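/- Identify $\mathbb C^d$ with $\mathbb R^{2d}$ through $x+i\xi\leftrightarrow(x,\xi)$, and let $|\cdot|$ denote Euclidean norms. **Weights.** A weight on $\mathbb R^{2d}$ is a positive function $\omega\in L^\infty_{loc}(\mathbb R^{2d})$ that is bounded from below by a positive constant on every compact set. It is *weakly subgaussian*, $\omega\in\mathscr P_Q^0(\mathbb R^{2d})$, if (i) there are $c,C>0$ such that $C^{-1}\omega(x)^2\le\omega(x+y)\,\omega(x-y)\le C\omega(x)^2$ whenever $|x|\ge 2c$ and $|y|\le c/|x|$, and (ii) for every $c>0$ there is $C>0$ such that $C^{-1}e^{-c|x|^2}\le\omega(x)\le Ce^{c|x|^2}$ for all $x$. **Mixed quasi-norm spaces.** Let $\mathbb R^{2d}=V_1\oplus\cdots\oplus V_n$ with linear subspaces $V_j$, and let $p_1,\dots,p_n\in(0,\infty]$. The mixed quasi-norm space $\mathscr B=L^{p}(V)$ has the quasi-norm $\|f\|_{\mathscr B}$ obtained from $(x_1,\dots,x_n)\mapsto |f(x_1+\cdots+x_n)|$, $x_j\in V_j$, by taking successively the $L^{p_1}(V_1)$ quasi-norm in $x_1$, the $L^{p_2}(V_2)$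 quasi-norm in $x_2$, ..., the $L^{p_n}(V_n)$ quasi-norm in $x_n$ (Lebesgue measure on each $V_j$). Put $\nu_1(\mathscr B)=\min_j p_j$. **Distributions and modulation spaces.** For $h>0$ let $\mathcal S_{1/2,h}(\mathbb R^d)$ be the space of all $f\in C^\infty(\mathbb R^d)$ for which $\|f\|_{\mathcal S_{1/2,h}}=\sup_{\alpha,\beta,x}|x^\beta\partial^\alpha f(x)|\,h^{-|\alpha|-|\beta|}(\alpha!\beta!)^{-1/2}$ is finite. Let $\mathcal S_{1/2}(\mathbb R^d)=\bigcup_{h>0}\mathcal S_{1/2,h}(\mathbb R^d)$, and let $\mathcal S_{1/2}'(\mathbb R^d)$ be the space of linear forms on $\mathcal S_{1/2}(\mathbb R^d)$ whose restriction to $\mathcal S_{1/2,h}(\mathbb R^d)$ is continuous for every $h>0$. With $\phi(y)=\pi^{-d/4}e^{-|y|^2/2}$, the short-time Fourier transform of $f\in\mathcal S'_{1/2}(\mathbb R^d)$ is $$V_\phi f(x,\xi)=(2\pi)^{-d/2}\langle f,\overline{\phi(\cdot-x)}\,e^{-i\langle\cdot,\xi\rangle}\rangle .$$ The modulation space $M(\omega,\mathscr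 B)$ consists of all $f\in\mathcal S_{1/2}'(\mathbb R^d)$ such that $\|f\|_{M(\omega,\mathscr B)}=\|V_\phi f\cdot\omega\|_{\mathscr B}<\infty$. **Bargmann transform and spaces of entire functions.** For $f\in\mathcal S_{1/2}'(\mathbb R^d)$ and $z\in\mathbb C^d$ let $$(\mathfrak Vf)(z)=\langle f,\mathfrak A_d(z,\cdot)\rangle,\qquad \mathfrak A_d(z,y)=\pi^{-d/4}\exp\Big(-\tfrac12(\langle z,z\rangle+|y|^2)+2^{1/2}\langle z,y\rangle\Big),\quad \langle z,w\rangle=\sum_j z_jw_j .$$ Let $(U_{\mathfrak V}G)(x,\xi)=(2\pi)^{d/2}e^{(|x|^2+|\xi|^2)/2}e^{-i\langle x,\xi\rangle}G(2^{1/2}x,-2^{1/2}\xi)$, so that $(U_{\mathfrak V}^{-1}F)(x,\xi)=(2\pi)^{-d/2}e^{-(|x|^2+|\xi|^2)/4}e^{-i\langle x,\xi\rangle/2}F(2^{-1/2}x,-2^{-1/2}\xi)$. For $0<r\le\nu_1(\mathscr B)$, let $B(\omega,\mathscr B)$ be the set of all $F\in L^r_{loc}(\mathbb C^d)$ such that $\|F\|_{B(\omega,\mathscr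 B)}=\|(U_{\mathfrak V}^{-1}F)\,\omega\|_{\mathscr B}<\infty$. Let $A(\omega,\mathscr B)$ be the set of all entire functions in $B(\omega,\mathscr B)$, with the quasi-norm of $B(\omega,\mathscr B)$. Let $A_0(\omega,\mathscr B)=\{\mathfrak Vf : f\in M(\omega,\mathscr B)\}$, with the quasi-norm $\|\mathfrak Vf\|_{A_0(\omega,\mathscr B)}=\|f\|_{M(\omega,\mathscr B)}$. **Theorem.** Let $\mathscr B$ be a mixed quasi-norm space on $\mathbb R^{2d}\simeq\mathbb C^d$, let $\omega\in\mathscr P_Q^0(\mathbb R^{2d})$, and let $0<r\le\nu_1(\mathscr B)$. Then $A_0(\omega,\mathscr B)=A(\omega,\mathscr B)$, with equal quasi-norms, and the map $f\mapsto\mathfrak Vf$ from $M(\omega,\mathscr B)$ to $A(\omega,\mathscr B)$ is isometric and bijective. -/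

import Mathlib

open MeasureTheory
open scoped ENNReal NNReal ComplexConjugate

noncomputable section

namespace BargmannMod

/-- `ℝ^d` with its Euclidean norm. -/
abbrev RSp (d : ℕ) : Type := EuclideanSpace ℝ (Fin d)

/-- `ℂ^d` with its Hermitian norm. As a real inner product space it is `ℝ^{2d}`, the point `(x, ξ)`
being identified with `x + iξ`. -/
abbrev CSp (d : ℕ) : Type := EuclideanSpace ℂ (Fin d)

/-- The real part `x` of `z = x + iξ`. -/
def rePart {d : ℕ} (z : CSp d) : RSp d := WithLp.toLp 2 fun j => (z j).re

/-- The imaginary part `ξ` of `z = x + iξ`. -/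
def imPart {d : ℕ} (z : CSp d) : RSp d := WithLp.toLp 2 fun j => (z j).im

/-- The point `x + iξ`. -/
def ofReIm {d : ℕ} (x ξ : RSp d) : CSp d := WithLp.toLp 2 fun j => (⟨x j, ξ j⟩ : ℂ)

/-! ### Weights -/

section Weights

variable {E : Type*} [NormedAddCommGroup E] [InnerProductSpace ℝ E] [FiniteDimensional ℝ E]
  [MeasurableSpace E] [BorelSpace E]

/-- A weight: a positive function in `L^∞_loc` that is bounded from below by a positive constant
on every compact set. -/
structure IsWeight (ω : E → ℝ) : Prop where
  pos : ∀ x, 0 < ω x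
  aemeasurable : AEMeasurable ω (volume : Measure E)
  locally_bounded : ∀ K : Set E, IsCompact K →
    ∃ C : ℝ, ∀ᵐ x ∂((volume : Measure E).restrict K), ω x ≤ C
  locally_bounded_below : ∀ K : Set E, IsCompact K → ∃ c : ℝ, 0 < c ∧ ∀ x ∈ K, c ≤ ω x

/-- Weights of weakly subgaussian type (the class `𝒫_Q^0`). -/
structure IsWeaklySubgaussian (ω : E → ℝ) : Prop extends IsWeight ω where
  local_cond : ∃ c C : ℝ, 0 < c ∧ 0 < C ∧ ∀ x y : E, 2 * c ≤ ‖x‖ → ‖y‖ ≤ c / ‖x‖ →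
    C⁻¹ * ω x ^ 2 ≤ ω (x + y) * ω (x - y) ∧ ω (x + y) * ω (x - y) ≤ C * ω x ^ 2
  subgaussian : ∀ c : ℝ, 0 < c → ∃ C : ℝ, 0 < C ∧ ∀ x : E,
    C⁻¹ * Real.exp (-c * ‖x‖ ^ 2) ≤ ω x ∧ ω x ≤ C * Real.exp (c * ‖x‖ ^ 2)

end Weights

/-! ### Mixed quasi-norm spaces -/

section Mixed

variable {E : Type*} [NormedAddCommGroup E] [InnerProductSpace ℝ E] [FiniteDimensional ℝ E]
  [MeasurableSpace E] [BorelSpace E]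

/-- Lebesgue measure on a linear subspace `V` of a Euclidean space. (The instance `volume` on the
subtype would be the restriction of the Lebesgue measure of the ambient space.) -/
def subspaceVolume (V : Submodule ℝ E) : Measure V :=
  (stdOrthonormalBasis ℝ V).toBasis.addHaar

/-- The iterated quasi-norm: first the `L^{p_1}(V_1)`-quasi-norm in `x_1`, then the
`L^{p_2}(V_2)`-quasi-norm in `x_2`, and so on, of `(x_1, …, x_n) ↦ f (x_1 + ⋯ + x_n)`,
where `x_j ∈ V_j`. -/
def iteratedNorm : (n : ℕ) → (Fin n → Submodule ℝ E) → (Fin n → ℝ≥0∞) → (E → ℝ≥0∞) → ℝ≥0∞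
  | 0, _, _, f => f 0
  | n + 1, V, p, f =>
      iteratedNorm n (fun j => V j.succ) (fun j => p j.succ)
        (fun y => eLpNorm (fun x : V 0 => f ((x : E) + y)) (p 0) (subspaceVolume (V 0)))

variable (E) in
/-- The data of a mixed quasi-norm space `L^p(V)` on `E`: a decomposition
`V_1 ⊕ ⋯ ⊕ V_n = E` and exponents `p_1, …, p_n ∈ (0, ∞]`. -/
structure MixedSpace where
  n : ℕ
  V : Fin n → Submodule ℝ E
  p : Fin n → ℝ≥0∞
  isInternal : DirectSum.IsInternal V
  p_pos : ∀ j, 0 < p j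

/-- The quasi-norm of the mixed quasi-norm space (with value `∞` outside the space). -/
def MixedSpace.norm (B : MixedSpace E) (f : E → ℂ) : ℝ≥0∞ :=
  iteratedNorm B.n B.V B.p fun x => ‖f x‖ₑ

/-- The smallest Lebesgue exponent `ν_1`. -/
def MixedSpace.minExponent (B : MixedSpace E) : ℝ≥0∞ := ⨅ j, B.p j

end Mixed

/-! ### Gelfand-Shilov spaces -/

section GelfandShilov

variable {d : ℕ}

/-- The partial derivative `∂_i`. -/
def pderiv (i : Fin d) (f : RSp d → ℂ) : RSp d → ℂ :=
  fun x => lineDeriv ℝ f x (EuclideanSpace.single i (1 : ℝ))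

/-- The partial derivative `∂^α`. -/
def mderiv (α : Fin d → ℕ) (f : RSp d → ℂ) : RSp d → ℂ :=
  (List.finRange d).foldr (fun i g => (pderiv i)^[α i] g) f

/-- The norm of `𝒮_{s,h}(ℝ^d)`: the supremum over all `α`, `β`, `x` of
`|x^β ∂^α f(x)| / (h^{|α| + |β|} (α! β!)^s)`. -/
def gsNorm (s h : ℝ) (f : RSp d → ℂ) : ℝ≥0∞ :=
  ⨆ (α : Fin d → ℕ) (β : Fin d → ℕ) (x : RSp d),
    ENNReal.ofReal (‖((∏ j, x j ^ β j : ℝ) : ℂ) * mderiv α f x‖ /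
      (h ^ ((∑ j, α j) + ∑ j, β j) *
        (((∏ j, (α j).factorial) * ∏ j, (β j).factorial : ℕ) : ℝ) ^ s))

lemma contDiff_pderiv {f : RSp d → ℂ} (hf : ContDiff ℝ (⊤ : ℕ∞) f) (i : Fin d) :
    ContDiff ℝ (⊤ : ℕ∞) (pderiv i f) := by
  have h : pderiv i f = fun x => fderiv ℝ f x (EuclideanSpace.single i (1 : ℝ)) := by
    funext x
    exact (hf.differentiable (by simp) x).lineDeriv_eq_fderiv
  rw [h]
  exact (hf.fderiv_right (m := ((⊤ : ℕ∞) : WithTop ℕ∞)) (by simp)).clm_apply contDiff_const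

lemma pderiv_lin {f g : RSp d → ℂ} (hf : ContDiff ℝ (⊤ : ℕ∞) f) (hg : ContDiff ℝ (⊤ : ℕ∞) g) (i : Fin d)
    (a b : ℂ) : pderiv i (a • f + b • g) = a • pderiv i f + b • pderiv i g := by
  funext x
  have h1 := ((hf.differentiable (by simp) x).lineDifferentiableAt
    (v := EuclideanSpace.single i (1 : ℝ))).hasLineDerivAt
  have h2 := ((hg.differentiable (by simp) x).lineDifferentiableAt
    (v := EuclideanSpace.single i (1 : ℝ))).hasLineDerivAt
  have h3 : HasLineDerivAt ℝ (a • f + b • g) (a • pderiv i f x + b • pderiv i g x) x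
      (EuclideanSpace.single i (1 : ℝ)) :=
    HasDerivAt.add (HasDerivAt.const_smul a h1) (HasDerivAt.const_smul b h2)
  exact h3.lineDeriv

lemma iterate_pderiv_lin (i : Fin d) (k : ℕ) (a b : ℂ) : ∀ {f g : RSp d → ℂ},
    ContDiff ℝ (⊤ : ℕ∞) f → ContDiff ℝ (⊤ : ℕ∞) g →
    ContDiff ℝ (⊤ : ℕ∞) ((pderiv i)^[k] f) ∧
    (pderiv i)^[k] (a • f + b • g) = a • (pderiv i)^[k] f + b • (pderiv i)^[k] g := by
  induction k with
  | zero => intro f g hf hg; exact ⟨hf, rfl⟩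
  | succ k ih =>
    intro f g hf hg
    simp only [Function.iterate_succ_apply]
    rw [pderiv_lin hf hg]
    exact ih (contDiff_pderiv hf i) (contDiff_pderiv hg i)

lemma foldr_pderiv_lin (α : Fin d → ℕ) {f g : RSp d → ℂ} (hf : ContDiff ℝ (⊤ : ℕ∞) f)
    (hg : ContDiff ℝ (⊤ : ℕ∞) g) (a b : ℂ) (l : List (Fin d)) :
    ContDiff ℝ (⊤ : ℕ∞) (l.foldr (fun i g => (pderiv i)^[α i] g) f) ∧
    ContDiff ℝ (⊤ : ℕ∞) (l.foldr (fun i g => (pderiv i)^[α i] g) g) ∧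
    l.foldr (fun i g => (pderiv i)^[α i] g) (a • f + b • g) =
      a • l.foldr (fun i g => (pderiv i)^[α i] g) f +
      b • l.foldr (fun i g => (pderiv i)^[α i] g) g := by
  induction l with
  | nil => exact ⟨hf, hg, rfl⟩
  | cons i l ih =>
    obtain ⟨h1, h2, h3⟩ := ih
    simp only [List.foldr_cons]
    rw [h3]
    exact ⟨(iterate_pderiv_lin i _ a b h1 h2).1, (iterate_pderiv_lin i _ a b h2 h1).1,
      (iterate_pderiv_lin i _ a b h1 h2).2⟩

lemma mderiv_lin (α : Fin d → ℕ) {f g : RSp d → ℂ} (hf : ContDiff ℝ (⊤ : ℕ∞) f)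
    (hg : ContDiff ℝ (⊤ : ℕ∞) g) (a b : ℂ) :
    mderiv α (a • f + b • g) = a • mderiv α f + b • mderiv α g :=
  (foldr_pderiv_lin α hf hg a b _).2.2

lemma gsNorm_lt_top_iff {s h : ℝ} (hh : 0 < h) {f : RSp d → ℂ} :
    gsNorm s h f < ∞ ↔ ∃ C : ℝ, 0 ≤ C ∧ ∀ (α β : Fin d → ℕ) (x : RSp d),
      ‖((∏ j, x j ^ β j : ℝ) : ℂ) * mderiv α f x‖ ≤ C * (h ^ ((∑ j, α j) + ∑ j, β j) *
        (((∏ j, (α j).factorial) * ∏ j, (β j).factorial : ℕ) : ℝ) ^ s) := by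
  have hpos : ∀ α β : Fin d → ℕ, 0 < h ^ ((∑ j, α j) + ∑ j, β j) *
        (((∏ j, (α j).factorial) * ∏ j, (β j).factorial : ℕ) : ℝ) ^ s := by
    intro α β
    have : (0 : ℝ) < (((∏ j, (α j).factorial) * ∏ j, (β j).factorial : ℕ) : ℝ) := by
      exact_mod_cast Nat.mul_pos (Finset.prod_pos fun j _ => Nat.factorial_pos _)
        (Finset.prod_pos fun j _ => Nat.factorial_pos _)
    positivity
  constructor
  · intro hf
    refine ⟨(gsNorm s h f).toReal, ENNReal.toReal_nonneg, fun α β x => ?_⟩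
    rw [← div_le_iff₀ (hpos α β)]
    rw [← ENNReal.ofReal_le_iff_le_toReal hf.ne]
    exact le_iSup_of_le α (le_iSup_of_le β (le_iSup_of_le x le_rfl))
  · rintro ⟨C, hC, H⟩
    refine lt_of_le_of_lt ?_ (ENNReal.ofReal_lt_top (r := C))
    refine iSup_le fun α => iSup_le fun β => iSup_le fun x => ?_
    exact ENNReal.ofReal_le_ofReal ((div_le_iff₀ (hpos α β)).2 (H α β x))

lemma gs_lin {s : ℝ} {f g : RSp d → ℂ} (a b : ℂ)
    (hf : ContDiff ℝ (⊤ : ℕ∞) f ∧ ∃ h : ℝ, 0 < h ∧ gsNorm s h f < ∞)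
    (hg : ContDiff ℝ (⊤ : ℕ∞) g ∧ ∃ h : ℝ, 0 < h ∧ gsNorm s h g < ∞) :
    ContDiff ℝ (⊤ : ℕ∞) (a • f + b • g) ∧ ∃ h : ℝ, 0 < h ∧ gsNorm s h (a • f + b • g) < ∞ := by
  obtain ⟨hf, h₁, hh₁, hf'⟩ := hf
  obtain ⟨hg, h₂, hh₂, hg'⟩ := hg
  refine ⟨(contDiff_const.smul hf).add (contDiff_const.smul hg), max h₁ h₂,
    lt_max_of_lt_left hh₁, ?_⟩
  rw [gsNorm_lt_top_iff hh₁] at hf'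
  rw [gsNorm_lt_top_iff hh₂] at hg'
  rw [gsNorm_lt_top_iff (lt_max_of_lt_left hh₁)]
  obtain ⟨C₁, hC₁, H₁⟩ := hf'
  obtain ⟨C₂, hC₂, H₂⟩ := hg'
  refine ⟨‖a‖ * C₁ + ‖b‖ * C₂, by positivity, fun α β x => ?_⟩
  rw [mderiv_lin α hf hg a b]
  set m : ℂ := ((∏ j, x j ^ β j : ℝ) : ℂ)
  set F : ℝ := (((∏ j, (α j).factorial) * ∏ j, (β j).factorial : ℕ) : ℝ) ^ s
  have hF : 0 ≤ F := by positivity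
  have e : m * (a • mderiv α f + b • mderiv α g) x =
      a * (m * mderiv α f x) + b * (m * mderiv α g x) := by
    simp only [Pi.add_apply, Pi.smul_apply, smul_eq_mul]; ring
  rw [e]
  calc ‖a * (m * mderiv α f x) + b * (m * mderiv α g x)‖
      ≤ ‖a‖ * ‖m * mderiv α f x‖ + ‖b‖ * ‖m * mderiv α g x‖ := by
        rw [← norm_mul a, ← norm_mul b]; exact norm_add_le _ _
    _ ≤ ‖a‖ * (C₁ * (max h₁ h₂ ^ ((∑ j, α j) + ∑ j, β j) * F)) +
        ‖b‖ * (C₂ * (max h₁ h₂ ^ ((∑ j, α j) + ∑ j, β j) * F)) := by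
        refine add_le_add (mul_le_mul_of_nonneg_left ((H₁ α β x).trans ?_) (norm_nonneg _))
          (mul_le_mul_of_nonneg_left ((H₂ α β x).trans ?_) (norm_nonneg _))
        · have := pow_le_pow_left₀ hh₁.le (le_max_left h₁ h₂) ((∑ j, α j) + ∑ j, β j)
          gcongr
        · have := pow_le_pow_left₀ hh₂.le (le_max_right h₁ h₂) ((∑ j, α j) + ∑ j, β j)
          gcongr
    _ = _ := by ring

variable (d) in
/-- The Gelfand-Shilov space `𝒮_s(ℝ^d)`, the union over `h > 0` of the spaces `𝒮_{s,h}(ℝ^d)` of all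
smooth functions with finite `gsNorm s h`. -/
def GelfandShilov (s : ℝ) : Submodule ℂ (RSp d → ℂ) where
  carrier := {f | ContDiff ℝ (⊤ : ℕ∞) f ∧ ∃ h : ℝ, 0 < h ∧ gsNorm s h f < ∞}
  add_mem' := by
    intro f g hf hg
    simpa using gs_lin 1 1 hf hg
  zero_mem' := by
    have h0 : ContDiff ℝ (⊤ : ℕ∞) (0 : RSp d → ℂ) := contDiff_const
    refine ⟨h0, 1, one_pos, ?_⟩
    rw [gsNorm_lt_top_iff one_pos]
    refine ⟨0, le_rfl, fun α β x => ?_⟩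
    have : mderiv α (0 : RSp d → ℂ) = 0 := by
      simpa using mderiv_lin α h0 h0 0 0
    simp [this]
  smul_mem' := by
    intro c f hf
    simpa using gs_lin c 0 hf hf

variable (d) in
/-- The distribution space `𝒮_s'(ℝ^d)`: the linear forms on `𝒮_s(ℝ^d)` whose restriction to
`𝒮_{s,h}(ℝ^d)` is continuous for every `h > 0`. -/
def GelfandShilovDual (s : ℝ) : Submodule ℂ (GelfandShilov d s →ₗ[ℂ] ℂ) where
  carrier := {u | ∀ h : ℝ, 0 < h → ∃ C : ℝ≥0, ∀ φ : GelfandShilov d s,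
    gsNorm s h (φ : RSp d → ℂ) < ∞ → ‖u φ‖ₑ ≤ C * gsNorm s h (φ : RSp d → ℂ)}
  add_mem' := by
    intro u v hu hv h hh
    obtain ⟨C₁, H₁⟩ := hu h hh
    obtain ⟨C₂, H₂⟩ := hv h hh
    refine ⟨C₁ + C₂, fun φ hφ => ?_⟩
    rw [LinearMap.add_apply, ENNReal.coe_add, add_mul]
    exact (enorm_add_le _ _).trans (add_le_add (H₁ φ hφ) (H₂ φ hφ))
  zero_mem' := by
    intro h _
    exact ⟨0, fun φ _ => by simp⟩
  smul_mem' := by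
    intro c u hu h hh
    obtain ⟨C, H⟩ := hu h hh
    refine ⟨‖c‖₊ * C, fun φ hφ => ?_⟩
    rw [LinearMap.smul_apply, smul_eq_mul, enorm_mul, ENNReal.coe_mul, mul_assoc]
    exact mul_le_mul_right (H φ hφ) _

end GelfandShilov

/-! ### Gaussian test functions -/

section Gauss

variable {d : ℕ}

/-- `t ↦ exp (-t²/2 + w t)` on `ℂ`. -/
def gauss1 (w t : ℂ) : ℂ := Complex.exp (-(t ^ 2) / 2 + w * t)

lemma differentiable_gauss1 (w : ℂ) : Differentiable ℂ (gauss1 w) := by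
  unfold gauss1; fun_prop

lemma norm_gauss1_le (w : ℂ) (t r : ℝ) (z : ℂ) (hz : ‖z - t‖ = r) :
    ‖gauss1 w z‖ ≤ Real.exp (5 * ‖w‖ ^ 2) * Real.exp (r ^ 2) * Real.exp (-(t ^ 2) / 8) := by
  rw [gauss1, Complex.norm_exp, ← Real.exp_add, ← Real.exp_add, Real.exp_le_exp]
  have h1 : (-(z ^ 2) / 2 + w * z).re = -(z.re ^ 2 - z.im ^ 2) / 2 + (w * z).re := by
    simp [pow_two]
  have h2 : (w * z).re ≤ ‖w‖ * ‖z‖ := (Complex.re_le_norm _).trans (norm_mul_le _ _)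
  have h3 : ‖z‖ ≤ |t| + r := by
    calc ‖z‖ = ‖(t : ℂ) + (z - t)‖ := by ring_nf
      _ ≤ |t| + r := by
        refine (norm_add_le _ _).trans ?_
        rw [hz, Complex.norm_real, Real.norm_eq_abs]
  have h4 : r ^ 2 = (z.re - t) ^ 2 + z.im ^ 2 := by
    rw [← hz, ← Complex.normSq_eq_norm_sq, Complex.normSq_apply]
    simp; ring
  have h5 : ‖w‖ * ‖z‖ ≤ ‖w‖ * (|t| + r) := mul_le_mul_of_nonneg_left h3 (norm_nonneg _)
  rw [h1]
  nlinarith [sq_nonneg (‖w‖ - r), sq_nonneg (4 * ‖w‖ - |t|), sq_abs t,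
    sq_nonneg (2 * (z.re - t) + t), norm_nonneg w]

lemma gauss1_deriv_bound (w : ℂ) (a b : ℕ) (t : ℝ) :
    |t| ^ b * ‖iteratedDeriv a (gauss1 w) t‖ ≤ Real.exp (5 * ‖w‖ ^ 2 + 1) *
      (3 ^ (a + b) * (Real.sqrt a.factorial * Real.sqrt b.factorial)) := by
  have hr : (0 : ℝ) < Real.sqrt (a + 1) := Real.sqrt_pos.2 (by positivity)
  have hc := Complex.norm_iteratedDeriv_le_of_forall_mem_sphere_norm_le (c := (t : ℂ)) a hr
    (f := gauss1 w) (differentiable_gauss1 w).diffContOnCl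
    (C := Real.exp (5 * ‖w‖ ^ 2) * Real.exp (a + 1) * Real.exp (-(t ^ 2) / 8)) (by
      intro z hz
      have := norm_gauss1_le w t (Real.sqrt (a + 1)) z (by simpa [dist_eq_norm] using hz)
      rwa [Real.sq_sqrt (by positivity)] at this)
  have hfac : (a.factorial : ℝ) ≤ Real.sqrt a.factorial * Real.sqrt (a + 1) ^ a := by
    have h1 : (a.factorial : ℝ) ≤ ((a : ℝ) + 1) ^ a := by
      have : a.factorial ≤ (a + 1) ^ a :=
        (Nat.factorial_le_pow a).trans (Nat.pow_le_pow_left (Nat.le_succ a) a)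
      exact_mod_cast this
    have h2 : Real.sqrt a.factorial ≤ Real.sqrt (a + 1) ^ a := by
      refine Real.sqrt_le_iff.2 ⟨by positivity, ?_⟩
      rw [← pow_mul, mul_comm a 2, pow_mul, Real.sq_sqrt (by positivity)]
      exact h1
    calc (a.factorial : ℝ) = Real.sqrt a.factorial * Real.sqrt a.factorial :=
          (Real.mul_self_sqrt (by positivity)).symm
      _ ≤ _ := mul_le_mul_of_nonneg_left h2 (Real.sqrt_nonneg _)
  have hpow : |t| ^ b * Real.exp (-(t ^ 2) / 8) ≤ 2 ^ b * Real.sqrt b.factorial := by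
    have h1 := Real.pow_div_factorial_le_exp (t ^ 2 / 4) (by positivity) b
    rw [div_le_iff₀ (by positivity)] at h1
    refine le_of_sq_le_sq ?_ (by positivity)
    have e1 : (|t| ^ b * Real.exp (-(t ^ 2) / 8)) ^ 2 =
        4 ^ b * ((t ^ 2 / 4) ^ b * Real.exp (-(t ^ 2 / 4))) := by
      rw [mul_pow, ← Real.exp_nat_mul, div_pow, ← pow_mul, mul_comm b 2, pow_mul, sq_abs]
      rw [show ((2 : ℕ) : ℝ) * (-(t ^ 2) / 8) = -(t ^ 2 / 4) by push_cast; ring]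
      field_simp
    have e2 : (2 ^ b * Real.sqrt b.factorial) ^ 2 = 4 ^ b * (b.factorial : ℝ) := by
      rw [mul_pow, Real.sq_sqrt (by positivity), ← pow_mul, mul_comm b 2, pow_mul]; norm_num
    rw [e1, e2]
    refine mul_le_mul_of_nonneg_left ?_ (by positivity)
    calc (t ^ 2 / 4) ^ b * Real.exp (-(t ^ 2 / 4))
        ≤ Real.exp (t ^ 2 / 4) * b.factorial * Real.exp (-(t ^ 2 / 4)) :=
          mul_le_mul_of_nonneg_right h1 (Real.exp_nonneg _)
      _ = b.factorial * (Real.exp (t ^ 2 / 4) * Real.exp (-(t ^ 2 / 4))) := by ring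
      _ = b.factorial := by rw [← Real.exp_add]; simp
  have hexp : Real.exp a ≤ 3 ^ a := by
    rw [← mul_one (a : ℝ), Real.exp_nat_mul]
    exact pow_le_pow_left₀ (Real.exp_nonneg _) (Real.exp_one_lt_d9.le.trans (by norm_num)) _
  have hder : ‖iteratedDeriv a (gauss1 w) t‖ ≤ Real.sqrt a.factorial *
      (Real.exp (5 * ‖w‖ ^ 2) * Real.exp (a + 1) * Real.exp (-(t ^ 2) / 8)) := by
    refine hc.trans ?_
    rw [div_le_iff₀ (by positivity)]
    nlinarith [mul_le_mul_of_nonneg_right hfac (show 0 ≤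
      (Real.exp (5 * ‖w‖ ^ 2) * Real.exp (a + 1) * Real.exp (-(t ^ 2) / 8)) by positivity)]
  calc |t| ^ b * ‖iteratedDeriv a (gauss1 w) t‖
      ≤ |t| ^ b * (Real.sqrt a.factorial *
      (Real.exp (5 * ‖w‖ ^ 2) * Real.exp (a + 1) * Real.exp (-(t ^ 2) / 8))) := by gcongr
    _ = Real.sqrt a.factorial * Real.exp (5 * ‖w‖ ^ 2) * Real.exp (a + 1) *
      (|t| ^ b * Real.exp (-(t ^ 2) / 8)) := by ring
    _ ≤ Real.sqrt a.factorial * Real.exp (5 * ‖w‖ ^ 2) * (3 ^ a * Real.exp 1) *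
      (3 ^ b * Real.sqrt b.factorial) := by
        rw [Real.exp_add (a : ℝ) 1]
        have h23 : (2 : ℝ) ^ b ≤ 3 ^ b := pow_le_pow_left₀ (by norm_num) (by norm_num) _
        have h24 := hpow.trans (mul_le_mul_of_nonneg_right h23 (Real.sqrt_nonneg _))
        gcongr
    _ = _ := by rw [Real.exp_add, pow_add]; ring

/-- The tensor product of derivatives of one-dimensional Gaussians. -/
def gaussDeriv (w : Fin d → ℂ) (a : Fin d → ℕ) (y : RSp d) : ℂ :=
  ∏ j, iteratedDeriv (a j) (gauss1 (w j)) (y j : ℂ)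

lemma pderiv_gaussDeriv (w : Fin d → ℂ) (a : Fin d → ℕ) (i : Fin d) :
    pderiv i (gaussDeriv w a) = gaussDeriv w (Function.update a i (a i + 1)) := by
  funext y
  have hsm : ContDiff ℂ (⊤ : ℕ∞) (gauss1 (w i)) := (differentiable_gauss1 (w i)).contDiff
  have hd : HasDerivAt (iteratedDeriv (a i) (gauss1 (w i)))
      (iteratedDeriv (a i + 1) (gauss1 (w i)) ((y i : ℝ) : ℂ)) ((y i : ℝ) : ℂ) := by
    rw [iteratedDeriv_succ]
    exact ((hsm.differentiable_iteratedDeriv (a i)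
      (by exact_mod_cast ENat.natCast_lt_top _)) _).hasDerivAt
  have hd2 : HasDerivAt (fun t : ℝ => iteratedDeriv (a i) (gauss1 (w i)) ((y i + t : ℝ) : ℂ))
      (iteratedDeriv (a i + 1) (gauss1 (w i)) ((y i : ℝ) : ℂ)) 0 := by
    have h0 : HasDerivAt (fun t : ℝ => y i + t) 1 0 := by
      simpa using (hasDerivAt_id (0 : ℝ)).const_add (y i)
    have h1 : HasDerivAt (fun s : ℝ => iteratedDeriv (a i) (gauss1 (w i)) (s : ℂ))
      (iteratedDeriv (a i + 1) (gauss1 (w i)) ((y i : ℝ) : ℂ)) (y i + 0) := by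
      simpa using hd.comp_ofReal
    have h2 := h1.scomp (0 : ℝ) h0
    rw [one_smul] at h2
    exact h2
  have key : HasLineDerivAt ℝ (gaussDeriv w a)
      (gaussDeriv w (Function.update a i (a i + 1)) y) y (EuclideanSpace.single i (1 : ℝ)) := by
    unfold HasLineDerivAt
    have e1 : (fun t : ℝ => gaussDeriv w a (y + t • EuclideanSpace.single i (1 : ℝ))) =
        fun t : ℝ => iteratedDeriv (a i) (gauss1 (w i)) ((y i + t : ℝ) : ℂ) *
          ∏ j ∈ Finset.univ.erase i, iteratedDeriv (a j) (gauss1 (w j)) (y j : ℂ) := by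
      funext t
      rw [gaussDeriv, ← Finset.mul_prod_erase _ _ (Finset.mem_univ i)]
      congr 1
      · simp
      · refine Finset.prod_congr rfl fun j hj => ?_
        have : j ≠ i := Finset.ne_of_mem_erase hj
        simp [this]
    have e2 : gaussDeriv w (Function.update a i (a i + 1)) y =
        iteratedDeriv (a i + 1) (gauss1 (w i)) ((y i : ℝ) : ℂ) *
          ∏ j ∈ Finset.univ.erase i, iteratedDeriv (a j) (gauss1 (w j)) (y j : ℂ) := by
      rw [gaussDeriv, ← Finset.mul_prod_erase _ _ (Finset.mem_univ i)]
      congr 1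
      · simp
      · refine Finset.prod_congr rfl fun j hj => ?_
        have : j ≠ i := Finset.ne_of_mem_erase hj
        simp [this]
    rw [e1, e2]
    exact hd2.mul_const _
  exact key.lineDeriv

lemma iterate_pderiv_gaussDeriv (w : Fin d → ℂ) (i : Fin d) (k : ℕ) (a : Fin d → ℕ) :
    (pderiv i)^[k] (gaussDeriv w a) = gaussDeriv w (Function.update a i (a i + k)) := by
  induction k generalizing a with
  | zero => simp
  | succ k ih =>
    rw [Function.iterate_succ_apply, pderiv_gaussDeriv, ih]
    simp [add_comm, add_left_comm]

lemma mderiv_gaussDeriv (w : Fin d → ℂ) (α : Fin d → ℕ) :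
    mderiv α (gaussDeriv w 0) = gaussDeriv w α := by
  have key : ∀ l : List (Fin d), l.Nodup →
      l.foldr (fun i g => (pderiv i)^[α i] g) (gaussDeriv w 0) =
        gaussDeriv w (fun j => if j ∈ l then α j else 0) := by
    intro l
    induction l with
    | nil => intro _; rfl
    | cons i l ih =>
      intro hl
      rw [List.nodup_cons] at hl
      rw [List.foldr_cons, ih hl.2, iterate_pderiv_gaussDeriv]
      congr 1
      funext j
      by_cases hj : j = i
      · subst hj; simp [hl.1]
      · simp [hj]
  have := key _ (List.nodup_finRange d)
  simpa [mderiv] using this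

lemma gaussDeriv_zero_mem (w : Fin d → ℂ) : gaussDeriv w 0 ∈ GelfandShilov d (1 / 2) := by
  constructor
  · unfold gaussDeriv
    simp only [Pi.zero_apply, iteratedDeriv_zero, gauss1]
    refine contDiff_prod fun j _ => ?_
    have h : ContDiff ℝ (⊤ : ℕ∞) fun y : RSp d => ((y j : ℝ) : ℂ) :=
      Complex.ofRealCLM.contDiff.comp (EuclideanSpace.proj (𝕜 := ℝ) j).contDiff
    exact ((h.pow 2).neg.div_const 2 |>.add (contDiff_const.mul h)).cexp
  · refine ⟨3, by norm_num, ?_⟩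
    rw [gsNorm_lt_top_iff (by norm_num)]
    refine ⟨∏ j, Real.exp (5 * ‖w j‖ ^ 2 + 1), by positivity, fun α β x => ?_⟩
    rw [mderiv_gaussDeriv, gaussDeriv, norm_mul, Complex.norm_real, norm_prod, norm_prod,
      ← Finset.prod_mul_distrib, ← Real.sqrt_eq_rpow, Nat.cast_mul, Nat.cast_prod, Nat.cast_prod,
      Real.sqrt_mul (by positivity), Real.sqrt_prod _ (fun _ _ => by positivity),
      Real.sqrt_prod _ (fun _ _ => by positivity), ← Finset.sum_add_distrib,
      ← Finset.prod_pow_eq_pow_sum, ← Finset.prod_mul_distrib, ← Finset.prod_mul_distrib,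
      ← Finset.prod_mul_distrib]
    refine Finset.prod_le_prod (fun _ _ => by positivity) fun j _ => ?_
    rw [norm_pow, Real.norm_eq_abs]
    exact gauss1_deriv_bound (w j) (α j) (β j) (x j)

lemma gaussDeriv_zero_apply (w : Fin d → ℂ) (y : RSp d) :
    gaussDeriv w 0 y = Complex.exp (-((‖y‖ ^ 2 : ℝ) : ℂ) / 2 + ∑ j, w j * (y j : ℂ)) := by
  simp only [gaussDeriv, Pi.zero_apply, iteratedDeriv_zero, gauss1]
  rw [← Complex.exp_sum, Finset.sum_add_distrib, EuclideanSpace.norm_sq_eq]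
  congr 2
  simp [← Finset.sum_div, Finset.sum_neg_distrib]

end Gauss

/-! ### The short-time Fourier transform and modulation spaces -/

section Transforms

variable {d : ℕ}

/-- The Gaussian window `φ(y) = π^{-d/4} e^{-|y|²/2}`. -/
def gaussWindow (y : RSp d) : ℂ :=
  ((Real.pi ^ (-(d : ℝ) / 4) * Real.exp (-‖y‖ ^ 2 / 2) : ℝ) : ℂ)

/-- The test function `y ↦ conj (φ(y - x)) e^{-i⟨y, ξ⟩}`. -/
def stftAtom (x ξ : RSp d) (y : RSp d) : ℂ :=
  conj (gaussWindow (y - x)) * Complex.exp (-Complex.I * ((inner ℝ y ξ : ℝ) : ℂ))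

lemma stftAtom_mem (x ξ : RSp d) : stftAtom x ξ ∈ GelfandShilov d (1 / 2) := by
  have e : stftAtom x ξ = (((Real.pi ^ (-(d : ℝ) / 4) * Real.exp (-‖x‖ ^ 2 / 2) : ℝ) : ℂ)) •
      gaussDeriv (fun j => (x j : ℂ) - Complex.I * (ξ j : ℂ)) 0 := by
    funext y
    have h1 : ∑ j, ((x j : ℂ) - Complex.I * (ξ j : ℂ)) * (y j : ℂ) =
        ((inner ℝ y x : ℝ) : ℂ) - Complex.I * ((inner ℝ y ξ : ℝ) : ℂ) := by
      simp only [PiLp.inner_apply, RCLike.inner_apply, conj_trivial, Complex.ofReal_sum,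
        Complex.ofReal_mul, Finset.mul_sum, ← Finset.sum_sub_distrib]
      exact Finset.sum_congr rfl fun j _ => by ring
    rw [Pi.smul_apply, gaussDeriv_zero_apply, h1, stftAtom, gaussWindow, Complex.conj_ofReal,
      norm_sub_sq_real, smul_eq_mul]
    push_cast
    rw [mul_assoc, mul_assoc, ← Complex.exp_add, ← Complex.exp_add]
    congr 2
    ring
  rw [e]
  exact Submodule.smul_mem _ _ (gaussDeriv_zero_mem _)

/-- The short-time Fourier transform `V_φ f (x, ξ)` of `f ∈ 𝒮_{1/2}'(ℝ^d)` with respect to the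
Gaussian window, as a function of `x + iξ`; for functions `f` it is
`(2π)^{-d/2} ∫ f(y) conj (φ(y - x)) e^{-i⟨y, ξ⟩} dy`. -/
def stft (f : GelfandShilovDual d (1 / 2)) (z : CSp d) : ℂ :=
  (((2 * Real.pi) ^ (-(d : ℝ) / 2) : ℝ) : ℂ) *
    f.1 ⟨stftAtom (rePart z) (imPart z), stftAtom_mem _ _⟩

/-- The quasi-norm of the modulation space `M(ω, ℬ)`. -/
def modNorm (ω : CSp d → ℝ) (B : MixedSpace (CSp d)) (f : GelfandShilovDual d (1 / 2)) : ℝ≥0∞ :=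
  B.norm fun z => stft f z * (ω z : ℂ)

/-- The modulation space `M(ω, ℬ)`. -/
def modSpace (ω : CSp d → ℝ) (B : MixedSpace (CSp d)) : Set (GelfandShilovDual d (1 / 2)) :=
  {f | modNorm ω B f < ∞}

/-! ### The Bargmann transform -/

/-- The Bargmann kernel
`𝔄_d(z, y) = π^{-d/4} exp (-(⟨z, z⟩ + |y|²) / 2 + √2 ⟨z, y⟩)`, where `⟨z, w⟩ = ∑ z_j w_j`. -/
def bargmannKernel (z : CSp d) (y : RSp d) : ℂ :=
  ((Real.pi ^ (-(d : ℝ) / 4) : ℝ) : ℂ) *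
    Complex.exp (-(1 / 2) * ((∑ j, z j * z j) + ((‖y‖ ^ 2 : ℝ) : ℂ)) +
      ((Real.sqrt 2 : ℝ) : ℂ) * ∑ j, z j * (y j : ℂ))

lemma bargmannKernel_mem (z : CSp d) : bargmannKernel z ∈ GelfandShilov d (1 / 2) := by
  have e : bargmannKernel z = (((Real.pi ^ (-(d : ℝ) / 4) : ℝ) : ℂ) *
      Complex.exp (-(1 / 2) * ∑ j, z j * z j)) •
      gaussDeriv (fun j => ((Real.sqrt 2 : ℝ) : ℂ) * z j) 0 := by
    funext y
    rw [Pi.smul_apply, gaussDeriv_zero_apply, bargmannKernel, smul_eq_mul, mul_assoc,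
      ← Complex.exp_add, Finset.mul_sum]
    congr 2
    simp only [mul_assoc]
    ring
  rw [e]
  exact Submodule.smul_mem _ _ (gaussDeriv_zero_mem _)

/-- The Bargmann transform `(𝔙 f)(z) = ⟨f, 𝔄_d(z, ·)⟩` of `f ∈ 𝒮_{1/2}'(ℝ^d)`. -/
def bargmann : GelfandShilovDual d (1 / 2) →ₗ[ℂ] (CSp d → ℂ) where
  toFun f z := f.1 ⟨bargmannKernel z, bargmannKernel_mem z⟩
  map_add' _ _ := rfl
  map_smul' _ _ := rfl

/-- The operator `U_𝔙`, given by
`(U_𝔙 G)(x, ξ) = (2π)^{d/2} e^{(|x|² + |ξ|²)/2} e^{-i⟨x, ξ⟩} G(√2 x, -√2 ξ)`. -/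
def bargU (G : CSp d → ℂ) (z : CSp d) : ℂ :=
  (((2 * Real.pi) ^ ((d : ℝ) / 2) * Real.exp ((‖rePart z‖ ^ 2 + ‖imPart z‖ ^ 2) / 2) : ℝ) : ℂ) *
    Complex.exp (-Complex.I * ((inner ℝ (rePart z) (imPart z) : ℝ) : ℂ)) *
    G (ofReIm (Real.sqrt 2 • rePart z) (-(Real.sqrt 2 • imPart z)))

/-- The inverse of `U_𝔙`, given by
`(U_𝔙⁻¹ F)(x, ξ) = (2π)^{-d/2} e^{-(|x|² + |ξ|²)/4} e^{-i⟨x, ξ⟩/2} F(x/√2, -ξ/√2)`. -/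
def bargUInv (F : CSp d → ℂ) (z : CSp d) : ℂ :=
  (((2 * Real.pi) ^ (-(d : ℝ) / 2) *
      Real.exp (-(‖rePart z‖ ^ 2 + ‖imPart z‖ ^ 2) / 4) : ℝ) : ℂ) *
    Complex.exp (-Complex.I * ((inner ℝ (rePart z) (imPart z) : ℝ) : ℂ) / 2) *
    F (ofReIm ((Real.sqrt 2)⁻¹ • rePart z) (-((Real.sqrt 2)⁻¹ • imPart z)))

lemma bargU_bargUInv (F : CSp d → ℂ) : bargU (bargUInv F) = F := by
  funext z
  have h2 : Real.sqrt 2 ≠ 0 := by positivity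
  have hre : rePart (ofReIm (Real.sqrt 2 • rePart z) (-(Real.sqrt 2 • imPart z))) =
    Real.sqrt 2 • rePart z := rfl
  have him : imPart (ofReIm (Real.sqrt 2 • rePart z) (-(Real.sqrt 2 • imPart z))) =
    -(Real.sqrt 2 • imPart z) := rfl
  have hz : ofReIm (rePart z) (imPart z) = z := rfl
  have hpi : (2 * Real.pi) ^ ((d : ℝ) / 2) * (2 * Real.pi) ^ (-(d : ℝ) / 2) = 1 := by
    rw [← Real.rpow_add (by positivity)]; ring_nf; simp
  have hss : Real.sqrt 2 * Real.sqrt 2 = 2 := Real.mul_self_sqrt (by norm_num)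
  rw [bargU, bargUInv, hre, him, smul_neg, neg_neg, smul_smul, smul_smul, inv_mul_cancel₀ h2,
    one_smul, one_smul, hz, norm_neg, norm_smul, norm_smul, inner_neg_right, inner_smul_left,
    inner_smul_right, mul_pow, mul_pow, Real.norm_of_nonneg (Real.sqrt_nonneg 2),
    Real.sq_sqrt (by norm_num : (0 : ℝ) ≤ 2), conj_trivial, ← mul_assoc (Real.sqrt 2), hss]
  set X := ‖rePart z‖ ^ 2
  set Y := ‖imPart z‖ ^ 2
  set I := inner ℝ (rePart z) (imPart z)
  have e1 : Real.exp ((X + Y) / 2) * Real.exp (-(2 * X + 2 * Y) / 4) = 1 := by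
    rw [← Real.exp_add]; ring_nf; simp
  have e2 : Complex.exp (-Complex.I * (I : ℂ)) *
      Complex.exp (-Complex.I * ((-(2 * I) : ℝ) : ℂ) / 2) = 1 := by
    rw [← Complex.exp_add]; push_cast; ring_nf; simp
  have e3 : (((2 * Real.pi) ^ ((d : ℝ) / 2) * Real.exp ((X + Y) / 2) : ℝ) : ℂ) *
      (((2 * Real.pi) ^ (-(d : ℝ) / 2) * Real.exp (-(2 * X + 2 * Y) / 4) : ℝ) : ℂ) = 1 := by
    rw [← Complex.ofReal_mul, mul_mul_mul_comm, hpi, e1]; simp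
  linear_combination (F z) * e2 * (((2 * Real.pi) ^ ((d : ℝ) / 2) * Real.exp ((X + Y) / 2) : ℝ) : ℂ) *
      (((2 * Real.pi) ^ (-(d : ℝ) / 2) * Real.exp (-(2 * X + 2 * Y) / 4) : ℝ) : ℂ) + (F z) * e3

/-- The quasi-norm of `B(ω, ℬ)`. -/
def bNorm (ω : CSp d → ℝ) (B : MixedSpace (CSp d)) (F : CSp d → ℂ) : ℝ≥0∞ :=
  B.norm fun z => bargUInv F z * (ω z : ℂ)

/-- The space `B(ω, ℬ)`, consisting of all `F ∈ L^r_loc(ℂ^d)` with finite quasi-norm. -/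
def bSpace (r : ℝ≥0∞) (ω : CSp d → ℝ) (B : MixedSpace (CSp d)) : Set (CSp d → ℂ) :=
  {F | (∀ K : Set (CSp d), IsCompact K → MemLp F r ((volume : Measure (CSp d)).restrict K)) ∧
    bNorm ω B F < ∞}

/-- The space `A(ω, ℬ)` of all entire functions in `B(ω, ℬ)`. -/
def aSpace (r : ℝ≥0∞) (ω : CSp d → ℝ) (B : MixedSpace (CSp d)) : Set (CSp d → ℂ) :=
  {F | Differentiable ℂ F} ∩ bSpace r ω B

/-- The space `A_0(ω, ℬ)`, the image of `M(ω, ℬ)` under the Bargmann transform. -/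
def aZeroSpace (ω : CSp d → ℝ) (B : MixedSpace (CSp d)) : Set (CSp d → ℂ) :=
  bargmann '' modSpace ω B

/-- The quasi-norm of `A_0(ω, ℬ)`, which takes `F = 𝔙 f` to the quasi-norm of `f` in `M(ω, ℬ)`.
(The infimum is over the single preimage `f` of `F`, as `𝔙` is injective.) -/
def aZeroNorm (ω : CSp d → ℝ) (B : MixedSpace (CSp d)) (F : CSp d → ℂ) : ℝ≥0∞ :=
  ⨅ (f : GelfandShilovDual d (1 / 2)) (_ : f ∈ modSpace ω B ∧ bargmann f = F), modNorm ω B f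

end Transforms

end BargmannMod

end

/-! Up to an explicit factor, the Gaussian atom of the short-time Fourier transform at `(x, ξ)` is
the Bargmann kernel at `(x - iξ)/√2`, and that factor is the one in `bargUInv`. Hence `bargUInv
(bargmann f) = stft f` (`bargUInv_bargmann`), which makes every norm identity immediate. What
remains is that `𝔙f` is entire, that `𝔙` is injective, and, as the main point, that every entire `F`
of finite quasi-norm is `𝔙f` for some distribution `f`; this `f` then lies in the modulation space
because the norms agree.

Distributions are handled through the formula `u(φ) = ∫ V_φ φ · u(atom)` over phase space
(`gsDual_apply_eq_integral`). Here the short-time Fourier transform of a test function in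
`𝒮_{1/2,h}` has Gaussian decay at a rate depending on `h` only, while that of a distribution is
`O(exp(ε|·|²))` for every `ε > 0`. Injectivity is a direct consequence. Inserting the Bargmann
kernel writes `𝔙u(w)` as an integral of `exp⟨q, w⟩` against a function of `q` with Gaussian decay,
which is entire in `w`.

Surjectivity has an analytic and an algebraic half. In the analytic half
(`exists_norm_bargUInv_le`), `|F|^s` satisfies a sub-mean value inequality on unit balls for each `s
> 0`. For `s` below all Lebesgue exponents, Hölder's inequality bounds the local `L^s` norm over a
unit ball by the mixed quasi-norm, uniformly in the centre, and the lower Gaussian bound on the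
weight then gives `U_𝔙⁻¹ F = O(exp(ε|z|²))` for every `ε > 0`. In the algebraic half
(`exists_bargmann_eq`), integration against a multiple of `U_𝔙⁻¹ F` defines a distribution `u`;
applied to the Bargmann kernel, the integral becomes the reproducing formula `∫ exp⟨q, w⟩ exp(-|q|²)
F(q) = F(w)` of the Fock space, so `𝔙u = F`. -/

open scoped FourierTransform

namespace BargmannMod

/-! ### Mean value inequalities for powers of moduli of holomorphic functions -/

section

/-- `‖f‖ ^ r` is subharmonic: the mean value inequality on the unit circle. -/
lemma rpow_norm_le_circleAverage {f : ℂ → ℂ} (hf : Differentiable ℂ f) {r : ℝ} (hr : 0 < r) :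
    ‖f 0‖ ^ r ≤ Real.circleAverage (fun z => ‖f z‖ ^ r) 0 1 := by
  have hcont : Continuous fun z => ‖f z‖ ^ r :=
    hf.continuous.norm.rpow_const fun _ => Or.inr hr.le
  by_cases h0 : f 0 = 0
  · rw [h0, norm_zero, Real.zero_rpow hr.ne']
    exact Real.circleAverage_nonneg_of_nonneg fun z _ => by positivity
  have ha : AnalyticOnNhd ℂ f Set.univ := fun z _ => hf.analyticAt z
  have hnz : {z | f z ≠ 0} ∈ Filter.codiscreteWithin (Metric.sphere (0 : ℂ) |1|) :=
    Filter.codiscreteWithin_mono (Set.subset_univ _)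
      (ha.preimage_zero_mem_codiscrete h0)
  have hpos : 0 < ‖f 0‖ := norm_pos_iff.2 h0
  have hposr : 0 < ‖f 0‖ ^ r := by positivity
  -- A tangent line bound: `1 + t ≤ exp t` at `t = r (log ‖f z‖ - log ‖f 0‖)` says `log ‖f z‖ ≤ φ
  -- z`. Since `φ` is affine in `‖f z‖ ^ r`, the mean value inequality for `log ‖f‖` (Jensen's
  -- formula) passes to `‖f‖ ^ r`.
  set φ : ℂ → ℝ := fun z => (r * ‖f 0‖ ^ r)⁻¹ * ‖f z‖ ^ r + (Real.log ‖f 0‖ - r⁻¹) with hφ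
  have hφc : Continuous φ := (continuous_const.mul hcont).add continuous_const
  have hle : ∀ z, f z ≠ 0 → Real.log ‖f z‖ ≤ φ z := by
    intro z hz
    have hz' : 0 < ‖f z‖ := norm_pos_iff.2 hz
    have h1 := Real.add_one_le_exp (r * (Real.log ‖f z‖ - Real.log ‖f 0‖))
    have h2 : Real.exp (r * (Real.log ‖f z‖ - Real.log ‖f 0‖)) = ‖f z‖ ^ r / ‖f 0‖ ^ r := by
      rw [Real.rpow_def_of_pos hz', Real.rpow_def_of_pos hpos, ← Real.exp_sub]; ring_nf
    rw [h2] at h1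
    have h3 : φ z = r⁻¹ * (‖f z‖ ^ r / ‖f 0‖ ^ r) + Real.log ‖f 0‖ - r⁻¹ := by
      rw [hφ]; field_simp; ring
    rw [h3]
    have h4 := mul_le_mul_of_nonneg_left h1 (inv_pos.2 hr).le
    have h5 : r⁻¹ * (r * (Real.log ‖f z‖ - Real.log ‖f 0‖) + 1) =
      Real.log ‖f z‖ - Real.log ‖f 0‖ + r⁻¹ := by field_simp
    linarith
  have hlog : CircleIntegrable (fun z => Real.log ‖f z‖) 0 1 :=
    MeromorphicOn.circleIntegrable_log_norm fun z _ => (hf.analyticAt z).meromorphicAt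
  -- At a zero of `f` the convention `Real.log 0 = 0` can violate `log ‖f‖ ≤ φ`. Taking the minimum
  -- with `φ` alters the function only on a discrete set, which circle averages do not see.
  have heq : (fun z => Real.log ‖f z‖) =ᶠ[Filter.codiscreteWithin (Metric.sphere (0 : ℂ) |1|)]
      fun z => min (Real.log ‖f z‖) (φ z) := by
    filter_upwards [hnz] with z hz
    exact (min_eq_left (hle z hz)).symm
  have hjen := AnalyticOnNhd.circleAverage_log_norm (c := 0) (R := 1) one_ne_zero
    (ha.mono (Set.subset_univ _)) h0
  have hge : Real.log ‖f 0‖ ≤ Real.circleAverage (fun z => Real.log ‖f z‖) 0 1 := by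
    rw [hjen]
    -- The correction in Jensen's formula is a sum over the zeros in the closed disc of multiplicity
    -- times `log (1 / ‖u‖)`, each term being nonnegative.
    refine le_add_of_nonneg_left (finsum_nonneg fun u => ?_)
    by_cases hu : u ∈ Metric.closedBall (0 : ℂ) |1|
    · refine mul_nonneg (by exact_mod_cast
        MeromorphicOn.AnalyticOnNhd.divisor_nonneg (ha.mono (Set.subset_univ _)) u) ?_
      by_cases hu0 : u = 0
      · simp [hu0]
      · refine Real.log_nonneg ?_
        rw [one_mul, zero_sub, norm_neg]
        exact (one_le_inv₀ (norm_pos_iff.2 hu0)).2 (by simpa using hu)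
    · rw [Function.locallyFinsuppWithin.apply_eq_zero_of_notMem _ hu]; simp
  have hmono : Real.circleAverage (fun z => Real.log ‖f z‖) 0 1 ≤ Real.circleAverage φ 0 1 := by
    rw [Real.circleAverage_congr_codiscreteWithin heq one_ne_zero]
    refine Real.circleAverage_mono (hlog.congr_codiscreteWithin heq) hφc.continuousOn.circleIntegrable' ?_
    exact fun z _ => min_le_right _ _
  have hφavg : Real.circleAverage φ 0 1 = (r * ‖f 0‖ ^ r)⁻¹ *
      Real.circleAverage (fun z => ‖f z‖ ^ r) 0 1 + (Real.log ‖f 0‖ - r⁻¹) := by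
    rw [hφ, Real.circleAverage_fun_add (f₁ := fun z => (r * ‖f 0‖ ^ r)⁻¹ * ‖f z‖ ^ r)
      (continuous_const.mul hcont).continuousOn.circleIntegrable'
      continuous_const.continuousOn.circleIntegrable', Real.circleAverage_const]
    congr 1
    exact Real.circleAverage_fun_smul (a := (r * ‖f 0‖ ^ r)⁻¹)
  rw [hφavg] at hmono
  have h6 : r⁻¹ ≤ (r * ‖f 0‖ ^ r)⁻¹ * Real.circleAverage (fun z => ‖f z‖ ^ r) 0 1 := by linarith
  rw [← div_eq_inv_mul, le_div_iff₀ (by positivity), ← mul_assoc, inv_mul_cancel₀ hr.ne',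
    one_mul] at h6
  exact h6

/-- Invariance of the volume of `ℂ^d` under the action of the unit circle. -/
lemma measurePreserving_circle_smul (d : ℕ) (c : ℂ) (hc : ‖c‖ = 1) :
    MeasurePreserving (fun z : CSp d => c • z) volume volume := by
  have hc0 : c ≠ 0 := by rintro rfl; simp at hc
  let e : CSp d ≃ₗᵢ[ℝ] CSp d :=
    { (LinearEquiv.smulOfNeZero ℂ (CSp d) c hc0).restrictScalars ℝ with
      norm_map' := fun z => by
        change ‖c • z‖ = ‖z‖
        rw [norm_smul, hc, one_mul] }
  exact e.measurePreserving

/-- For each `u` the circle inequality applies on the complex line through `z` in direction `u`.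
Integrating over `u` in the unit ball and exchanging integrals, every rotation leaves the ball and
its measure invariant, so the angular integral is only a factor `2π`. Holomorphy is needed along
complex lines only. -/
lemma rpow_enorm_le_lintegral_ball {d : ℕ} {F : CSp d → ℂ} (hF : Continuous F) {r : ℝ}
    (hr : 0 < r) (hline : ∀ z u : CSp d, Differentiable ℂ fun τ : ℂ => F (z + τ • u)) (z : CSp d) :
    ‖F z‖ₑ ^ r * volume (Metric.ball (0 : CSp d) 1) ≤
      ∫⁻ u in Metric.ball (0 : CSp d) 1, ‖F (z + u)‖ₑ ^ r := by
  set B := Metric.ball (0 : CSp d) 1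
  have hpi : (0 : ℝ) ≤ 2 * Real.pi := by positivity
  have h1 : ∀ u : CSp d, ENNReal.ofReal (2 * Real.pi) * ‖F z‖ₑ ^ r ≤
      ∫⁻ θ in Set.Ioc 0 (2 * Real.pi), ‖F (z + circleMap 0 1 θ • u)‖ₑ ^ r := by
    intro u
    have h := rpow_norm_le_circleAverage (f := fun τ : ℂ => F (z + τ • u)) (hline z u) hr
    rw [Real.circleAverage_def, intervalIntegral.integral_of_le hpi, smul_eq_mul,
      ← div_eq_inv_mul, le_div_iff₀ (by positivity), zero_smul, add_zero, mul_comm] at h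
    have hc : Continuous fun θ : ℝ => ‖F (z + circleMap 0 1 θ • u)‖ ^ r := by
      refine (hF.comp ?_).norm.rpow_const fun _ => Or.inr hr.le
      fun_prop
    have h' := ENNReal.ofReal_le_ofReal h
    rw [ofReal_integral_eq_lintegral_ofReal
      ((hc.intervalIntegrable 0 (2 * Real.pi)).1) (ae_of_all _ fun _ => by positivity),
      ENNReal.ofReal_mul hpi] at h'
    simpa only [← ENNReal.ofReal_rpow_of_nonneg (norm_nonneg _) hr.le, ofReal_norm]
      using h'
  have hmeas : Measurable fun p : CSp d × ℝ => ‖F (z + circleMap 0 1 p.2 • p.1)‖ₑ ^ r := by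
    have : Continuous fun p : CSp d × ℝ => F (z + circleMap 0 1 p.2 • p.1) := by
      refine hF.comp ?_
      fun_prop
    exact this.measurable.enorm.pow_const r
  have hrot : ∀ θ : ℝ, ∫⁻ u in B, ‖F (z + circleMap 0 1 θ • u)‖ₑ ^ r =
      ∫⁻ u in B, ‖F (z + u)‖ₑ ^ r := by
    intro θ
    have hc : ‖circleMap 0 1 θ‖ = 1 := by simp
    have hp := measurePreserving_circle_smul d _ hc
    have hB : (fun u : CSp d => circleMap 0 1 θ • u) ⁻¹' B = B := by
      ext u
      simp [B, norm_smul]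
    have h2 := (hp.restrict_preimage (s := B) Metric.isOpen_ball.measurableSet).lintegral_comp
      (f := fun u => ‖F (z + u)‖ₑ ^ r) (by
        have : Continuous fun u : CSp d => F (z + u) := hF.comp (by fun_prop)
        exact this.measurable.enorm.pow_const r)
    rwa [hB] at h2
  have h3 : ENNReal.ofReal (2 * Real.pi) * (‖F z‖ₑ ^ r * volume B) ≤
      ENNReal.ofReal (2 * Real.pi) * ∫⁻ u in B, ‖F (z + u)‖ₑ ^ r := by
    calc ENNReal.ofReal (2 * Real.pi) * (‖F z‖ₑ ^ r * volume B)
        = ∫⁻ u in B, ENNReal.ofReal (2 * Real.pi) * ‖F z‖ₑ ^ r := by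
          rw [setLIntegral_const, mul_assoc]
      _ ≤ ∫⁻ u in B, ∫⁻ θ in Set.Ioc 0 (2 * Real.pi), ‖F (z + circleMap 0 1 θ • u)‖ₑ ^ r :=
          lintegral_mono h1
      _ = ∫⁻ θ in Set.Ioc 0 (2 * Real.pi), ∫⁻ u in B, ‖F (z + circleMap 0 1 θ • u)‖ₑ ^ r :=
          lintegral_lintegral_swap hmeas.aemeasurable
      _ = _ := by
          simp_rw [hrot]
          rw [setLIntegral_const, Real.volume_Ioc, sub_zero, mul_comm]
  exact (ENNReal.mul_le_mul_iff_right (by simpa using Real.pi_pos) ENNReal.ofReal_ne_top).1 h3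

end

/-! ### Local control of `L^r` by mixed quasi-norms -/

section

section Mixed

variable {E : Type*} [NormedAddCommGroup E] [InnerProductSpace ℝ E] [FiniteDimensional ℝ E]
  [MeasurableSpace E] [BorelSpace E]

instance isAddHaarMeasure_subspaceVolume (V : Submodule ℝ E) :
    (subspaceVolume V).IsAddHaarMeasure := by
  unfold subspaceVolume; infer_instance

lemma iteratedNorm_le_mul (c : ℝ≥0) : ∀ (n : ℕ) (V : Fin n → Submodule ℝ E) (p : Fin n → ℝ≥0∞)
    (f g : E → ℝ≥0∞), (∀ x, f x ≤ c * g x) →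
    iteratedNorm n V p f ≤ c * iteratedNorm n V p g
  | 0, _, _, _, _, h => h 0
  | n + 1, V, p, f, g, h => by
    refine iteratedNorm_le_mul c n _ _ _ _ fun y => ?_
    have := eLpNorm_le_nnreal_smul_eLpNorm_of_ae_le_mul' (μ := subspaceVolume (V 0))
      (f := fun x : V 0 => f ((x : E) + y)) (g := fun x : V 0 => g ((x : E) + y)) (c := c)
      (ae_of_all _ fun x => by simpa using h _) (p 0)
    simpa [ENNReal.smul_def] using this

/-- Induction on the number of factors: on a measure of mass at most `m`, Hölder's inequality passes
from `L^r` to `L^{p_0}` at the cost of a power of `m`, and Tonelli's theorem peels off one variable.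
The constant sees the measures only through `m`; this is what later makes it independent of the
centre of a ball. -/
lemma exists_lintegral_pi_le_iteratedNorm {r : ℝ} (hr : 0 < r) (m : ℝ≥0) :
    ∀ (n : ℕ) (V : Fin n → Submodule ℝ E) (p : Fin n → ℝ≥0∞),
    (∀ j, ENNReal.ofReal r ≤ p j) → ∃ C : ℝ≥0, ∀ ν : ∀ j, Measure (V j),
      (∀ j, ν j ≤ subspaceVolume (V j)) → (∀ j, ν j Set.univ ≤ m) →
      ∀ g : E → ℝ≥0∞, Measurable g →
        ∫⁻ x, g (∑ j, (x j : E)) ^ r ∂(Measure.pi ν) ≤ (C * iteratedNorm n V p g) ^ r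
  | 0, V, p, _ => by
    refine ⟨1, fun ν _ _ g _ => ?_⟩
    simp only [Finset.univ_eq_empty, Finset.sum_empty, lintegral_const, ENNReal.coe_one, one_mul,
      iteratedNorm]
    rw [Measure.pi_of_empty]
    simp
  | n + 1, V, p, hp => by
    obtain ⟨C, hC⟩ := exists_lintegral_pi_le_iteratedNorm hr m n (fun j => V j.succ)
      (fun j => p j.succ) fun j => hp _
    -- The Hölder exponent. If `p 0 = ∞`, then `toReal` gives `0` and `1 / 0 = 0`, so `s = 1 / r` as
    -- it should be.
    set s : ℝ := 1 / r - 1 / (p 0).toReal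
    have hs : 0 ≤ s := by
      by_cases h : p 0 = ∞
      · simp [s, h, hr.le]
      · have : r ≤ (p 0).toReal := by
          rw [← ENNReal.ofReal_le_iff_le_toReal h]; exact hp 0
        have := one_div_le_one_div_of_le hr this
        simp only [s]; linarith
    refine ⟨C * m ^ s, fun ν hν hνm g hg => ?_⟩
    have hfin : ∀ j, IsFiniteMeasure (ν j) := fun j =>
      ⟨(hνm j).trans_lt ENNReal.coe_lt_top⟩
    set μ₀ := subspaceVolume (V 0)
    -- The induction hypothesis is applied to the `L^r(ν 0)` norm in the first variable: it is
    -- measurable and compatible with Tonelli's theorem, and the `L^{p_0}` norm enters only through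
    -- monotonicity.
    set k : E → ℝ≥0∞ := fun y =>
      eLpNorm (fun x : V 0 => g ((x : E) + y)) (ENNReal.ofReal r) (ν 0) with hk
    have hr0 : ENNReal.ofReal r ≠ 0 := by simpa using hr
    have hkr : ∀ y, k y = (∫⁻ x : V 0, g ((x : E) + y) ^ r ∂(ν 0)) ^ (1 / r) := by
      intro y
      rw [hk]
      simp only
      rw [eLpNorm_eq_lintegral_rpow_enorm_toReal hr0 ENNReal.ofReal_ne_top]
      simp [ENNReal.toReal_ofReal hr.le]
    have hkr' : ∀ y, k y ^ r = ∫⁻ x : V 0, g ((x : E) + y) ^ r ∂(ν 0) := by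
      intro y
      rw [hkr, ← ENNReal.rpow_mul, one_div_mul_cancel hr.ne', ENNReal.rpow_one]
    have hgm : Measurable fun q : E × V 0 => g ((q.2 : E) + q.1) ^ r :=
      (hg.comp ((measurable_subtype_coe.comp measurable_snd).add measurable_fst)).pow_const r
    have hkm : Measurable k := by
      have : k = fun y => (∫⁻ x : V 0, g ((x : E) + y) ^ r ∂(ν 0)) ^ (1 / r) := funext hkr
      rw [this]
      exact (Measurable.lintegral_prod_right' hgm).pow_const _
    have hkle : ∀ y, k y ≤ (m ^ s : ℝ≥0) * eLpNorm (fun x : V 0 => g ((x : E) + y)) (p 0) μ₀ := by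
      intro y
      have h1 := eLpNorm_le_eLpNorm_mul_rpow_measure_univ (μ := ν 0) (hp 0)
        (f := fun x : V 0 => g ((x : E) + y))
        ((hg.comp (measurable_subtype_coe.add_const y)).aestronglyMeasurable)
      rw [ENNReal.toReal_ofReal hr.le] at h1
      refine h1.trans ?_
      rw [mul_comm, ENNReal.coe_rpow_of_nonneg _ hs]
      exact mul_le_mul' (ENNReal.rpow_le_rpow (hνm 0) hs) (eLpNorm_mono_measure _ (hν 0))
    have h2 := hC (fun j => ν j.succ) (fun j => hν _) (fun j => hνm _) k hkm
    have h3 := iteratedNorm_le_mul (m ^ s) n (fun j => V j.succ) (fun j => p j.succ) k _ hkle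
    have h4 : ∫⁻ x, g (∑ j, (x j : E)) ^ r ∂(Measure.pi ν) =
        ∫⁻ x : ∀ j : Fin n, V j.succ, k (∑ j, (x j : E)) ^ r ∂(Measure.pi fun j => ν j.succ) := by
      have hmp := measurePreserving_piFinSuccAbove ν 0
      have hmeas : Measurable fun q : V 0 × (∀ j : Fin n, V j.succ) =>
          g ((q.1 : E) + ∑ j, (q.2 j : E)) ^ r := by
        refine (hg.comp (Measurable.add (measurable_subtype_coe.comp measurable_fst) ?_)).pow_const r
        exact Finset.measurable_sum _ fun j _ =>
          measurable_subtype_coe.comp ((measurable_pi_apply j).comp measurable_snd)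
      have h5 := hmp.lintegral_comp (f := fun q : V 0 × (∀ j : Fin n, V j.succ) =>
          g ((q.1 : E) + ∑ j, (q.2 j : E)) ^ r) hmeas
      have h7 : ∫⁻ q, g ((q.1 : E) + ∑ j, (q.2 j : E)) ^ r
          ∂((ν 0).prod (Measure.pi fun j : Fin n => ν j.succ)) =
          ∫⁻ x : ∀ j : Fin n, V j.succ, k (∑ j, (x j : E)) ^ r
            ∂(Measure.pi fun j => ν j.succ) := by
        rw [lintegral_prod_symm' _ hmeas]
        simp_rw [hkr']
      have h6 : ∀ x : (∀ j, V j), g (∑ j, (x j : E)) ^ r =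
          (fun q : V 0 × (∀ j : Fin n, V j.succ) => g ((q.1 : E) + ∑ j, (q.2 j : E)) ^ r)
            (MeasurableEquiv.piFinSuccAbove (fun j => V j) 0 x) := by
        intro x
        simp only [MeasurableEquiv.piFinSuccAbove_apply]
        rw [Fin.sum_univ_succ]
        rfl
      simp_rw [h6]
      refine h5.trans (Eq.trans ?_ h7)
      rfl
    rw [h4]
    refine h2.trans (ENNReal.rpow_le_rpow ?_ hr.le)
    rw [ENNReal.coe_mul, mul_assoc]
    exact mul_le_mul_right h3 _

/-- In the coordinates of the decomposition, Lebesgue measure is a multiple of the product of Haar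
measures. A unit ball is contained in a product of balls of fixed radius `K`, the norm of the
coordinate map, whose masses do not depend on the centre. -/
lemma exists_lintegral_ball_le_mixedNorm (B : MixedSpace E) {r : ℝ} (hr : 0 < r)
    (hB : ENNReal.ofReal r ≤ B.minExponent) :
    ∃ C : ℝ≥0, ∀ g : E → ℝ≥0∞, Measurable g → ∀ z : E,
      ∫⁻ u in Metric.ball (0 : E) 1, g (z + u) ^ r ≤ (C * iteratedNorm B.n B.V B.p g) ^ r := by
  classical
  let Φl : (∀ j, B.V j) ≃ₗ[ℝ] E :=
    (DirectSum.linearEquivFunOnFintype ℝ (Fin B.n) fun j => B.V j).symm.trans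
      (LinearEquiv.ofBijective (DirectSum.coeLinearMap B.V) B.isInternal)
  have hΦl : ∀ x, Φl x = ∑ j, (x j : E) := by
    intro x
    change DirectSum.coeLinearMap B.V
      ((DirectSum.linearEquivFunOnFintype ℝ (Fin B.n) fun j => B.V j).symm x) = _
    rw [DirectSum.coeLinearMap_eq_dfinsuppSum, DFinsupp.sum_eq_sum_fintype _ (by simp)]
    refine Finset.sum_congr rfl fun j _ => ?_
    have := congrFun ((DirectSum.linearEquivFunOnFintype ℝ (Fin B.n) fun j => B.V j).apply_symm_apply x) j
    exact congrArg _ this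
  let Φ : (∀ j, B.V j) ≃L[ℝ] E := Φl.toContinuousLinearEquiv
  have hΦ : ∀ x, Φ x = ∑ j, (x j : E) := hΦl
  set μ : Measure (∀ j, B.V j) := Measure.pi fun j => subspaceVolume (B.V j)
  have hhaar : (μ.map Φ).IsAddHaarMeasure := Φ.isAddHaarMeasure_map μ
  obtain ⟨c, hc⟩ : ∃ c : ℝ≥0, (volume : Measure E) = c • μ.map Φ :=
    ⟨_, Measure.isAddLeftInvariant_eq_smul volume (μ.map Φ)⟩
  set K : ℝ := ‖(Φ.symm : E →L[ℝ] (∀ j, B.V j))‖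
  have hfin : ∀ j, subspaceVolume (B.V j) (Metric.closedBall 0 K) < ∞ := fun j =>
    (ProperSpace.isCompact_closedBall _ _).measure_lt_top
  set m : ℝ≥0 := ∑ j, (subspaceVolume (B.V j) (Metric.closedBall 0 K)).toNNReal
  have hp : ∀ j, ENNReal.ofReal r ≤ B.p j := fun j => hB.trans (iInf_le _ j)
  obtain ⟨C, hC⟩ := exists_lintegral_pi_le_iteratedNorm hr m B.n B.V B.p hp
  refine ⟨c ^ (1 / r) * C, fun g hg z => ?_⟩
  have e1 : ∫⁻ u in Metric.ball (0 : E) 1, g (z + u) ^ r =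
      ∫⁻ v in Metric.ball z 1, g v ^ r := by
    have hmp := (measurePreserving_add_left (volume : Measure E) z).restrict_preimage
      (s := Metric.ball z 1) Metric.isOpen_ball.measurableSet
    have hpre : (fun u => z + u) ⁻¹' Metric.ball z 1 = Metric.ball 0 1 := by
      ext u; simp [dist_eq_norm]
    rw [hpre] at hmp
    exact hmp.lintegral_comp (f := fun v => g v ^ r) (hg.pow_const r)
  have hgr : Measurable fun v => g v ^ r := hg.pow_const r
  have hΦm : Measurable Φ := Φ.continuous.measurable
  have hsub : Φ ⁻¹' Metric.ball z 1 ⊆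
      Set.univ.pi fun j => Metric.closedBall (Φ.symm z j) K := by
    intro x hx j _
    have h1 : ‖x - Φ.symm z‖ ≤ K := by
      have h2 : x - Φ.symm z = Φ.symm (Φ x - z) := by simp
      rw [h2]
      refine ((Φ.symm : E →L[ℝ] (∀ j, B.V j)).le_opNorm _).trans ?_
      have : ‖Φ x - z‖ ≤ 1 := by
        have := Metric.mem_ball.1 hx
        rw [dist_eq_norm] at this
        exact this.le
      exact mul_le_of_le_one_right (norm_nonneg _) this
    rw [Metric.mem_closedBall, dist_eq_norm]
    exact (norm_le_pi_norm (x - Φ.symm z) j).trans h1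
  have e2 : ∫⁻ v in Metric.ball z 1, g v ^ r ≤ c * (C * iteratedNorm B.n B.V B.p g) ^ r := by
    rw [hc, Measure.restrict_smul, lintegral_smul_measure, ENNReal.smul_def, smul_eq_mul]
    refine mul_le_mul_right ?_ _
    rw [Measure.restrict_map hΦm Metric.isOpen_ball.measurableSet, lintegral_map hgr hΦm]
    refine (lintegral_mono_set hsub).trans ?_
    rw [Measure.restrict_pi_pi]
    simp_rw [hΦ]
    refine hC _ (fun j => Measure.restrict_le_self) (fun j => ?_) g hg
    rw [Measure.restrict_apply_univ, Measure.addHaar_closedBall_center]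
    rw [← ENNReal.coe_toNNReal (hfin j).ne]
    exact_mod_cast Finset.single_le_sum (f := fun j =>
      (subspaceVolume (B.V j) (Metric.closedBall 0 K)).toNNReal) (fun _ _ => zero_le) (Finset.mem_univ j)
  rw [e1]
  refine e2.trans (le_of_eq ?_)
  rw [ENNReal.coe_mul, mul_assoc, ENNReal.mul_rpow_of_nonneg (c ^ (1 / r) : ℝ≥0) _ hr.le,
    ENNReal.coe_rpow_of_nonneg _ (by positivity), ← ENNReal.rpow_mul, one_div_mul_cancel hr.ne',
    ENNReal.rpow_one]

end Mixed

end

/-! ### Pointwise growth of entire functions of finite quasi-norm -/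

section

variable {d : ℕ}

lemma norm_sq_rePart_add_imPart (z : CSp d) : ‖rePart z‖ ^ 2 + ‖imPart z‖ ^ 2 = ‖z‖ ^ 2 := by
  rw [EuclideanSpace.norm_sq_eq, EuclideanSpace.norm_sq_eq, EuclideanSpace.norm_sq_eq,
    ← Finset.sum_add_distrib]
  refine Finset.sum_congr rfl fun j _ => ?_
  simp only [rePart, imPart, Real.norm_eq_abs, sq_abs]
  rw [← Complex.normSq_eq_norm_sq, Complex.normSq_apply]
  ring

lemma norm_sq_ofReIm (x ξ : RSp d) : ‖ofReIm x ξ‖ ^ 2 = ‖x‖ ^ 2 + ‖ξ‖ ^ 2 :=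
  (norm_sq_rePart_add_imPart (ofReIm x ξ)).symm

@[fun_prop]
lemma continuous_rePart : Continuous (rePart : CSp d → RSp d) := by
  unfold rePart; fun_prop

@[fun_prop]
lemma continuous_imPart : Continuous (imPart : CSp d → RSp d) := by
  unfold imPart; fun_prop

lemma continuous_ofReIm : Continuous fun p : RSp d × RSp d => ofReIm p.1 p.2 := by
  have h : ∀ p : RSp d × RSp d, ofReIm p.1 p.2 =
      WithLp.toLp 2 fun j => ((p.1 j : ℝ) : ℂ) + (p.2 j : ℝ) * Complex.I := by
    intro p
    simp [ofReIm, Complex.mk_eq_add_mul_I]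
  simp_rw [h]
  fun_prop

/-- The point of `ℂ^d` at which `F` is evaluated in `bargUInv F z`. -/
noncomputable def conjScale (z : CSp d) : CSp d :=
  ofReIm ((Real.sqrt 2)⁻¹ • rePart z) (-((Real.sqrt 2)⁻¹ • imPart z))

/-- `conjScale` is antilinear. Consequently `F ∘ conjScale` has to be conjugated before it is
holomorphic along complex lines; this does not affect its modulus. -/
lemma conjScale_add_smul (z u : CSp d) (τ : ℂ) :
    conjScale (z + τ • u) = conjScale z + conj τ • conjScale u := by
  ext j
  apply Complex.ext <;>
  · simp [conjScale, ofReIm, rePart, imPart]; ring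

@[fun_prop]
lemma continuous_conjScale : Continuous (conjScale : CSp d → CSp d) :=
  continuous_ofReIm.comp (f := fun z : CSp d =>
    ((Real.sqrt 2)⁻¹ • rePart z, -((Real.sqrt 2)⁻¹ • imPart z))) (by fun_prop)

lemma norm_bargUInv (F : CSp d → ℂ) (z : CSp d) :
    ‖bargUInv F z‖ = (2 * Real.pi) ^ (-(d : ℝ) / 2) * Real.exp (-‖z‖ ^ 2 / 4) *
      ‖F (conjScale z)‖ := by
  rw [bargUInv, norm_mul, norm_mul, Complex.norm_real, Complex.norm_exp]
  have : (-Complex.I * ((inner ℝ (rePart z) (imPart z) : ℝ) : ℂ) / 2).re = 0 := by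
    simp
  rw [this, Real.exp_zero, mul_one, norm_sq_rePart_add_imPart, Real.norm_of_nonneg (by positivity)]
  rfl

lemma continuous_bargUInv {F : CSp d → ℂ} (hF : Continuous F) : Continuous (bargUInv F) := by
  have h2 : bargUInv F = fun z => (((2 * Real.pi) ^ (-(d : ℝ) / 2) *
      Real.exp (-(‖rePart z‖ ^ 2 + ‖imPart z‖ ^ 2) / 4) : ℝ) : ℂ) *
    Complex.exp (-Complex.I * ((inner ℝ (rePart z) (imPart z) : ℝ) : ℂ) / 2) *
    F (conjScale z) := rfl
  rw [h2]
  fun_prop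

/-- An entire function in `B(ω, ℬ)`, with `ω` weakly subgaussian, is subgaussian
after `U_𝔙⁻¹`. -/
lemma exists_norm_bargUInv_le {B : MixedSpace (CSp d)} {ω : CSp d → ℝ}
    (hω : IsWeaklySubgaussian ω) {r : ℝ≥0∞} (hr : 0 < r) (hrB : r ≤ B.minExponent)
    {F : CSp d → ℂ} (hF : Differentiable ℂ F) (hFB : bNorm ω B F < ∞) {ε : ℝ} (hε : 0 < ε) :
    ∃ C : ℝ, 0 ≤ C ∧ ∀ z, ‖bargUInv F z‖ ≤ C * Real.exp (ε * ‖z‖ ^ 2) := by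
  -- The mean value inequality needs a finite real exponent, whereas `r` may be `∞`; hence the
  -- minimum with `1`.
  obtain ⟨s, hs, hsB⟩ : ∃ s : ℝ, 0 < s ∧ ENNReal.ofReal s ≤ B.minExponent := by
    refine ⟨(min r 1).toReal, ENNReal.toReal_pos (by simp [hr.ne']) (by simp), ?_⟩
    rw [ENNReal.ofReal_toReal (by simp)]
    exact (min_le_left _ _).trans hrB
  obtain ⟨A, hA⟩ := exists_lintegral_ball_le_mixedNorm B hs hsB
  obtain ⟨W, hW, hWω⟩ := hω.subgaussian (ε / 4) (by positivity)
  -- The weight is replaced by a Gaussian minorant, up to a constant. The function `g` is then the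
  -- modulus of a continuous function, and its quasi-norm remains finite.
  set g : CSp d → ℝ≥0∞ := fun z => ‖bargUInv F z * (Real.exp (-(ε / 4) * ‖z‖ ^ 2) : ℝ)‖ₑ with hg
  have hcU := continuous_bargUInv hF.continuous
  have hgm : Measurable g := by
    have : Continuous fun z => bargUInv F z * (Real.exp (-(ε / 4) * ‖z‖ ^ 2) : ℝ) := by fun_prop
    exact this.measurable.enorm
  have hgle : ∀ z, g z ≤ (W.toNNReal : ℝ≥0) * ‖bargUInv F z * (ω z : ℂ)‖ₑ := by
    intro z
    have h1 := (hWω z).1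
    have h2 : ‖bargUInv F z * (Real.exp (-(ε / 4) * ‖z‖ ^ 2) : ℝ)‖ ≤
        W * ‖bargUInv F z * (ω z : ℂ)‖ := by
      rw [norm_mul, norm_mul, Complex.norm_real, Complex.norm_real,
        Real.norm_of_nonneg (Real.exp_nonneg _), Real.norm_of_nonneg (hω.pos z).le]
      have h3 : Real.exp (-(ε / 4) * ‖z‖ ^ 2) ≤ W * ω z := by
        rwa [inv_mul_le_iff₀ hW] at h1
      nlinarith [norm_nonneg (bargUInv F z)]
    simp only [hg]
    rw [← ofReal_norm, ← ofReal_norm]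
    refine (ENNReal.ofReal_le_ofReal h2).trans ?_
    rw [ENNReal.ofReal_mul hW.le]; rfl
  set N : ℝ≥0∞ := iteratedNorm B.n B.V B.p g
  have hN : N < ∞ := by
    refine (iteratedNorm_le_mul W.toNNReal B.n B.V B.p g _ hgle).trans_lt ?_
    exact ENNReal.mul_lt_top ENNReal.coe_lt_top hFB
  set G : CSp d → ℂ := fun z => conj (F (conjScale z)) with hG
  have hGc : Continuous G := Complex.continuous_conj.comp (hF.continuous.comp continuous_conjScale)
  have hline : ∀ z u : CSp d, Differentiable ℂ fun τ : ℂ => G (z + τ • u) := by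
    intro z u
    have h1 : Differentiable ℂ fun τ : ℂ => F (conjScale z + τ • conjScale u) :=
      hF.comp ((differentiable_const _).add (differentiable_id.smul_const _))
    have h2 : (fun τ : ℂ => G (z + τ • u)) =
        conj ∘ (fun τ : ℂ => F (conjScale z + τ • conjScale u)) ∘ conj := by
      funext τ
      simp [hG, conjScale_add_smul]
    rw [h2]
    intro τ
    simpa using (h1 (conj τ)).conj_conj
  set k : ℝ := (2 * Real.pi) ^ (-(d : ℝ) / 2)
  have hk : 0 < k := by positivity
  have hgG : ∀ z, ‖G z‖ₑ = ENNReal.ofReal (k⁻¹ * Real.exp ((1 / 4 + ε / 4) * ‖z‖ ^ 2)) * g z := by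
    intro z
    have h1 : ‖G z‖ = (k⁻¹ * Real.exp ((1 / 4 + ε / 4) * ‖z‖ ^ 2)) *
        ‖bargUInv F z * (Real.exp (-(ε / 4) * ‖z‖ ^ 2) : ℝ)‖ := by
      rw [norm_mul, norm_bargUInv, Complex.norm_real, Real.norm_of_nonneg (Real.exp_nonneg _)]
      have h2 : Real.exp ((1 / 4 + ε / 4) * ‖z‖ ^ 2) * (Real.exp (-‖z‖ ^ 2 / 4) *
          Real.exp (-(ε / 4) * ‖z‖ ^ 2)) = 1 := by
        rw [← Real.exp_add, ← Real.exp_add, Real.exp_eq_one_iff]; ring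
      have h3 : ‖G z‖ = ‖F (conjScale z)‖ := by simp [hG]
      rw [h3]
      calc ‖F (conjScale z)‖ = (k⁻¹ * k) * (Real.exp ((1 / 4 + ε / 4) * ‖z‖ ^ 2) *
            (Real.exp (-‖z‖ ^ 2 / 4) * Real.exp (-(ε / 4) * ‖z‖ ^ 2))) * ‖F (conjScale z)‖ := by
            rw [h2, inv_mul_cancel₀ hk.ne']; ring
        _ = _ := by ring
    simp only [hg]
    rw [← ofReal_norm, ← ofReal_norm, h1, ENNReal.ofReal_mul (by positivity)]
  -- For `‖u‖ ≤ 1` one has `‖z + u‖² ≤ (1 + δ)‖z‖² + 1 + 1/δ`. This `δ` turns the exponent `1/4 +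
  -- ε/4` into `1/4 + 3ε/4`, which is within the allowed `1/4 + ε`.
  set δ : ℝ := 2 * ε / (1 + ε)
  have hδ : 0 < δ := by positivity
  have hδ' : (1 / 4 + ε / 4) * (1 + δ) ≤ 1 / 4 + ε := by
    have : δ * (1 + ε) = 2 * ε := by simp only [δ]; field_simp
    nlinarith
  set vB := volume (Metric.ball (0 : CSp d) 1)
  have hvB0 : vB ≠ 0 := (Metric.measure_ball_pos volume _ one_pos).ne'
  have hvBt : vB ≠ ∞ := measure_ball_lt_top.ne
  set D : ℝ := k⁻¹ * Real.exp ((1 / 4 + ε / 4) * (1 + δ⁻¹))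
  have hD : 0 < D := by positivity
  set L : ℝ≥0∞ := ENNReal.ofReal D * (A * N) * (vB ^ (1 / s))⁻¹
  have hL : L ≠ ∞ := by
    refine ENNReal.mul_ne_top (ENNReal.mul_ne_top ENNReal.ofReal_ne_top
      (ENNReal.mul_ne_top ENNReal.coe_ne_top hN.ne)) (ENNReal.inv_ne_top.2 ?_)
    exact (ENNReal.rpow_pos (pos_iff_ne_zero.2 hvB0) hvBt).ne'
  have hmain : ∀ z, ‖G z‖ₑ ≤ ENNReal.ofReal (Real.exp ((1 / 4 + ε) * ‖z‖ ^ 2)) * L := by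
    intro z
    set M : ℝ≥0∞ := ENNReal.ofReal (D * Real.exp ((1 / 4 + ε) * ‖z‖ ^ 2)) with hM
    have h1 := rpow_enorm_le_lintegral_ball hGc hs hline z
    have h2 : ∀ u ∈ Metric.ball (0 : CSp d) 1, ‖G (z + u)‖ₑ ^ s ≤ M ^ s * g (z + u) ^ s := by
      intro u hu
      rw [← ENNReal.mul_rpow_of_nonneg _ _ hs.le, hgG]
      refine ENNReal.rpow_le_rpow (mul_le_mul_left (ENNReal.ofReal_le_ofReal ?_) _) hs.le
      have hu1 : ‖u‖ ≤ 1 := by simpa using (Metric.mem_ball.1 hu).le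
      have h3 : ‖z + u‖ ^ 2 ≤ (1 + δ) * ‖z‖ ^ 2 + (1 + δ⁻¹) := by
        have h4 : ‖z + u‖ ≤ ‖z‖ + 1 := (norm_add_le _ _).trans (by linarith)
        have h5 : ‖z + u‖ ^ 2 ≤ (‖z‖ + 1) ^ 2 := pow_le_pow_left₀ (norm_nonneg _) h4 2
        have h6 : 2 * ‖z‖ ≤ δ * ‖z‖ ^ 2 + δ⁻¹ := by
          have : 0 ≤ δ⁻¹ * (δ * ‖z‖ - 1) ^ 2 := by positivity
          have e : δ⁻¹ * (δ * ‖z‖ - 1) ^ 2 = δ * ‖z‖ ^ 2 - 2 * ‖z‖ + δ⁻¹ := by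
            field_simp; ring
          linarith
        nlinarith
      have h7 : (1 / 4 + ε / 4) * ‖z + u‖ ^ 2 ≤
          (1 / 4 + ε / 4) * (1 + δ⁻¹) + (1 / 4 + ε) * ‖z‖ ^ 2 := by
        have := mul_le_mul_of_nonneg_left h3 (show 0 ≤ 1 / 4 + ε / 4 by positivity)
        have := mul_le_mul_of_nonneg_right hδ' (sq_nonneg ‖z‖)
        nlinarith
      simp only [D]
      rw [mul_assoc, ← Real.exp_add]
      gcongr
    have h3 : ‖G z‖ₑ ^ s * vB ≤ (M * (A * N)) ^ s := by
      refine h1.trans ((setLIntegral_mono' Metric.isOpen_ball.measurableSet h2).trans ?_)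
      rw [lintegral_const_mul (M ^ s) (f := fun u => g (z + u) ^ s)
        ((hgm.comp (measurable_const_add z)).pow_const s),
        ENNReal.mul_rpow_of_nonneg _ _ hs.le]
      exact mul_le_mul_right (hA g hgm z) _
    have h4 : ‖G z‖ₑ * vB ^ (1 / s) ≤ M * (A * N) := by
      rw [← ENNReal.rpow_le_rpow_iff hs, ENNReal.mul_rpow_of_nonneg _ _ hs.le,
        ← ENNReal.rpow_mul, one_div_mul_cancel hs.ne', ENNReal.rpow_one]
      exact h3
    have hv1 : vB ^ (1 / s) ≠ 0 := (ENNReal.rpow_pos (pos_iff_ne_zero.2 hvB0) hvBt).ne'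
    have hv2 : vB ^ (1 / s) ≠ ∞ := ENNReal.rpow_ne_top_of_nonneg (by positivity) hvBt
    rw [← ENNReal.le_div_iff_mul_le (Or.inl hv1) (Or.inl hv2), div_eq_mul_inv] at h4
    refine h4.trans (le_of_eq ?_)
    rw [hM, ENNReal.ofReal_mul hD.le]
    simp only [L]; ring
  refine ⟨k * L.toReal, by positivity, fun z => ?_⟩
  have h1 : ‖G z‖ ≤ Real.exp ((1 / 4 + ε) * ‖z‖ ^ 2) * L.toReal := by
    have := ENNReal.toReal_mono (ENNReal.mul_ne_top ENNReal.ofReal_ne_top hL) (hmain z)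
    rwa [ENNReal.toReal_mul, toReal_enorm, ENNReal.toReal_ofReal (Real.exp_nonneg _)] at this
  have h3 : ‖G z‖ = ‖F (conjScale z)‖ := by simp [hG]
  rw [norm_bargUInv, ← h3]
  calc k * Real.exp (-‖z‖ ^ 2 / 4) * ‖G z‖
      ≤ k * Real.exp (-‖z‖ ^ 2 / 4) * (Real.exp ((1 / 4 + ε) * ‖z‖ ^ 2) * L.toReal) := by gcongr
    _ = k * L.toReal * (Real.exp (-‖z‖ ^ 2 / 4) * Real.exp ((1 / 4 + ε) * ‖z‖ ^ 2)) := by ring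
    _ = _ := by rw [← Real.exp_add]; ring_nf

end

section

/-! ### Gaussian estimates -/

/-- Squaring the `m`-th bound and dividing by `(2h²)^m m!` gives `A² (t²/2h²)^m / m! ≤ B² 2^{-m}`.
The sum over `m` is an exponential series on the left and a geometric one on the right. The factor
`2` is a generous `√2`. -/
lemma le_exp_of_pow_mul_le {A B h t : ℝ} (hA : 0 ≤ A) (hB : 0 ≤ B) (hh : 0 < h)
    (H : ∀ m : ℕ, |t| ^ m * A ≤ B * (h ^ m * Real.sqrt m.factorial)) :
    A ≤ 2 * B * Real.exp (-(t ^ 2) / (4 * h ^ 2)) := by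
  have hs : HasSum (fun m : ℕ => A ^ 2 * ((t ^ 2 / (2 * h ^ 2)) ^ m / m.factorial))
      (A ^ 2 * Real.exp (t ^ 2 / (2 * h ^ 2))) := by
    have := NormedSpace.expSeries_div_hasSum_exp (t ^ 2 / (2 * h ^ 2))
    rw [← Real.exp_eq_exp_ℝ] at this
    exact this.mul_left _
  have hg : HasSum (fun m : ℕ => B ^ 2 * (1 / 2 : ℝ) ^ m) (B ^ 2 * 2) :=
    hasSum_geometric_two.mul_left _
  have hle : A ^ 2 * Real.exp (t ^ 2 / (2 * h ^ 2)) ≤ B ^ 2 * 2 := by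
    refine hasSum_le (fun m => ?_) hs hg
    have h1 := pow_le_pow_left₀ (by positivity) (H m) 2
    have e1 : (|t| ^ m) ^ 2 = (t ^ 2) ^ m := by rw [← pow_mul, mul_comm, pow_mul, sq_abs]
    have e2 : (h ^ m) ^ 2 = (h ^ 2) ^ m := by rw [← pow_mul, mul_comm, pow_mul]
    rw [mul_pow, mul_pow, mul_pow, Real.sq_sqrt (by positivity), e1, e2] at h1
    rw [div_pow, mul_pow, one_div, inv_pow]
    have h2 : A ^ 2 * ((t ^ 2) ^ m / (2 ^ m * (h ^ 2) ^ m) / m.factorial) =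
        ((t ^ 2) ^ m * A ^ 2) / ((h ^ 2) ^ m * m.factorial) * (2 ^ m)⁻¹ := by
      field_simp
    rw [h2]
    refine mul_le_mul_of_nonneg_right ?_ (by positivity)
    rw [div_le_iff₀ (by positivity)]
    exact h1
  refine le_of_sq_le_sq ?_ (by positivity)
  have e : Real.exp (-(t ^ 2) / (4 * h ^ 2)) ^ 2 = (Real.exp (t ^ 2 / (2 * h ^ 2)))⁻¹ := by
    rw [← Real.exp_nat_mul, ← Real.exp_neg]; congr 1; push_cast; field_simp; ring
  rw [mul_pow, e, ← div_eq_mul_inv, le_div_iff₀ (Real.exp_pos _)]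
  nlinarith [sq_nonneg B]

variable {d : ℕ}

/-- The bound for the largest coordinate suffices, since its square is at least `‖x‖² / (d + 1)`.
The denominator `d + 1` and the hypothesis `h0` take care of `d = 0`. -/
lemma le_exp_norm_sq_of_forall {A B c : ℝ} (hB : 0 ≤ B) (hc : 0 ≤ c) (x : RSp d) (h0 : A ≤ B)
    (H : ∀ j, A ≤ B * Real.exp (-c * x j ^ 2)) :
    A ≤ B * Real.exp (-(c / (d + 1)) * ‖x‖ ^ 2) := by
  rcases isEmpty_or_nonempty (Fin d) with hd | hd
  · have : ‖x‖ ^ 2 = 0 := by rw [EuclideanSpace.norm_sq_eq]; simp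
    rw [this]; simpa using h0
  obtain ⟨j, hj⟩ := Finite.exists_max fun j => x j ^ 2
  refine (H j).trans ?_
  have h1 : ‖x‖ ^ 2 ≤ (d + 1) * x j ^ 2 := by
    rw [EuclideanSpace.norm_sq_eq]
    simp only [Real.norm_eq_abs, sq_abs]
    refine (Finset.sum_le_card_nsmul _ _ _ fun i _ => hj i).trans ?_
    simp
    nlinarith [sq_nonneg (x j)]
  have h2 : c / (d + 1) * ‖x‖ ^ 2 ≤ c * x j ^ 2 := by
    rw [div_mul_eq_mul_div, div_le_iff₀ (by positivity)]
    nlinarith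
  refine mul_le_mul_of_nonneg_left (Real.exp_le_exp.2 ?_) hB
  linarith

lemma integrable_exp_neg_mul_norm_sq {E : Type*} [NormedAddCommGroup E] [InnerProductSpace ℝ E]
    [FiniteDimensional ℝ E] [MeasurableSpace E] [BorelSpace E] {c : ℝ} (hc : 0 < c) :
    Integrable (fun y : E => Real.exp (-c * ‖y‖ ^ 2)) := by
  have h := GaussianFourier.integrable_cexp_neg_mul_sq_norm_add (V := E) (b := (c : ℂ))
    (by simpa using hc) 0 0
  have h2 := h.norm
  refine h2.congr (ae_of_all _ fun y => ?_)
  simp only [Complex.norm_exp]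
  congr 1
  simp [← Complex.ofReal_pow]

/-- From `‖x‖² ≤ 2‖y‖² + 2‖y - x‖²`: half of the common rate `min b c` pays for the decay in `x`,
and the other half of the rate in `y` keeps the product integrable. -/
lemma exp_mul_exp_shift_le {b c : ℝ} (hb : 0 < b) (hc : 0 < c) (x y : RSp d) :
    Real.exp (-c * ‖y‖ ^ 2) * Real.exp (-b * ‖y - x‖ ^ 2) ≤
      Real.exp (-(min b c / 4) * ‖x‖ ^ 2) * Real.exp (-(min b c / 2) * ‖y‖ ^ 2) := by
  rw [← Real.exp_add, ← Real.exp_add, Real.exp_le_exp]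
  have h1 : ‖x‖ ≤ ‖y‖ + ‖y - x‖ := by
    calc ‖x‖ = ‖y - (y - x)‖ := by simp
      _ ≤ _ := norm_sub_le _ _
  have h2 : ‖x‖ ^ 2 ≤ 2 * ‖y‖ ^ 2 + 2 * ‖y - x‖ ^ 2 := by
    have := pow_le_pow_left₀ (norm_nonneg x) h1 2
    nlinarith [sq_nonneg (‖y‖ - ‖y - x‖)]
  have hm : 0 < min b c := lt_min hb hc
  have h3 := mul_le_mul_of_nonneg_left h2 hm.le
  have h4 := mul_le_mul_of_nonneg_right (min_le_left b c) (sq_nonneg ‖y - x‖)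
  have h5 := mul_le_mul_of_nonneg_right (min_le_right b c) (sq_nonneg ‖y‖)
  nlinarith

/-- A product of a function dominated by a centred Gaussian and one dominated by a translated
Gaussian has small integral when the translation is large. -/
lemma norm_integral_mul_le_exp {b c M K : ℝ} (hb : 0 < b) (hc : 0 < c) (hM : 0 ≤ M) (hK : 0 ≤ K)
    {f k : RSp d → ℂ} (x : RSp d) (hf : ∀ y, ‖f y‖ ≤ M * Real.exp (-c * ‖y‖ ^ 2))
    (hk : ∀ y, ‖k y‖ ≤ K * Real.exp (-b * ‖y - x‖ ^ 2)) :
    ‖∫ y, f y * k y‖ ≤ M * K * (∫ y : RSp d, Real.exp (-(min b c / 2) * ‖y‖ ^ 2)) *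
      Real.exp (-(min b c / 4) * ‖x‖ ^ 2) := by
  have hm : 0 < min b c := lt_min hb hc
  have hint := integrable_exp_neg_mul_norm_sq (E := RSp d) (c := min b c / 2) (by positivity)
  have h := norm_integral_le_of_norm_le (f := fun y => f y * k y)
    (hint.const_mul (M * K * Real.exp (-(min b c / 4) * ‖x‖ ^ 2))) (ae_of_all _ fun y => by
      rw [norm_mul]
      calc ‖f y‖ * ‖k y‖ ≤ (M * Real.exp (-c * ‖y‖ ^ 2)) * (K * Real.exp (-b * ‖y - x‖ ^ 2)) :=
            mul_le_mul (hf y) (hk y) (norm_nonneg _) (by positivity)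
        _ = M * K * (Real.exp (-c * ‖y‖ ^ 2) * Real.exp (-b * ‖y - x‖ ^ 2)) := by ring
        _ ≤ M * K * (Real.exp (-(min b c / 4) * ‖x‖ ^ 2) *
              Real.exp (-(min b c / 2) * ‖y‖ ^ 2)) :=
            mul_le_mul_of_nonneg_left (exp_mul_exp_shift_le hb hc x y) (by positivity)
        _ = _ := by ring)
  rw [integral_const_mul] at h
  refine h.trans (le_of_eq (by ring))

/-! ### Decay of functions in Gelfand-Shilov spaces -/

/-- The bound `gsNorm (1/2) h g ≤ M`, spelled out. -/
def GSBound (h M : ℝ) (g : RSp d → ℂ) : Prop :=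
  ∀ (α β : Fin d → ℕ) (x : RSp d), ‖((∏ j, x j ^ β j : ℝ) : ℂ) * mderiv α g x‖ ≤
    M * (h ^ ((∑ j, α j) + ∑ j, β j) *
      (((∏ j, (α j).factorial) * ∏ j, (β j).factorial : ℕ) : ℝ) ^ (1 / 2 : ℝ))

lemma gsNorm_denom_pos {h : ℝ} (hh : 0 < h) (α β : Fin d → ℕ) :
    0 < h ^ ((∑ j, α j) + ∑ j, β j) *
      (((∏ j, (α j).factorial) * ∏ j, (β j).factorial : ℕ) : ℝ) ^ (1 / 2 : ℝ) := by
  have : (0 : ℝ) < (((∏ j, (α j).factorial) * ∏ j, (β j).factorial : ℕ) : ℝ) := by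
    exact_mod_cast Nat.mul_pos (Finset.prod_pos fun j _ => Nat.factorial_pos _)
      (Finset.prod_pos fun j _ => Nat.factorial_pos _)
  positivity

lemma GSBound.of_gsNorm {h : ℝ} (hh : 0 < h) {g : RSp d → ℂ} (hg : gsNorm (1 / 2) h g < ∞) :
    GSBound h (gsNorm (1 / 2) h g).toReal g := by
  intro α β x
  rw [← div_le_iff₀ (gsNorm_denom_pos hh α β), ← ENNReal.ofReal_le_iff_le_toReal hg.ne]
  exact le_iSup_of_le α (le_iSup_of_le β (le_iSup_of_le x le_rfl))

lemma GSBound.gsNorm_le {h M : ℝ} (hh : 0 < h) {g : RSp d → ℂ} (hg : GSBound h M g) :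
    gsNorm (1 / 2) h g ≤ ENNReal.ofReal M :=
  iSup_le fun α => iSup_le fun β => iSup_le fun x =>
    ENNReal.ofReal_le_ofReal ((div_le_iff₀ (gsNorm_denom_pos hh α β)).2 (hg α β x))

lemma mderiv_single (i : Fin d) (k : ℕ) (g : RSp d → ℂ) :
    mderiv (Pi.single i k) g = (pderiv i)^[k] g := by
  have key : ∀ l : List (Fin d), l.Nodup →
      l.foldr (fun j f => (pderiv j)^[(Pi.single i k : Fin d → ℕ) j] f) g =
        if i ∈ l then (pderiv i)^[k] g else g := by
    intro l
    induction l with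
    | nil => intro _; rfl
    | cons a l ih =>
      intro hl
      rw [List.nodup_cons] at hl
      rw [List.foldr_cons, ih hl.2]
      by_cases ha : a = i
      · subst ha; simp [hl.1]
      · have : i ≠ a := fun h => ha h.symm
        simp [ha, this]
  simpa [mderiv] using key _ (List.nodup_finRange d)

lemma mderiv_zero (g : RSp d → ℂ) : mderiv 0 g = g := by
  have key : ∀ l : List (Fin d),
      l.foldr (fun j f => (pderiv j)^[(0 : Fin d → ℕ) j] f) g = g := by
    intro l
    induction l with
    | nil => rfl
    | cons a l ih => rw [List.foldr_cons, ih]; rfl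
  exact key _

lemma GSBound.nonneg {h M : ℝ} {g : RSp d → ℂ} (hg : GSBound h M g) : 0 ≤ M := by
  have := hg 0 0 0
  simp at this
  exact (norm_nonneg _).trans this

/-- Only derivatives in one direction and powers of one coordinate enter. The factor `h^k √(k!)` is
kept explicit because the Fourier transform turns it into a bound on powers of the frequency, to
which `le_exp_of_pow_mul_le` applies a second time. -/
lemma GSBound.norm_iterate_pderiv_le {h M : ℝ} (hh : 0 < h) {g : RSp d → ℂ} (hg : GSBound h M g)
    (i : Fin d) (k : ℕ) (y : RSp d) :
    ‖(pderiv i)^[k] g y‖ ≤ 2 * M * (h ^ k * Real.sqrt k.factorial) *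
      Real.exp (-(1 / (4 * h ^ 2) / (d + 1)) * ‖y‖ ^ 2) := by
  have hM := hg.nonneg
  have hfac : ((∏ j, ((Pi.single i k : Fin d → ℕ) j).factorial : ℕ)) = k.factorial := by
    rw [Finset.prod_eq_single i] <;> simp +contextual
  have hsum : ∑ j, (Pi.single i k : Fin d → ℕ) j = k := by simp
  have key : ∀ j (m : ℕ), |y j| ^ m * ‖(pderiv i)^[k] g y‖ ≤
      (M * (h ^ k * Real.sqrt k.factorial)) * (h ^ m * Real.sqrt m.factorial) := by
    intro j m
    have := hg (Pi.single i k) (Pi.single j m) y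
    have hprod : ∏ l, y l ^ (Pi.single j m : Fin d → ℕ) l = y j ^ m := by
      rw [Finset.prod_eq_single j] <;> simp +contextual
    have hfac' : ((∏ l, ((Pi.single j m : Fin d → ℕ) l).factorial : ℕ)) = m.factorial := by
      rw [Finset.prod_eq_single j] <;> simp +contextual
    rw [hprod, mderiv_single, hfac, hfac', hsum, norm_mul, Complex.norm_real, norm_pow,
      Real.norm_eq_abs, ← Real.sqrt_eq_rpow, Nat.cast_mul, Real.sqrt_mul (by positivity)] at this
    refine this.trans (le_of_eq ?_)
    simp only [Finset.sum_pi_single', Finset.mem_univ, if_true]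
    rw [pow_add]; ring
  have hB : 0 ≤ M * (h ^ k * Real.sqrt k.factorial) := by positivity
  have := le_exp_norm_sq_of_forall (A := ‖(pderiv i)^[k] g y‖)
    (B := 2 * (M * (h ^ k * Real.sqrt k.factorial))) (c := 1 / (4 * h ^ 2)) (by positivity)
    (by positivity) y (by have := key i 0; simp at this; linarith) (fun j => by
      have := le_exp_of_pow_mul_le (norm_nonneg _) hB hh (key j)
      refine this.trans (le_of_eq ?_)
      congr 2; field_simp)
  refine this.trans (le_of_eq (by ring))

lemma GSBound.norm_le {h M : ℝ} (hh : 0 < h) {g : RSp d → ℂ} (hg : GSBound h M g) (y : RSp d) :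
    ‖g y‖ ≤ 2 * M * Real.exp (-(1 / (4 * h ^ 2) / (d + 1)) * ‖y‖ ^ 2) := by
  rcases isEmpty_or_nonempty (Fin d) with hd | ⟨⟨i⟩⟩
  · have h1 : ‖y‖ ^ 2 = 0 := by rw [EuclideanSpace.norm_sq_eq]; simp
    have h2 := hg 0 0 y
    rw [mderiv_zero] at h2
    simp at h2
    rw [h1]; simp
    linarith [hg.nonneg]
  · simpa using hg.norm_iterate_pderiv_le hh i 0 y

end

/-! ### Fourier transforms and Gaussian decay in phase space -/

section

variable {d : ℕ}

lemma continuous_gaussWindow : Continuous (gaussWindow : RSp d → ℂ) := by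
  unfold gaussWindow; fun_prop

lemma norm_gaussWindow (y : RSp d) :
    ‖gaussWindow y‖ = Real.pi ^ (-(d : ℝ) / 4) * Real.exp (-(1 / 2) * ‖y‖ ^ 2) := by
  rw [gaussWindow, Complex.norm_real, Real.norm_of_nonneg (by positivity)]
  congr 2; ring

lemma contDiff_iterate_pderiv {g : RSp d → ℂ} (hg : ContDiff ℝ (⊤ : ℕ∞) g) (i : Fin d) (k : ℕ) :
    ContDiff ℝ (⊤ : ℕ∞) ((pderiv i)^[k] g) :=
  (iterate_pderiv_lin i k 0 0 hg hg).1

lemma integrable_of_norm_le_exp {E : Type*} [NormedAddCommGroup E] [InnerProductSpace ℝ E]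
    [FiniteDimensional ℝ E] [MeasurableSpace E] [BorelSpace E] {f : E → ℂ} (hf : Continuous f)
    {c M : ℝ} (hc : 0 < c) (h : ∀ y, ‖f y‖ ≤ M * Real.exp (-c * ‖y‖ ^ 2)) : Integrable f :=
  ((integrable_exp_neg_mul_norm_sq hc).const_mul M).mono' hf.aestronglyMeasurable
    (ae_of_all _ h)

lemma fourier_pderiv {g : RSp d → ℂ} (hg : ContDiff ℝ (⊤ : ℕ∞) g) (i : Fin d)
    (h0 : Integrable g) (h1 : Integrable (pderiv i g)) (η : RSp d) :
    𝓕 (pderiv i g) η = (2 * Real.pi * η i * Complex.I) * 𝓕 g η := by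
  set e : RSp d → ℂ := fun y => Complex.exp ((-2 * Real.pi * inner ℝ y η : ℝ) * Complex.I) with he
  have hline : ∀ y, HasLineDerivAt ℝ e (-(2 * Real.pi * η i * Complex.I) * e y) y
      (EuclideanSpace.single i (1 : ℝ)) := by
    intro y
    unfold HasLineDerivAt
    have e1 : (fun t : ℝ => e (y + t • EuclideanSpace.single i (1 : ℝ))) =
        fun t : ℝ => Complex.exp ((-2 * Real.pi * (inner ℝ y η + t * η i) : ℝ) * Complex.I) := by
      funext t
      simp only [he]
      rw [inner_add_left, inner_smul_left, EuclideanSpace.inner_single_left]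
      simp
    rw [e1]
    have h2 : HasDerivAt (fun t : ℝ => (-2 * Real.pi * (inner ℝ y η + t * η i) : ℝ))
        (-2 * Real.pi * η i) 0 := by
      have := (((hasDerivAt_id (0 : ℝ)).mul_const (η i)).const_add (inner ℝ y η)).const_mul
        (-2 * Real.pi)
      simpa using this
    have h3 := ((h2.ofReal_comp).mul_const Complex.I).cexp
    refine h3.congr_deriv ?_
    simp only [he, zero_mul, add_zero]
    push_cast
    ring
  have hnorm : ∀ y, ‖e y‖ = 1 := fun y => Complex.norm_exp_ofReal_mul_I _
  have hec : Continuous e := by simp only [he]; fun_prop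
  have hmul : ∀ f : RSp d → ℂ, Integrable f → Integrable fun y => f y * e y := by
    intro f hf
    exact hf.mul_bdd hec.aestronglyMeasurable (ae_of_all _ fun y => (hnorm y).le)
  have hgl : ∀ y, HasLineDerivAt ℝ g (pderiv i g y) y (EuclideanSpace.single i (1 : ℝ)) := fun y =>
    ((hg.differentiable (by simp) y).lineDifferentiableAt).hasLineDerivAt
  have key := integral_bilinear_hasLineDerivAt_right_eq_neg_left_of_integrable (μ := volume)
    (f := g) (f' := pderiv i g) (g := e) (g' := fun y => -(2 * Real.pi * η i * Complex.I) * e y)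
    (v := EuclideanSpace.single i (1 : ℝ)) (B := ContinuousLinearMap.mul ℝ ℂ)
    (by simpa using hmul _ h1)
    (by
      have := (hmul _ h0).const_mul (-(2 * Real.pi * η i * Complex.I))
      refine this.congr (ae_of_all _ fun y => ?_)
      simp; ring)
    (by simpa using hmul _ h0) (fun y _ => hgl y) (fun y _ => hline y)
  simp only [ContinuousLinearMap.mul_apply'] at key
  have e2 : ∫ y, g y * (-(2 * Real.pi * η i * Complex.I) * e y) =
      -(2 * Real.pi * η i * Complex.I) * ∫ y, g y * e y := by
    rw [← integral_const_mul]; congr 1; funext y; ring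
  rw [e2] at key
  rw [Real.fourier_eq', Real.fourier_eq']
  have e3 : ∀ f : RSp d → ℂ, ∫ y, Complex.exp ((-2 * Real.pi * inner ℝ y η : ℝ) * Complex.I) • f y =
      ∫ y, f y * e y := fun f => by
    congr 1; funext y; rw [smul_eq_mul, mul_comm]
  rw [e3, e3]
  linear_combination key

lemma fourier_iterate_pderiv {g : RSp d → ℂ} (hg : ContDiff ℝ (⊤ : ℕ∞) g) (i : Fin d)
    (h : ∀ k, Integrable ((pderiv i)^[k] g)) (k : ℕ) (η : RSp d) :
    𝓕 ((pderiv i)^[k] g) η = (2 * Real.pi * η i * Complex.I) ^ k * 𝓕 g η := by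
  induction k with
  | zero => simp
  | succ k ih =>
    have h2 := h (k + 1)
    rw [Function.iterate_succ_apply'] at h2 ⊢
    rw [fourier_pderiv (contDiff_iterate_pderiv hg i k) i (h k) h2, ih]
    ring

lemma norm_fourier_le (f : RSp d → ℂ) (η : RSp d) : ‖𝓕 f η‖ ≤ ∫ y, ‖f y‖ := by
  rw [Real.fourier_eq']
  refine (norm_integral_le_integral_norm _).trans (le_of_eq ?_)
  congr 1; funext y
  rw [norm_smul, Complex.norm_exp_ofReal_mul_I, one_mul]

/-- Gaussian decay of the Fourier transform. -/
lemma GSBound.norm_fourier_le_exp {h M : ℝ} (hh : 0 < h) {g : RSp d → ℂ}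
    (hs : ContDiff ℝ (⊤ : ℕ∞) g) (hg : GSBound h M g) (η : RSp d) :
    ‖𝓕 g η‖ ≤ 4 * M * (∫ y : RSp d, Real.exp (-(1 / (4 * h ^ 2) / (d + 1)) * ‖y‖ ^ 2)) *
      Real.exp (-(Real.pi ^ 2 / h ^ 2 / (d + 1)) * ‖η‖ ^ 2) := by
  have hM := hg.nonneg
  set c : ℝ := 1 / (4 * h ^ 2) / (d + 1)
  have hc : 0 < c := by positivity
  set I : ℝ := ∫ y : RSp d, Real.exp (-c * ‖y‖ ^ 2)
  have hI : 0 ≤ I := integral_nonneg fun _ => (Real.exp_pos _).le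
  have hint := integrable_exp_neg_mul_norm_sq (E := RSp d) hc
  have hgen : ∀ (f : RSp d → ℂ) (K : ℝ), (∀ y, ‖f y‖ ≤ K * Real.exp (-c * ‖y‖ ^ 2)) →
      ‖𝓕 f η‖ ≤ K * I := by
    intro f K hf
    refine (norm_fourier_le f η).trans ?_
    have := integral_mono_of_nonneg (ae_of_all _ fun y => norm_nonneg (f y)) (hint.const_mul K)
      (ae_of_all _ hf)
    rwa [integral_const_mul] at this
  have h0 : ‖𝓕 g η‖ ≤ 2 * M * I := hgen g _ (hg.norm_le hh)
  refine (le_exp_norm_sq_of_forall (B := 4 * M * I) (c := Real.pi ^ 2 / h ^ 2) (by positivity)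
    (by positivity) η (by nlinarith [mul_nonneg hM hI]) fun i => ?_)
  have hik : ∀ k, Integrable ((pderiv i)^[k] g) := fun k =>
    integrable_of_norm_le_exp (contDiff_iterate_pderiv hs i k).continuous hc
      (hg.norm_iterate_pderiv_le hh i k)
  -- The `L¹` norm of the `k`-th derivative bounds `|2πη_i|^k |𝓕 g(η)|`. Its growth `h^k √(k!)` in
  -- `k` is exactly what yields Gaussian decay in `η_i`.
  have h1 : ∀ k : ℕ, |2 * Real.pi * η i| ^ k * ‖𝓕 g η‖ ≤
      (2 * M * I) * (h ^ k * Real.sqrt k.factorial) := by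
    intro k
    have h2 := hgen _ _ (hg.norm_iterate_pderiv_le hh i k)
    rw [fourier_iterate_pderiv hs i hik, norm_mul, norm_pow] at h2
    have e : ‖(2 * Real.pi * η i * Complex.I : ℂ)‖ = |2 * Real.pi * η i| := by
      rw [norm_mul, Complex.norm_I, mul_one]
      exact_mod_cast Complex.norm_real (2 * Real.pi * η i)
    rw [e] at h2
    refine h2.trans (le_of_eq (by ring))
  refine (le_exp_of_pow_mul_le (norm_nonneg _) (by positivity) hh h1).trans (le_of_eq ?_)
  have e : -(2 * Real.pi * η i) ^ 2 / (4 * h ^ 2) = -(Real.pi ^ 2 / h ^ 2) * η i ^ 2 := by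
    field_simp; ring
  rw [e]; ring

/-- The short-time Fourier transform of a function, with the frequency normalized as for `𝓕`. -/
noncomputable def fnSTFT (g : RSp d → ℂ) (x η : RSp d) : ℂ :=
  𝓕 (fun y => g y * gaussWindow (y - x)) η

/-- Computes the frequency-side Gaussian whose Fourier transform is the translated window times a
character, so that the window can be moved to the Fourier side. -/
lemma fourier_translated_gaussian (x η y : RSp d) :
    𝓕 (fun v : RSp d => Complex.exp (-((2 * Real.pi ^ 2 : ℝ) : ℂ) * ‖v - η‖ ^ 2 +
      2 * Real.pi * Complex.I * (inner ℝ x (v - η) : ℝ))) y =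
    ((2 * Real.pi : ℝ) : ℂ)⁻¹ ^ ((d : ℂ) / 2) * Complex.exp (-(‖x - y‖ ^ 2 : ℝ) / 2) *
      Complex.exp ((-2 * Real.pi * inner ℝ y η : ℝ) * Complex.I) := by
  have h1 := fourier_gaussian_innerProductSpace' (V := RSp d) (b := ((2 * Real.pi ^ 2 : ℝ) : ℂ))
    (by rw [Complex.ofReal_re]; positivity) x y
  rw [Real.fourier_eq'] at h1 ⊢
  rw [← integral_add_right_eq_self _ η]
  simp only [add_sub_cancel_right]
  have h2 : ∀ v : RSp d, Complex.exp ((-2 * Real.pi * inner ℝ (v + η) y : ℝ) * Complex.I) •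
      Complex.exp (-((2 * Real.pi ^ 2 : ℝ) : ℂ) * ‖v‖ ^ 2 +
        2 * Real.pi * Complex.I * (inner ℝ x v : ℝ)) =
      Complex.exp ((-2 * Real.pi * inner ℝ y η : ℝ) * Complex.I) *
      (Complex.exp ((-2 * Real.pi * inner ℝ v y : ℝ) * Complex.I) •
      Complex.exp (-((2 * Real.pi ^ 2 : ℝ) : ℂ) * ‖v‖ ^ 2 +
        2 * Real.pi * Complex.I * (inner ℝ x v : ℝ))) := by
    intro v
    rw [smul_eq_mul, smul_eq_mul, ← Complex.exp_add, ← Complex.exp_add, ← Complex.exp_add,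
      inner_add_left, real_inner_comm y η]
    congr 1
    push_cast; ring
  simp_rw [h2]
  rw [integral_const_mul, h1, mul_comm]
  congr 1
  have hpi : (Real.pi : ℂ) ≠ 0 := by exact_mod_cast Real.pi_ne_zero
  congr 1
  · rw [finrank_euclideanSpace_fin]
    congr 1
    push_cast
    field_simp
  · congr 1
    push_cast
    field_simp

/-- Parseval's formula: the transform also pairs `𝓕 g` with a Gaussian centred at `η`. This gives
decay in `η` in the same way as the definition gives decay in `x`. -/
lemma fnSTFT_eq_integral_fourier {g : RSp d → ℂ} (hg : Integrable g) (x η : RSp d) :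
    fnSTFT g x η = ∫ v, 𝓕 g v * ((Real.pi ^ (-(d : ℝ) / 4) * (2 * Real.pi) ^ ((d : ℝ) / 2) : ℝ) *
      Complex.exp (-((2 * Real.pi ^ 2 : ℝ) : ℂ) * ‖v - η‖ ^ 2 +
      2 * Real.pi * Complex.I * (inner ℝ x (v - η) : ℝ))) := by
  set G : RSp d → ℂ := fun v => Complex.exp (-((2 * Real.pi ^ 2 : ℝ) : ℂ) * ‖v - η‖ ^ 2 +
      2 * Real.pi * Complex.I * (inner ℝ x (v - η) : ℝ)) with hG
  set K : ℂ := ((Real.pi ^ (-(d : ℝ) / 4) * (2 * Real.pi) ^ ((d : ℝ) / 2) : ℝ) : ℂ) with hK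
  have hGint : Integrable G := by
    have := GaussianFourier.integrable_cexp_neg_mul_sq_norm_add (V := RSp d)
      (b := ((2 * Real.pi ^ 2 : ℝ) : ℂ)) (by rw [Complex.ofReal_re]; positivity)
      (2 * Real.pi * Complex.I) x
    exact this.comp_sub_right η
  have hflip := VectorFourier.integral_fourierIntegral_smul_eq_flip (e := Real.fourierChar)
    (μ := (volume : Measure (RSp d))) (ν := (volume : Measure (RSp d))) (L := innerₗ (RSp d))
    (f := g) (g := G) Real.continuous_fourierChar (by
      simpa using! (continuous_inner (𝕜 := ℝ) (E := RSp d))) hg hGint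
  rw [flip_innerₗ] at hflip
  have h1 : ∫ v, 𝓕 g v * G v = ∫ y, g y * 𝓕 G y := by
    simpa only [smul_eq_mul] using! hflip
  have h2 : ∫ v, 𝓕 g v * (K * G v) = K * ∫ v, 𝓕 g v * G v := by
    rw [← integral_const_mul]; congr 1; funext v; ring
  rw [h2, h1, ← integral_const_mul, fnSTFT, Real.fourier_eq']
  congr 1
  funext y
  rw [hG, fourier_translated_gaussian, smul_eq_mul, gaussWindow, hK]
  have h3 : ((2 * Real.pi : ℝ) : ℂ)⁻¹ ^ ((d : ℂ) / 2) =
      (((2 * Real.pi) ^ (-((d : ℝ) / 2)) : ℝ) : ℂ) := by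
    rw [← Complex.ofReal_inv, show ((d : ℂ) / 2) = (((d : ℝ) / 2 : ℝ) : ℂ) by push_cast; rfl,
      ← Complex.ofReal_cpow (by positivity), Real.inv_rpow (by positivity),
      Real.rpow_neg (by positivity)]
  have h4 : (2 * Real.pi) ^ ((d : ℝ) / 2) * (2 * Real.pi) ^ (-((d : ℝ) / 2)) = 1 := by
    rw [← Real.rpow_add (by positivity)]; simp
  rw [h3, norm_sub_rev x y]
  have h5 : (((2 * Real.pi) ^ ((d : ℝ) / 2) : ℝ) : ℂ) * (((2 * Real.pi) ^ (-((d : ℝ) / 2)) : ℝ) : ℂ)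
      = 1 := by rw [← Complex.ofReal_mul, h4]; simp
  push_cast at h5 ⊢
  linear_combination (-g y * ((Real.pi ^ (-(d : ℝ) / 4) : ℝ) : ℂ) *
    Complex.exp (-(‖y - x‖ : ℂ) ^ 2 / 2) *
    Complex.exp (-2 * Real.pi * (inner ℝ y η : ℝ) * Complex.I)) * h5

/-- Joint Gaussian decay of the short-time Fourier transform of functions in `𝒮_{1/2,h}`. -/
lemma exists_norm_fnSTFT_le (d : ℕ) {h : ℝ} (hh : 0 < h) : ∃ C c : ℝ, 0 ≤ C ∧ 0 < c ∧
    ∀ (g : RSp d → ℂ) (M : ℝ), ContDiff ℝ (⊤ : ℕ∞) g → GSBound h M g → ∀ x η,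
      ‖fnSTFT g x η‖ ≤ C * M * Real.exp (-c * (‖x‖ ^ 2 + ‖η‖ ^ 2)) := by
  set c₁ : ℝ := 1 / (4 * h ^ 2) / (d + 1) with hc₁
  set c₂ : ℝ := Real.pi ^ 2 / h ^ 2 / (d + 1) with hc₂
  have hc₁p : 0 < c₁ := by positivity
  have hc₂p : 0 < c₂ := by positivity
  set b₁ : ℝ := 1 / 2
  set b₂ : ℝ := 2 * Real.pi ^ 2
  have hb₁ : 0 < b₁ := by positivity
  have hb₂ : 0 < b₂ := by positivity
  have hm₁ : 0 < min b₁ c₁ := lt_min hb₁ hc₁p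
  have hm₂ : 0 < min b₂ c₂ := lt_min hb₂ hc₂p
  set I₀ : ℝ := ∫ y : RSp d, Real.exp (-c₁ * ‖y‖ ^ 2)
  have hI₀ : 0 ≤ I₀ := integral_nonneg fun _ => (Real.exp_pos _).le
  set I₁ : ℝ := ∫ y : RSp d, Real.exp (-(min b₁ c₁ / 2) * ‖y‖ ^ 2)
  have hI₁ : 0 ≤ I₁ := integral_nonneg fun _ => (Real.exp_pos _).le
  set I₂ : ℝ := ∫ y : RSp d, Real.exp (-(min b₂ c₂ / 2) * ‖y‖ ^ 2)
  have hI₂ : 0 ≤ I₂ := integral_nonneg fun _ => (Real.exp_pos _).le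
  set K₁ : ℝ := Real.pi ^ (-(d : ℝ) / 4)
  have hK₁ : 0 ≤ K₁ := by positivity
  set K₂ : ℝ := Real.pi ^ (-(d : ℝ) / 4) * (2 * Real.pi) ^ ((d : ℝ) / 2)
  have hK₂ : 0 ≤ K₂ := by positivity
  set C₁ : ℝ := 2 * K₁ * I₁
  set C₂ : ℝ := 4 * I₀ * K₂ * I₂
  set m : ℝ := min (min b₁ c₁ / 4) (min b₂ c₂ / 4)
  have hm : 0 < m := lt_min (by positivity) (by positivity)
  have hC₁ : 0 ≤ C₁ := by positivity
  have hC₂ : 0 ≤ C₂ := by positivity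
  refine ⟨max C₁ C₂, m / 2, le_max_of_le_left hC₁, by positivity, fun g M hs hg x η => ?_⟩
  have hM := hg.nonneg
  have hgint : Integrable g := integrable_of_norm_le_exp hs.continuous hc₁p (hg.norm_le hh)
  have h1 : ‖fnSTFT g x η‖ ≤ C₁ * M * Real.exp (-(min b₁ c₁ / 4) * ‖x‖ ^ 2) := by
    have := norm_integral_mul_le_exp hb₁ hc₁p (M := 2 * M) (K := K₁) (by positivity) hK₁
      (f := g) (k := fun y => gaussWindow (y - x) *
        Complex.exp ((-2 * Real.pi * inner ℝ y η : ℝ) * Complex.I)) x (hg.norm_le hh) (fun y => by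
          rw [norm_mul, Complex.norm_exp_ofReal_mul_I, mul_one, norm_gaussWindow])
    rw [fnSTFT, Real.fourier_eq']
    refine le_trans (le_of_eq ?_) (this.trans (le_of_eq (by ring)))
    congr 2; funext y; rw [smul_eq_mul]; ring
  have h2 : ‖fnSTFT g x η‖ ≤ C₂ * M * Real.exp (-(min b₂ c₂ / 4) * ‖η‖ ^ 2) := by
    rw [fnSTFT_eq_integral_fourier hgint]
    have := norm_integral_mul_le_exp hb₂ hc₂p (M := 4 * M * I₀) (K := K₂) (by positivity) hK₂
      (f := 𝓕 g) (k := fun v => ((Real.pi ^ (-(d : ℝ) / 4) * (2 * Real.pi) ^ ((d : ℝ) / 2) : ℝ) *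
      Complex.exp (-((2 * Real.pi ^ 2 : ℝ) : ℂ) * ‖v - η‖ ^ 2 +
      2 * Real.pi * Complex.I * (inner ℝ x (v - η) : ℝ)))) η (hg.norm_fourier_le_exp hh hs)
      (fun v => by
        rw [norm_mul, Complex.norm_real, Real.norm_of_nonneg (by positivity), Complex.norm_exp]
        refine le_of_eq ?_
        congr 2
        simp [b₂, ← Complex.ofReal_pow])
    refine this.trans (le_of_eq ?_)
    simp only [C₂]; ring
  set X := ‖x‖ ^ 2
  set Y := ‖η‖ ^ 2
  have hX : 0 ≤ X := by positivity
  have hY : 0 ≤ Y := by positivity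
  have hm1 : m ≤ min b₁ c₁ / 4 := min_le_left _ _
  have hm2 : m ≤ min b₂ c₂ / 4 := min_le_right _ _
  -- Decay in `x` alone and in `η` alone combine, because the larger of `X` and `Y` is at least half
  -- of their sum. This is the source of the rate `m / 2`.
  rcases le_total X Y with hXY | hXY
  · refine h2.trans (mul_le_mul (mul_le_mul_of_nonneg_right (le_max_right _ _) hM)
      (Real.exp_le_exp.2 ?_) (Real.exp_nonneg _) (by positivity))
    nlinarith
  · refine h1.trans (mul_le_mul (mul_le_mul_of_nonneg_right (le_max_left _ _) hM)
      (Real.exp_le_exp.2 ?_) (Real.exp_nonneg _) (by positivity))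
    nlinarith

end

/-! ### Inversion of the short-time Fourier transform -/

section

variable {d : ℕ}

lemma integrable_exp_prod (d : ℕ) {c : ℝ} (hc : 0 < c) :
    Integrable fun p : RSp d × RSp d => Real.exp (-c * (‖p.1‖ ^ 2 + ‖p.2‖ ^ 2)) := by
  have h := (integrable_exp_neg_mul_norm_sq (E := RSp d) hc).mul_prod
    (integrable_exp_neg_mul_norm_sq (E := RSp d) hc)
  refine h.congr (ae_of_all _ fun p => ?_)
  simp only
  rw [← Real.exp_add]; ring_nf

lemma integral_phaseSpace (f : RSp d × RSp d → ℂ) (hf : Integrable f) :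
    ∫ p, f p = ∫ x, ∫ η, f (x, η) :=
  integral_prod f hf

lemma continuous_fnSTFT {g : RSp d → ℂ} (hg : Continuous g) (hi : Integrable g) :
    Continuous fun p : RSp d × RSp d => fnSTFT g p.1 p.2 := by
  simp only [fnSTFT, Real.fourier_eq']
  have hcw := continuous_gaussWindow (d := d)
  refine continuous_of_dominated (bound := fun y => ‖g y‖ * Real.pi ^ (-(d : ℝ) / 4))
    (fun p => ?_) (fun p => ae_of_all _ fun y => ?_) (hi.norm.mul_const _)
    (ae_of_all _ fun y => ?_)
  · exact Continuous.aestronglyMeasurable (by fun_prop)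
  · rw [norm_smul, Complex.norm_exp_ofReal_mul_I, one_mul, norm_mul, norm_gaussWindow]
    refine mul_le_mul_of_nonneg_left (mul_le_of_le_one_right (by positivity) ?_) (norm_nonneg _)
    rw [Real.exp_le_one_iff]
    nlinarith [sq_nonneg ‖y - p.1‖]
  · fun_prop

/-- The window has `L²` norm one, so the inversion formula carries no constant. -/
lemma integral_gaussWindow_sq (y : RSp d) :
    ∫ x, gaussWindow (y - x) * gaussWindow (y - x) = 1 := by
  rw [integral_sub_left_eq_self (fun v => gaussWindow v * gaussWindow v) volume y]
  have h1 : ∀ v : RSp d, gaussWindow v * gaussWindow v =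
      ((Real.pi ^ (-(d : ℝ) / 2) * Real.exp (-1 * ‖v‖ ^ 2) : ℝ) : ℂ) := by
    intro v
    rw [gaussWindow, ← Complex.ofReal_mul]
    congr 1
    rw [mul_mul_mul_comm, ← Real.rpow_add Real.pi_pos, ← Real.exp_add]
    congr 2 <;> ring
  simp_rw [h1]
  rw [integral_complex_ofReal, integral_const_mul,
    GaussianFourier.integral_rexp_neg_mul_sq_norm one_pos, finrank_euclideanSpace_fin, div_one,
    ← Real.rpow_add Real.pi_pos]
  ring_nf
  simp

/-- The pairing with atoms is bilinear, so the synthesis kernel `exp(2πi⟨y, η⟩)` of Fourier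
inversion corresponds to the atom of frequency `-2πη`. -/
lemma stftAtom_neg_two_pi (x η y : RSp d) : stftAtom x (-(2 * Real.pi) • η) y =
    gaussWindow (y - x) * Complex.exp ((2 * Real.pi * inner ℝ y η : ℝ) * Complex.I) := by
  rw [stftAtom, inner_smul_right, gaussWindow, Complex.conj_ofReal]
  congr 2
  push_cast; ring

lemma norm_stftAtom_le (x ξ y : RSp d) : ‖stftAtom x ξ y‖ ≤ Real.pi ^ (-(d : ℝ) / 4) := by
  rw [stftAtom, norm_mul, RCLike.norm_conj, norm_gaussWindow]
  have : ‖Complex.exp (-Complex.I * ((inner ℝ y ξ : ℝ) : ℂ))‖ = 1 := by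
    rw [Complex.norm_exp]; simp
  rw [this, mul_one]
  refine mul_le_of_le_one_right (by positivity) ?_
  rw [Real.exp_le_one_iff]
  nlinarith [sq_nonneg ‖y - x‖]

/-- Fourier inversion of the short-time Fourier transform for a fixed position. -/
lemma integral_fnSTFT_mul_stftAtom_freq {g : RSp d → ℂ} (hg : Continuous g) (hgi : Integrable g)
    (x y : RSp d) (hif : Integrable fun η => fnSTFT g x η) :
    ∫ η, fnSTFT g x η * stftAtom x (-(2 * Real.pi) • η) y =
      g y * (gaussWindow (y - x) * gaussWindow (y - x)) := by
  have hcw := continuous_gaussWindow (d := d)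
  have hcx : Continuous fun v => g v * gaussWindow (v - x) := by fun_prop
  have hix : Integrable fun v => g v * gaussWindow (v - x) := by
    refine hgi.mul_bdd (c := Real.pi ^ (-(d : ℝ) / 4))
      (Continuous.aestronglyMeasurable (by fun_prop)) (ae_of_all _ fun v => ?_)
    rw [norm_gaussWindow]
    refine mul_le_of_le_one_right (by positivity) ?_
    rw [Real.exp_le_one_iff]
    nlinarith [sq_nonneg ‖v - x‖]
  have hinv := congrFun (hcx.fourierInv_fourier_eq hix hif) y
  rw [Real.fourierInv_eq'] at hinv
  have e : ∀ η, fnSTFT g x η * stftAtom x (-(2 * Real.pi) • η) y =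
      gaussWindow (y - x) * (Complex.exp ((2 * Real.pi * inner ℝ η y : ℝ) * Complex.I) •
        𝓕 (fun v => g v * gaussWindow (v - x)) η) := by
    intro η
    rw [stftAtom_neg_two_pi, fnSTFT, smul_eq_mul, real_inner_comm]
    ring
  simp_rw [e]
  rw [integral_const_mul, hinv]
  ring

lemma GSBound.integrable {h M : ℝ} (hh : 0 < h) {g : RSp d → ℂ}
    (hs : ContDiff ℝ (⊤ : ℕ∞) g) (hg : GSBound h M g) : Integrable g :=
  integrable_of_norm_le_exp hs.continuous (by positivity) (hg.norm_le hh)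

lemma GSBound.continuous_fnSTFT {h M : ℝ} (hh : 0 < h) {g : RSp d → ℂ}
    (hs : ContDiff ℝ (⊤ : ℕ∞) g) (hg : GSBound h M g) :
    Continuous fun p : RSp d × RSp d => fnSTFT g p.1 p.2 :=
  BargmannMod.continuous_fnSTFT hs.continuous (hg.integrable hh hs)

/-- The short-time Fourier transform of a function in `𝒮_{1/2,h}` can be integrated against
everything that is subgaussian with a small exponent. -/
lemma integrable_phaseSpace_mul {C c D δ : ℝ} (hC : 0 ≤ C) (hδ : δ < c)
    {V G : RSp d × RSp d → ℂ} (hV : Continuous V) (hG : Continuous G)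
    (hVb : ∀ p, ‖V p‖ ≤ C * Real.exp (-c * (‖p.1‖ ^ 2 + ‖p.2‖ ^ 2)))
    (hGb : ∀ p, ‖G p‖ ≤ D * Real.exp (δ * (‖p.1‖ ^ 2 + ‖p.2‖ ^ 2))) :
    Integrable fun p => V p * G p := by
  refine ((integrable_exp_prod d (sub_pos.2 hδ)).const_mul (C * D)).mono'
    (hV.mul hG).aestronglyMeasurable (ae_of_all _ fun p => ?_)
  rw [norm_mul]
  refine (mul_le_mul (hVb p) (hGb p) (norm_nonneg _)
    (mul_nonneg hC (Real.exp_nonneg _))).trans (le_of_eq ?_)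
  rw [mul_mul_mul_comm, ← Real.exp_add]
  ring_nf

lemma continuous_stftAtom_phaseSpace (y : RSp d) :
    Continuous fun p : RSp d × RSp d => stftAtom p.1 (-(2 * Real.pi) • p.2) y := by
  have hcw := continuous_gaussWindow (d := d)
  simp only [stftAtom_neg_two_pi]; fun_prop

/-- The inversion formula for the short-time Fourier transform. -/
lemma integral_fnSTFT_mul_stftAtom {h M : ℝ} (hh : 0 < h) {g : RSp d → ℂ}
    (hs : ContDiff ℝ (⊤ : ℕ∞) g) (hg : GSBound h M g) (y : RSp d) :
    ∫ p : RSp d × RSp d, fnSTFT g p.1 p.2 * stftAtom p.1 (-(2 * Real.pi) • p.2) y = g y := by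
  obtain ⟨C, c, hC, hc, hb⟩ := exists_norm_fnSTFT_le d hh
  have hb := hb g M hs hg
  have hcV := hg.continuous_fnSTFT hh hs
  have hCM := mul_nonneg hC hg.nonneg
  have hint := integrable_phaseSpace_mul hCM hc hcV (continuous_stftAtom_phaseSpace y)
    (fun p => hb p.1 p.2) (fun p => by simpa using norm_stftAtom_le _ _ _)
  rw [integral_phaseSpace _ hint]
  -- Fourier inversion in `η` at fixed `x` leaves `g(y)` times the squared window, whose integral
  -- over `x` is one.
  have hinner : ∀ x : RSp d, ∫ η, fnSTFT g x η * stftAtom x (-(2 * Real.pi) • η) y =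
      g y * (gaussWindow (y - x) * gaussWindow (y - x)) := by
    intro x
    have hcx : Continuous fun η => fnSTFT g x η := by
      have := hcV.comp (Continuous.prodMk_right x)
      simpa only [Function.comp_def] using this
    refine integral_fnSTFT_mul_stftAtom_freq hs.continuous (hg.integrable hh hs) x y
      (integrable_of_norm_le_exp (M := C * M) (c := c) hcx hc fun η => ?_)
    refine (hb x η).trans (mul_le_mul_of_nonneg_left (Real.exp_le_exp.2 ?_) hCM)
    nlinarith [sq_nonneg ‖x‖]
  simp only [hinner]
  rw [integral_const_mul, integral_gaussWindow_sq, mul_one]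

/-! ### Bounds for Gaussian atoms -/

/-- On the real axis the modulus does not see `q`. Off the axis `q` appears only through `q · Im z`,
which Young's inequality splits into `ε q²` and a multiple of `r²`. -/
lemma norm_gauss1_le_of_circle {ε : ℝ} (hε : 0 < ε) (p q t r : ℝ) (z : ℂ) (hz : ‖z - t‖ = r) :
    ‖gauss1 ((p : ℂ) - Complex.I * q) z‖ ≤
      Real.exp (p ^ 2 / 2 - (t - p) ^ 2 / 4 + ε * q ^ 2 + r ^ 2 * (1 / 2 + 1 / (4 * ε))) := by
  rw [gauss1, Complex.norm_exp, Real.exp_le_exp]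
  have h1 : (-(z ^ 2) / 2 + ((p : ℂ) - Complex.I * q) * z).re =
      -(z.re ^ 2 - z.im ^ 2) / 2 + (p * z.re + q * z.im) := by
    simp [pow_two]
  have h4 : r ^ 2 = (z.re - t) ^ 2 + z.im ^ 2 := by
    rw [← hz, ← Complex.normSq_eq_norm_sq, Complex.normSq_apply]
    simp; ring
  have h5 : q * z.im ≤ ε * q ^ 2 + z.im ^ 2 * (1 / (4 * ε)) := by
    have h6 : 0 ≤ ε * (q - z.im * (1 / (2 * ε))) ^ 2 := by positivity
    have h7 : ε * (q - z.im * (1 / (2 * ε))) ^ 2 =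
        ε * q ^ 2 - q * z.im + z.im ^ 2 * (1 / (4 * ε)) := by field_simp; ring
    linarith
  rw [h1, h4]
  have h8 : 0 ≤ (z.re - t) ^ 2 * (1 / (4 * ε)) := by positivity
  nlinarith [sq_nonneg (2 * (z.re - t) + (t - p))]

/-- The factor `exp(p²/2)` is the true size of the Gaussian and is later cancelled by the
normalization of the atoms. What remains is growth at an arbitrarily small rate `ε`, at the price of
a parameter `H` depending on `ε`. -/
lemma exists_gauss1_deriv_bound {ε : ℝ} (hε : 0 < ε) : ∃ C H : ℝ, 0 < C ∧ 0 < H ∧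
    ∀ (p q t : ℝ) (a b : ℕ),
      |t| ^ b * ‖iteratedDeriv a (gauss1 ((p : ℂ) - Complex.I * q)) t‖ ≤
        C * (Real.exp (p ^ 2 / 2) * Real.exp (ε * (p ^ 2 + q ^ 2))) *
          (H ^ (a + b) * (Real.sqrt a.factorial * Real.sqrt b.factorial)) := by
  set κ' : ℝ := 1 / 2 + 1 / (4 * ε)
  -- The power `|t|^b` costs `exp(κt²/2)`. The bound `κ ≤ 1/4` lets the factor `exp(-(t-p)²/4)`
  -- absorb it up to `exp(κp²)`, and `κ ≤ ε` keeps that within the allowance.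
  set κ : ℝ := min (1 / 4) ε
  have hκ : 0 < κ := lt_min (by norm_num) hε
  have hκ1 : κ ≤ 1 / 4 := min_le_left _ _
  have hκ2 : κ ≤ ε := min_le_right _ _
  set s : ℝ := (Real.sqrt κ)⁻¹
  have hs : 0 < s := by positivity
  set H : ℝ := max (Real.exp κ') s
  refine ⟨Real.exp κ', H, Real.exp_pos _, lt_max_of_lt_right hs, fun p q t a b => ?_⟩
  set w : ℂ := (p : ℂ) - Complex.I * q
  -- Cauchy's estimate on a circle of radius `√(a+1)`: the quotient `a! / (a+1)^{a/2}` is at most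
  -- `√(a!)`, while the factor `exp((a+1)κ')` is only geometric in `a`.
  have hr : (0 : ℝ) < Real.sqrt (a + 1) := Real.sqrt_pos.2 (by positivity)
  have hrsq : Real.sqrt (a + 1) ^ 2 = a + 1 := Real.sq_sqrt (by positivity)
  set Q : ℝ := Real.exp (p ^ 2 / 2 - (t - p) ^ 2 / 4 + ε * q ^ 2)
  have hc := Complex.norm_iteratedDeriv_le_of_forall_mem_sphere_norm_le (c := (t : ℂ)) a hr
    (f := gauss1 w) (differentiable_gauss1 w).diffContOnCl
    (C := Q * Real.exp ((a + 1) * κ')) (by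
      intro z hz
      have := norm_gauss1_le_of_circle hε p q t (Real.sqrt (a + 1)) z
        (by simpa [dist_eq_norm] using hz)
      rwa [hrsq, Real.exp_add] at this)
  have hfac : (a.factorial : ℝ) ≤ Real.sqrt a.factorial * Real.sqrt (a + 1) ^ a := by
    have h1 : (a.factorial : ℝ) ≤ ((a : ℝ) + 1) ^ a := by
      have : a.factorial ≤ (a + 1) ^ a :=
        (Nat.factorial_le_pow a).trans (Nat.pow_le_pow_left (Nat.le_succ a) a)
      exact_mod_cast this
    have h2 : Real.sqrt a.factorial ≤ Real.sqrt (a + 1) ^ a := by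
      refine Real.sqrt_le_iff.2 ⟨by positivity, ?_⟩
      rw [← pow_mul, mul_comm a 2, pow_mul, hrsq]
      exact h1
    calc (a.factorial : ℝ) = Real.sqrt a.factorial * Real.sqrt a.factorial :=
          (Real.mul_self_sqrt (by positivity)).symm
      _ ≤ _ := mul_le_mul_of_nonneg_left h2 (Real.sqrt_nonneg _)
  have hder : ‖iteratedDeriv a (gauss1 w) t‖ ≤ Real.sqrt a.factorial *
      (Q * Real.exp ((a + 1) * κ')) := by
    refine hc.trans ?_
    rw [div_le_iff₀ (by positivity)]
    nlinarith [mul_le_mul_of_nonneg_right hfac (show 0 ≤ Q * Real.exp ((a + 1) * κ') by positivity)]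
  have hpow : |t| ^ b ≤ s ^ b * Real.sqrt b.factorial * Real.exp (κ * t ^ 2 / 2) := by
    have h1 := Real.pow_div_factorial_le_exp (κ * t ^ 2) (by positivity) b
    rw [div_le_iff₀ (by positivity)] at h1
    refine le_of_sq_le_sq ?_ (by positivity)
    have e1 : (|t| ^ b) ^ 2 = (t ^ 2) ^ b := by rw [← pow_mul, mul_comm, pow_mul, sq_abs]
    have e2 : (s ^ b) ^ 2 = (κ ^ b)⁻¹ := by
      rw [← pow_mul, mul_comm, pow_mul, inv_pow, Real.sq_sqrt hκ.le, inv_pow]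
    have e3 : Real.exp (κ * t ^ 2 / 2) ^ 2 = Real.exp (κ * t ^ 2) := by
      rw [← Real.exp_nat_mul]; congr 1; push_cast; ring
    rw [mul_pow, mul_pow, e1, e2, e3, Real.sq_sqrt (by positivity), mul_assoc, inv_mul_eq_div,
      le_div_iff₀ (by positivity)]
    rw [mul_pow] at h1
    linarith
  have hQ : Real.exp (κ * t ^ 2 / 2) * Q ≤
      Real.exp (p ^ 2 / 2) * Real.exp (ε * (p ^ 2 + q ^ 2)) := by
    rw [← Real.exp_add, ← Real.exp_add, Real.exp_le_exp]
    have h1 : κ * t ^ 2 / 2 ≤ κ * (t - p) ^ 2 + κ * p ^ 2 := by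
      nlinarith [mul_nonneg hκ.le (sq_nonneg (t - 2 * p))]
    have h2 := mul_le_mul_of_nonneg_right hκ1 (sq_nonneg (t - p))
    have h3 := mul_le_mul_of_nonneg_right hκ2 (sq_nonneg p)
    nlinarith
  have hexp : Real.exp ((a + 1) * κ') = Real.exp κ' * Real.exp κ' ^ a := by
    rw [← Real.exp_nat_mul, ← Real.exp_add]; congr 1; ring
  have hHa : Real.exp κ' ^ a ≤ H ^ a := pow_le_pow_left₀ (Real.exp_nonneg _) (le_max_left _ _) _
  have hHb : s ^ b ≤ H ^ b := pow_le_pow_left₀ hs.le (le_max_right _ _) _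
  calc |t| ^ b * ‖iteratedDeriv a (gauss1 w) t‖
      ≤ (s ^ b * Real.sqrt b.factorial * Real.exp (κ * t ^ 2 / 2)) * (Real.sqrt a.factorial *
        (Q * Real.exp ((a + 1) * κ'))) := by gcongr
    _ = Real.exp κ' * (Real.exp (κ * t ^ 2 / 2) * Q) * ((Real.exp κ' ^ a * s ^ b) *
        (Real.sqrt a.factorial * Real.sqrt b.factorial)) := by rw [hexp]; ring
    _ ≤ Real.exp κ' * (Real.exp (p ^ 2 / 2) * Real.exp (ε * (p ^ 2 + q ^ 2))) *
        ((H ^ a * H ^ b) * (Real.sqrt a.factorial * Real.sqrt b.factorial)) := by gcongr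
    _ = _ := by rw [pow_add]

end

/-! ### Gaussians as elements of `𝒮_{1/2,h}` -/

section

variable {d : ℕ}

/-- The weight `h^{|α| + |β|} (α! β!)^{1/2}` in the norm of `𝒮_{1/2,h}`. -/
noncomputable def gsWeight (h : ℝ) (α β : Fin d → ℕ) : ℝ :=
  h ^ ((∑ j, α j) + ∑ j, β j) *
    (((∏ j, (α j).factorial) * ∏ j, (β j).factorial : ℕ) : ℝ) ^ (1 / 2 : ℝ)

lemma gsWeight_pos {h : ℝ} (hh : 0 < h) (α β : Fin d → ℕ) : 0 < gsWeight h α β :=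
  gsNorm_denom_pos hh α β

lemma GSBound.mono {h h' M M' : ℝ} (hh : 0 < h) (hle : h ≤ h') (hM : M ≤ M') {g : RSp d → ℂ}
    (hg : GSBound h M g) : GSBound h' M' g := by
  intro α β x
  have h0 := hg.nonneg
  have := pow_le_pow_left₀ hh.le hle ((∑ j, α j) + ∑ j, β j)
  refine (hg α β x).trans (mul_le_mul hM (mul_le_mul_of_nonneg_right this (by positivity)) ?_ ?_)
  · exact (gsNorm_denom_pos hh α β).le
  · exact h0.trans hM

lemma stftAtom_eq_smul (x ξ : RSp d) :
    stftAtom x ξ = (((Real.pi ^ (-(d : ℝ) / 4) * Real.exp (-‖x‖ ^ 2 / 2) : ℝ) : ℂ)) •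
      gaussDeriv (fun j => ofReIm x (-ξ) j) 0 := by
  funext y
  have h1 : ∑ j, ofReIm x (-ξ) j * (y j : ℂ) =
      ((inner ℝ y x : ℝ) : ℂ) - Complex.I * ((inner ℝ y ξ : ℝ) : ℂ) := by
    simp only [PiLp.inner_apply, RCLike.inner_apply, conj_trivial, Complex.ofReal_sum,
      Complex.ofReal_mul, Finset.mul_sum, ← Finset.sum_sub_distrib]
    refine Finset.sum_congr rfl fun j _ => ?_
    simp only [ofReIm, Complex.mk_eq_add_mul_I, PiLp.neg_apply]
    push_cast; ring
  rw [Pi.smul_apply, gaussDeriv_zero_apply, h1, stftAtom, gaussWindow, Complex.conj_ofReal,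
    norm_sub_sq_real, smul_eq_mul]
  push_cast
  rw [mul_assoc, mul_assoc, ← Complex.exp_add, ← Complex.exp_add]
  congr 2
  ring

/-- Gaussians with complex linear phase lie in some `𝒮_{1/2,H}`, with a bound that is as good as
the modulus of the phase allows. -/
lemma exists_gsBound_gaussDeriv (d : ℕ) {ε : ℝ} (hε : 0 < ε) : ∃ C H : ℝ, 0 < C ∧ 0 < H ∧
    ∀ w : CSp d, GSBound H (C * (Real.exp (‖rePart w‖ ^ 2 / 2) * Real.exp (ε * ‖w‖ ^ 2)))
      (gaussDeriv (fun j => w j) 0) := by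
  obtain ⟨C, H, hC, hH, hb⟩ := exists_gauss1_deriv_bound hε
  refine ⟨C ^ d, H, by positivity, hH, fun w α β x => ?_⟩
  have hw : ∀ j, w j = ((w j).re : ℂ) - Complex.I * ((-(w j).im : ℝ) : ℂ) := by
    intro j
    apply Complex.ext <;> simp
  have e1 : C ^ d * (Real.exp (‖rePart w‖ ^ 2 / 2) * Real.exp (ε * ‖w‖ ^ 2)) =
      ∏ j, C * (Real.exp ((w j).re ^ 2 / 2) * Real.exp (ε * ((w j).re ^ 2 + (-(w j).im) ^ 2))) := by
    rw [Finset.prod_mul_distrib, Finset.prod_mul_distrib, ← Real.exp_sum, ← Real.exp_sum,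
      ← Finset.mul_sum, ← Finset.sum_div, EuclideanSpace.norm_sq_eq, EuclideanSpace.norm_sq_eq]
    simp only [Finset.prod_const, Finset.card_univ, Fintype.card_fin, rePart, Real.norm_eq_abs,
      sq_abs]
    congr 4
    refine Finset.sum_congr rfl fun j _ => ?_
    rw [← Complex.normSq_eq_norm_sq, Complex.normSq_apply]; ring
  rw [mderiv_gaussDeriv, gaussDeriv, norm_mul, Complex.norm_real, norm_prod, norm_prod,
    ← Finset.prod_mul_distrib, ← Real.sqrt_eq_rpow, Nat.cast_mul, Nat.cast_prod, Nat.cast_prod,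
    Real.sqrt_mul (by positivity), Real.sqrt_prod _ (fun _ _ => by positivity),
    Real.sqrt_prod _ (fun _ _ => by positivity), ← Finset.sum_add_distrib,
    ← Finset.prod_pow_eq_pow_sum, ← Finset.prod_mul_distrib, ← Finset.prod_mul_distrib, e1,
    ← Finset.prod_mul_distrib]
  refine Finset.prod_le_prod (fun _ _ => by positivity) fun j _ => ?_
  rw [norm_pow, Real.norm_eq_abs]
  have := hb (w j).re (-(w j).im) (x j) (α j) (β j)
  rwa [← hw j] at this

lemma GSBound.smul {h M : ℝ} {g : RSp d → ℂ} (hs : ContDiff ℝ (⊤ : ℕ∞) g) (hg : GSBound h M g)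
    (c : ℂ) : GSBound h (‖c‖ * M) (c • g) := by
  intro α β x
  have e : mderiv α (c • g) = c • mderiv α g := by
    simpa using mderiv_lin α hs hs c 0
  rw [e, Pi.smul_apply, smul_eq_mul, mul_left_comm, norm_mul, mul_assoc]
  exact mul_le_mul_of_nonneg_left (hg α β x) (norm_nonneg _)

/-! ### Embedding of `𝒮_{1/2,h}` into a space of bounded functions -/

/-- The index set of the seminorms of `𝒮_{1/2,h}`. -/
abbrev GSIndex (d : ℕ) : Type := (Fin d → ℕ) × (Fin d → ℕ) × RSp d

/-- The functions `x^β ∂^α g(x) / (h^{|α|+|β|} (α! β!)^{1/2})`. -/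
noncomputable def gsCoord (h : ℝ) (g : RSp d → ℂ) (i : GSIndex d) : ℂ :=
  ((∏ j, i.2.2 j ^ i.2.1 j : ℝ) : ℂ) * mderiv i.1 g i.2.2 / (gsWeight h i.1 i.2.1 : ℂ)

lemma norm_gsCoord {h : ℝ} (hh : 0 < h) (g : RSp d → ℂ) (i : GSIndex d) :
    ‖gsCoord h g i‖ =
      ‖((∏ j, i.2.2 j ^ i.2.1 j : ℝ) : ℂ) * mderiv i.1 g i.2.2‖ / gsWeight h i.1 i.2.1 := by
  rw [gsCoord, norm_div, Complex.norm_real, Real.norm_of_nonneg (gsWeight_pos hh _ _).le]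

lemma gsBound_iff {h M : ℝ} (hh : 0 < h) {g : RSp d → ℂ} :
    GSBound h M g ↔ ∀ i, ‖gsCoord h g i‖ ≤ M := by
  constructor
  · intro hg i
    rw [norm_gsCoord hh, div_le_iff₀ (gsWeight_pos hh _ _)]
    exact hg _ _ _
  · intro hg α β x
    have := hg (α, β, x)
    rw [norm_gsCoord hh, div_le_iff₀ (gsWeight_pos hh _ _)] at this
    exact this

variable (d) in
/-- The space `𝒮_{1/2,h}`, as a subspace of `𝒮_{1/2}`. -/
def gsSub (h : ℝ) : Submodule ℂ (GelfandShilov d (1 / 2)) where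
  carrier := {φ | ∃ M, GSBound h M (φ : RSp d → ℂ)}
  zero_mem' := ⟨0, fun α β x => by
    have h0 : ContDiff ℝ (⊤ : ℕ∞) (0 : RSp d → ℂ) := contDiff_const
    have : mderiv α (0 : RSp d → ℂ) = 0 := by
      simpa using mderiv_lin α h0 h0 0 0
    simp [this]⟩
  add_mem' := by
    rintro f g ⟨M, hM⟩ ⟨N, hN⟩
    refine ⟨M + N, fun α β x => ?_⟩
    have e : mderiv α ((f + g : GelfandShilov d (1 / 2)) : RSp d → ℂ) =
        mderiv α (f : RSp d → ℂ) + mderiv α (g : RSp d → ℂ) := by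
      simpa using mderiv_lin α f.2.1 g.2.1 1 1
    rw [e, Pi.add_apply, mul_add, add_mul]
    exact (norm_add_le _ _).trans (add_le_add (hM α β x) (hN α β x))
  smul_mem' := by
    rintro c f ⟨M, hM⟩
    exact ⟨‖c‖ * M, hM.smul f.2.1 c⟩

/-- The isometric embedding of `𝒮_{1/2,h}` into the bounded functions on `GSIndex d`. -/
noncomputable def gsEmbed (h : ℝ) (hh : 0 < h) :
    gsSub d h →ₗ[ℂ] lp (fun _ : GSIndex d => ℂ) ∞ where
  toFun φ := ⟨gsCoord h (φ : RSp d → ℂ), by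
    obtain ⟨M, hM⟩ := φ.2
    refine memℓp_infty ⟨M, ?_⟩
    rintro _ ⟨i, rfl⟩
    exact (gsBound_iff hh).1 hM i⟩
  map_add' f g := by
    ext i
    have e : mderiv i.1 ((f + g : gsSub d h) : RSp d → ℂ) =
        mderiv i.1 (f : RSp d → ℂ) + mderiv i.1 (g : RSp d → ℂ) := by
      simpa using mderiv_lin i.1 f.1.2.1 g.1.2.1 1 1
    change gsCoord h ((f + g : gsSub d h) : RSp d → ℂ) i = gsCoord h _ i + gsCoord h _ i
    simp only [gsCoord]
    rw [e, Pi.add_apply]; ring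
  map_smul' c f := by
    ext i
    have e : mderiv i.1 ((c • f : gsSub d h) : RSp d → ℂ) = c • mderiv i.1 (f : RSp d → ℂ) := by
      simpa using mderiv_lin i.1 f.1.2.1 f.1.2.1 c 0
    change gsCoord h ((c • f : gsSub d h) : RSp d → ℂ) i = c • gsCoord h _ i
    simp only [gsCoord]
    rw [e, Pi.smul_apply, smul_eq_mul, smul_eq_mul]; ring

lemma gsEmbed_apply {h : ℝ} (hh : 0 < h) (φ : gsSub d h) (i : GSIndex d) :
    gsEmbed h hh φ i = gsCoord h (φ : RSp d → ℂ) i := rfl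

lemma norm_gsEmbed_le {h M : ℝ} (hh : 0 < h) (φ : gsSub d h)
    (hφ : GSBound h M (φ : RSp d → ℂ)) : ‖gsEmbed h hh φ‖ ≤ M :=
  lp.norm_le_of_forall_le hφ.nonneg ((gsBound_iff hh).1 hφ)

lemma gsBound_norm_gsEmbed {h : ℝ} (hh : 0 < h) (φ : gsSub d h) :
    GSBound h ‖gsEmbed h hh φ‖ (φ : RSp d → ℂ) :=
  (gsBound_iff hh).2 fun i => lp.norm_apply_le_norm (by simp) (gsEmbed h hh φ) i

lemma gsEmbed_injective {h : ℝ} (hh : 0 < h) : Function.Injective (gsEmbed (d := d) h hh) := by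
  refine (injective_iff_map_eq_zero _).2 fun φ hφ => ?_
  have hb := gsBound_norm_gsEmbed hh φ
  rw [hφ, norm_zero] at hb
  apply Subtype.ext
  apply Subtype.ext
  funext x
  have := hb 0 0 x
  rw [mderiv_zero] at this
  simpa using this

/-- A Gelfand-Shilov distribution, restricted to `𝒮_{1/2,h}`, extends to a continuous linear form
on a space of bounded functions. -/
lemma exists_extension_gsDual (u : GelfandShilovDual d (1 / 2)) {h : ℝ} (hh : 0 < h) :
    ∃ L : lp (fun _ : GSIndex d => ℂ) ∞ →L[ℂ] ℂ, ∀ φ : gsSub d h, L (gsEmbed h hh φ) = u.1 φ := by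
  obtain ⟨C, hC⟩ := u.2 h hh
  have hb : ∀ φ : gsSub d h, ‖u.1 φ‖ ≤ C * ‖gsEmbed h hh φ‖ := by
    intro φ
    have h1 := (gsBound_norm_gsEmbed hh φ).gsNorm_le hh
    have h2 := (hC φ.1 (h1.trans_lt ENNReal.ofReal_lt_top)).trans (mul_le_mul_right h1 _)
    have h3 := ENNReal.toReal_mono (ENNReal.mul_ne_top ENNReal.coe_ne_top ENNReal.ofReal_ne_top) h2
    rwa [toReal_enorm, ENNReal.toReal_mul, ENNReal.coe_toReal,
      ENNReal.toReal_ofReal (norm_nonneg _)] at h3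
  let e := LinearEquiv.ofInjective (gsEmbed (d := d) h hh) (gsEmbed_injective hh)
  let f₀ : LinearMap.range (gsEmbed (d := d) h hh) →ₗ[ℂ] ℂ :=
    (u.1.comp (gsSub d h).subtype).comp e.symm.toLinearMap
  have hf₀ : ∀ φ, f₀ (e φ) = u.1 φ := by
    intro φ
    simp [f₀]
  have hbd : ∀ y, ‖f₀ y‖ ≤ C * ‖y‖ := by
    intro y
    obtain ⟨φ, rfl⟩ := e.surjective y
    rw [hf₀]
    exact hb φ
  -- Hahn–Banach. Integrals can now be taken in a complete space of bounded functions, where a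
  -- continuous linear form passes under the integral sign; completeness of `𝒮_{1/2,h}` is not
  -- needed.
  obtain ⟨L, hL, -⟩ := exists_extension_norm_eq _ (f₀.mkContinuous C hbd)
  refine ⟨L, fun φ => ?_⟩
  rw [← hf₀ φ]
  exact hL (e φ)

/-- A locally bounded map into a space of bounded functions with holomorphic coordinates is
continuous. -/
lemma continuous_lp_of_differentiable {E ι : Type*} [NormedAddCommGroup E] [NormedSpace ℂ E]
    {f : E → lp (fun _ : ι => ℂ) ∞} (hd : ∀ i, Differentiable ℂ fun w => f w i)
    (hb : ∀ w, ∃ M, ∀ w' ∈ Metric.ball w 1, ‖f w'‖ ≤ M) : Continuous f := by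
  rw [continuous_iff_continuousAt]
  intro w
  obtain ⟨M, hM⟩ := hb w
  have hw : ‖f w‖ ≤ M := hM w (Metric.mem_ball_self one_pos)
  have hM0 : 0 ≤ M := (norm_nonneg _).trans hw
  have hlip : ∀ w' ∈ Metric.ball w 1, dist (f w') (f w) ≤ 2 * M * dist w' w := by
    intro w' hw'
    rw [dist_eq_norm]
    refine lp.norm_le_of_forall_le (by positivity) fun i => ?_
    -- The Schwarz lemma in each coordinate: values stay within `2M` of the value at the centre,
    -- which gives a Lipschitz constant independent of the coordinate.
    have h1 := Complex.dist_le_div_mul_dist_of_mapsTo_ball (f := fun w => f w i) (c := w) (z := w')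
      (R₁ := 1) (R₂ := 2 * M) (hd i).differentiableOn (fun v hv => by
        rw [Metric.mem_closedBall, dist_eq_norm]
        have h2 := lp.norm_apply_le_norm (by simp) (f v) i
        have h3 := lp.norm_apply_le_norm (by simp) (f w) i
        have := hM v hv
        exact (norm_sub_le _ _).trans (by linarith)) hw'
    rw [dist_eq_norm, div_one] at h1
    exact h1
  rw [ContinuousAt, tendsto_iff_dist_tendsto_zero]
  refine squeeze_zero' (Filter.Eventually.of_forall fun _ => dist_nonneg)
    (g := fun w' => 2 * M * dist w' w) ?_ ?_
  · filter_upwards [Metric.ball_mem_nhds w one_pos] with w' hw' using hlip w' hw'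
  · have : Continuous fun w' => 2 * M * dist w' w := by fun_prop
    simpa using this.tendsto w

end

/-! ### Holomorphic dependence of Gaussians on their parameter -/

section

variable {d : ℕ}

/-- Completing the square turns the parameter into a translation, so all derivatives in `t` are
visibly holomorphic in `w`. -/
lemma iteratedDeriv_gauss1 (a : ℕ) (w t : ℂ) : iteratedDeriv a (gauss1 w) t =
    Complex.exp (w ^ 2 / 2) * iteratedDeriv a (gauss1 0) (t - w) := by
  have e : gauss1 w = fun t => Complex.exp (w ^ 2 / 2) * (fun z => gauss1 0 (z - w)) t := by
    funext t
    simp only [gauss1]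
    rw [← Complex.exp_add]; congr 1; ring
  rw [e, iteratedDeriv_const_mul_field, iteratedDeriv_comp_sub_const]

lemma differentiable_gaussDeriv_param (a : Fin d → ℕ) (y : RSp d) :
    Differentiable ℂ fun w : CSp d => gaussDeriv (fun j => w j) a y := by
  have e : (fun w : CSp d => gaussDeriv (fun j => w j) a y) = fun w : CSp d =>
      ∏ j, Complex.exp ((w j) ^ 2 / 2) * iteratedDeriv (a j) (gauss1 0) ((y j : ℂ) - w j) :=
    funext fun w => Finset.prod_congr rfl fun j _ => iteratedDeriv_gauss1 _ _ _
  rw [e]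
  intro w
  suffices h : ∀ j, DifferentiableAt ℂ (fun w : CSp d =>
      Complex.exp ((w j) ^ 2 / 2) * iteratedDeriv (a j) (gauss1 0) ((y j : ℂ) - w j)) w by
    have := (HasFDerivAt.finsetProd (u := Finset.univ) fun j _ => (h j).hasFDerivAt).differentiableAt
    exact this
  intro j
  have hproj : Differentiable ℂ fun w : CSp d => w j :=
    (EuclideanSpace.proj (𝕜 := ℂ) j).differentiable
  have hsm : ContDiff ℂ (⊤ : ℕ∞) (gauss1 0) := (differentiable_gauss1 0).contDiff
  have hd : Differentiable ℂ (iteratedDeriv (a j) (gauss1 0)) :=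
    hsm.differentiable_iteratedDeriv (a j) (by exact_mod_cast ENat.natCast_lt_top _)
  have h1 : Differentiable ℂ fun w : CSp d => Complex.exp ((w j) ^ 2 / 2) :=
    (show Differentiable ℂ fun t : ℂ => Complex.exp (t ^ 2 / 2) by fun_prop).comp hproj
  exact (h1.mul (hd.comp ((differentiable_const _).sub hproj))) w

/-- The parameter of the Gaussian that underlies `stftAtom x (-2πη)`. -/
noncomputable def phasePoint (p : RSp d × RSp d) : CSp d := ofReIm p.1 ((2 * Real.pi) • p.2)

lemma continuous_phasePoint : Continuous (phasePoint : RSp d × RSp d → CSp d) :=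
  continuous_ofReIm.comp (f := fun p : RSp d × RSp d => (p.1, (2 * Real.pi) • p.2)) (by fun_prop)

/-- The coefficient of the Gaussian that underlies `stftAtom x (-2πη)`. -/
noncomputable def phaseCoeff (p : RSp d × RSp d) : ℂ :=
  ((Real.pi ^ (-(d : ℝ) / 4) * Real.exp (-‖p.1‖ ^ 2 / 2) : ℝ) : ℂ)

lemma continuous_phaseCoeff : Continuous (phaseCoeff : RSp d × RSp d → ℂ) := by
  unfold phaseCoeff; fun_prop

lemma stftAtom_phase (p : RSp d × RSp d) : stftAtom p.1 (-(2 * Real.pi) • p.2) =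
    phaseCoeff p • gaussDeriv (fun j => phasePoint p j) 0 := by
  rw [stftAtom_eq_smul, neg_smul, neg_neg]; rfl

/-! ### Differentiation under the integral sign -/

lemma contDiff_gaussDeriv (w : Fin d → ℂ) (a : Fin d → ℕ) :
    ContDiff ℝ (⊤ : ℕ∞) (gaussDeriv w a) := by
  rw [← mderiv_gaussDeriv]
  exact (foldr_pderiv_lin a (gaussDeriv_zero_mem w).1 (gaussDeriv_zero_mem w).1 0 0 _).1

lemma hasDerivAt_gaussDeriv_line (w : Fin d → ℂ) (a : Fin d → ℕ) (i : Fin d) (y : RSp d) (t : ℝ) :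
    HasDerivAt (fun t : ℝ => gaussDeriv w a (y + t • EuclideanSpace.single i (1 : ℝ)))
      (gaussDeriv w (Function.update a i (a i + 1)) (y + t • EuclideanSpace.single i (1 : ℝ))) t := by
  have hd := (contDiff_gaussDeriv w a).differentiable (by simp)
    (y + t • EuclideanSpace.single i (1 : ℝ))
  rw [← pderiv_gaussDeriv, pderiv, hd.lineDeriv_eq_fderiv]
  refine hd.hasFDerivAt.comp_hasDerivAt (f := fun t : ℝ =>
    y + t • EuclideanSpace.single i (1 : ℝ)) t ?_
  simpa using ((hasDerivAt_id t).smul_const (EuclideanSpace.single i (1 : ℝ))).const_add y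

/-- Dominated differentiation, one partial derivative at a time. The bounds are uniform in `y`, and
each step only raises the multi-index of the Gaussian, so the hypotheses reproduce themselves. -/
lemma mderiv_integral_gaussDeriv {X : Type*} [MeasurableSpace X] {μ : Measure X} {c : X → ℂ}
    {w : X → CSp d}
    (hmeas : ∀ a y, AEStronglyMeasurable (fun p => c p * gaussDeriv (fun j => w p j) a y) μ)
    (hdom : ∀ a, ∃ bound : X → ℝ, Integrable bound μ ∧
      ∀ p y, ‖c p * gaussDeriv (fun j => w p j) a y‖ ≤ bound p) (α : Fin d → ℕ) :
    mderiv α (fun y => ∫ p, c p * gaussDeriv (fun j => w p j) 0 y ∂μ) =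
      fun y => ∫ p, c p * gaussDeriv (fun j => w p j) α y ∂μ := by
  have h1 : ∀ (i : Fin d) (a : Fin d → ℕ),
      pderiv i (fun y => ∫ p, c p * gaussDeriv (fun j => w p j) a y ∂μ) =
        fun y => ∫ p, c p * gaussDeriv (fun j => w p j) (Function.update a i (a i + 1)) y ∂μ := by
    intro i a
    funext y
    obtain ⟨b₀, hb₀, hb₀'⟩ := hdom a
    obtain ⟨b₁, hb₁, hb₁'⟩ := hdom (Function.update a i (a i + 1))
    have key := hasDerivAt_integral_of_dominated_loc_of_deriv_le (𝕜 := ℝ) (μ := μ)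
      (F := fun t p => c p * gaussDeriv (fun j => w p j) a
        (y + t • EuclideanSpace.single i (1 : ℝ)))
      (F' := fun t p => c p * gaussDeriv (fun j => w p j) (Function.update a i (a i + 1))
        (y + t • EuclideanSpace.single i (1 : ℝ)))
      (x₀ := 0) (s := Set.univ) (bound := b₁) Filter.univ_mem
      (Filter.Eventually.of_forall fun t => hmeas a _)
      (hb₀.mono' (hmeas a _) (ae_of_all _ fun p => hb₀' p _)) (hmeas _ _)
      (ae_of_all _ fun p t _ => hb₁' p _) hb₁
      (ae_of_all _ fun p t _ => (hasDerivAt_gaussDeriv_line _ a i y t).const_mul (c p))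
    have h2 := key.2
    simp only [zero_smul, add_zero] at h2
    exact HasLineDerivAt.lineDeriv h2
  have h2 : ∀ (i : Fin d) (k : ℕ) (a : Fin d → ℕ),
      (pderiv i)^[k] (fun y => ∫ p, c p * gaussDeriv (fun j => w p j) a y ∂μ) =
        fun y => ∫ p, c p * gaussDeriv (fun j => w p j) (Function.update a i (a i + k)) y ∂μ := by
    intro i k
    induction k with
    | zero => intro a; simp
    | succ k ih =>
      intro a
      rw [Function.iterate_succ_apply, h1, ih]
      simp [add_comm, add_left_comm]
  have key : ∀ l : List (Fin d), l.Nodup →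
      l.foldr (fun i g => (pderiv i)^[α i] g)
        (fun y => ∫ p, c p * gaussDeriv (fun j => w p j) 0 y ∂μ) =
        fun y => ∫ p, c p * gaussDeriv (fun j => w p j) (fun j => if j ∈ l then α j else 0) y ∂μ := by
    intro l
    induction l with
    | nil => intro _; rfl
    | cons i l ih =>
      intro hl
      rw [List.nodup_cons] at hl
      rw [List.foldr_cons, ih hl.2, h2]
      have e : Function.update (fun j => if j ∈ l then α j else 0) i
          ((if i ∈ l then α i else 0) + α i) = fun j => if j ∈ i :: l then α j else 0 := by
        funext j
        by_cases hj : j = i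
        · subst hj; simp [hl.1]
        · simp [hj]
      rw [e]
  simpa [mderiv] using key _ (List.nodup_finRange d)

end

/-! ### Reconstruction of a distribution from its short-time Fourier transform -/

section

variable {d : ℕ}

/-- The Gaussian `y ↦ exp (-|y|²/2 + ⟨w, y⟩)` as an element of `𝒮_{1/2}`. -/
noncomputable def gaussGS (w : CSp d) : GelfandShilov d (1 / 2) :=
  ⟨gaussDeriv (fun j => w j) 0, gaussDeriv_zero_mem _⟩

/-- The test function of the short-time Fourier transform at position `x`, frequency `-2πη`. -/
noncomputable def atomGS (p : RSp d × RSp d) : GelfandShilov d (1 / 2) :=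
  ⟨stftAtom p.1 (-(2 * Real.pi) • p.2), stftAtom_mem _ _⟩

lemma atomGS_eq (p : RSp d × RSp d) : atomGS p = phaseCoeff p • gaussGS (phasePoint p) :=
  Subtype.ext (stftAtom_phase p)

/-- Each coordinate is entire in `w` and the norm is locally bounded. Continuity in norm supplies
strong measurability for the Bochner integral below; measurability of the coordinates would not be
enough, as spaces of bounded functions are in general not separable. -/
lemma continuous_gsEmbed_gaussGS {h : ℝ} (hh : 0 < h) (hmem : ∀ w : CSp d, gaussGS w ∈ gsSub d h)
    {C ε : ℝ} (hC : 0 ≤ C) (hε : 0 ≤ ε)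
    (hb : ∀ w : CSp d, GSBound h (C * (Real.exp (‖rePart w‖ ^ 2 / 2) * Real.exp (ε * ‖w‖ ^ 2)))
      (gaussDeriv (fun j => w j) 0)) :
    Continuous fun w : CSp d => gsEmbed h hh ⟨gaussGS w, hmem w⟩ := by
  refine continuous_lp_of_differentiable (fun i => ?_) fun w => ?_
  · have e : (fun w : CSp d => gsEmbed h hh ⟨gaussGS w, hmem w⟩ i) = fun w : CSp d =>
        ((∏ j, i.2.2 j ^ i.2.1 j : ℝ) : ℂ) * gaussDeriv (fun j => w j) i.1 i.2.2 /
          (gsWeight h i.1 i.2.1 : ℂ) := by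
      funext w
      rw [gsEmbed_apply, gsCoord]
      simp only [gaussGS]
      rw [mderiv_gaussDeriv]
    rw [e]
    simp_rw [div_eq_mul_inv]
    exact ((differentiable_gaussDeriv_param _ _).const_mul _).mul_const _
  · refine ⟨C * (Real.exp ((‖w‖ + 1) ^ 2 / 2) * Real.exp (ε * (‖w‖ + 1) ^ 2)), fun w' hw' => ?_⟩
    refine (norm_gsEmbed_le hh _ (hb w')).trans ?_
    have h1 : ‖w'‖ ≤ ‖w‖ + 1 := by
      have := norm_add_le w (w' - w)
      rw [Metric.mem_ball, dist_eq_norm] at hw'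
      rw [add_sub_cancel] at this
      linarith
    have h2 : ‖w'‖ ^ 2 ≤ (‖w‖ + 1) ^ 2 := pow_le_pow_left₀ (norm_nonneg _) h1 2
    have h3 : ‖rePart w'‖ ^ 2 ≤ ‖w'‖ ^ 2 := by
      rw [← norm_sq_rePart_add_imPart w']; nlinarith [sq_nonneg ‖imPart w'‖]
    have h4 := Real.exp_le_exp.2 (div_le_div_of_nonneg_right (h3.trans h2) zero_le_two)
    have h5 := Real.exp_le_exp.2 (mul_le_mul_of_nonneg_left h2 hε)
    exact mul_le_mul_of_nonneg_left (mul_le_mul h4 h5 (by positivity) (by positivity)) hC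

lemma norm_phasePoint_sq_le (p : RSp d × RSp d) :
    ‖phasePoint p‖ ^ 2 ≤ 4 * Real.pi ^ 2 * (‖p.1‖ ^ 2 + ‖p.2‖ ^ 2) := by
  rw [phasePoint, norm_sq_ofReIm, norm_smul, Real.norm_of_nonneg (by positivity)]
  have : 1 ≤ 4 * Real.pi ^ 2 := by nlinarith [Real.pi_gt_three]
  rw [mul_pow, mul_pow]
  nlinarith [mul_le_mul_of_nonneg_right this (sq_nonneg ‖p.1‖)]

/-- The normalization of the atoms cancels the factor `exp(|x|²/2)` of the Gaussian bounds exactly,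
leaving only the growth at rate `ε`. -/
lemma norm_phaseCoeff_mul (p : RSp d × RSp d) : ‖phaseCoeff p‖ *
    Real.exp (‖rePart (phasePoint p)‖ ^ 2 / 2) = Real.pi ^ (-(d : ℝ) / 4) := by
  rw [phaseCoeff, Complex.norm_real, Real.norm_of_nonneg (by positivity)]
  have : rePart (phasePoint p) = p.1 := rfl
  rw [this, mul_assoc, ← Real.exp_add]
  ring_nf; simp

/-- The short-time Fourier transform of a Gelfand-Shilov distribution is continuous. -/
lemma continuous_apply_atomGS (u : GelfandShilovDual d (1 / 2)) :
    Continuous fun p : RSp d × RSp d => u.1 (atomGS p) := by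
  obtain ⟨C, H, hC, hH, hb⟩ := exists_gsBound_gaussDeriv d one_pos
  obtain ⟨L, hL⟩ := exists_extension_gsDual u hH
  have hmem : ∀ w : CSp d, gaussGS w ∈ gsSub d H := fun w => ⟨_, hb w⟩
  have hc := continuous_gsEmbed_gaussGS hH hmem hC.le zero_le_one hb
  have e : ∀ p : RSp d × RSp d, u.1 (atomGS p) =
      phaseCoeff p * L (gsEmbed H hH ⟨gaussGS (phasePoint p), hmem _⟩) := by
    intro p
    rw [atomGS_eq, map_smul, smul_eq_mul, hL]
  simp_rw [e]
  exact continuous_phaseCoeff.mul (L.continuous.comp (hc.comp continuous_phasePoint))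

/-- The short-time Fourier transform of a Gelfand-Shilov distribution grows slower than every
Gaussian. -/
lemma exists_norm_apply_atomGS_le (u : GelfandShilovDual d (1 / 2)) {ε : ℝ} (hε : 0 < ε) :
    ∃ C : ℝ, 0 ≤ C ∧ ∀ p : RSp d × RSp d,
      ‖u.1 (atomGS p)‖ ≤ C * Real.exp (ε * (‖p.1‖ ^ 2 + ‖p.2‖ ^ 2)) := by
  have hpi : 0 < 4 * Real.pi ^ 2 := by positivity
  obtain ⟨C, H, hC, hH, hb⟩ := exists_gsBound_gaussDeriv d (ε := ε / (4 * Real.pi ^ 2))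
    (by positivity)
  obtain ⟨L, hL⟩ := exists_extension_gsDual u hH
  have hmem : ∀ w : CSp d, gaussGS w ∈ gsSub d H := fun w => ⟨_, hb w⟩
  refine ⟨‖L‖ * (Real.pi ^ (-(d : ℝ) / 4) * C), by positivity, fun p => ?_⟩
  have e : u.1 (atomGS p) =
      phaseCoeff p * L (gsEmbed H hH ⟨gaussGS (phasePoint p), hmem _⟩) := by
    rw [atomGS_eq, map_smul, smul_eq_mul, hL]
  rw [e, norm_mul]
  have h1 := L.le_opNorm (gsEmbed H hH ⟨gaussGS (phasePoint p), hmem _⟩)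
  have h2 := norm_gsEmbed_le hH ⟨gaussGS (phasePoint p), hmem _⟩ (hb (phasePoint p))
  have h3 := norm_phaseCoeff_mul p
  have h4 : Real.exp (ε / (4 * Real.pi ^ 2) * ‖phasePoint p‖ ^ 2) ≤
      Real.exp (ε * (‖p.1‖ ^ 2 + ‖p.2‖ ^ 2)) := by
    rw [Real.exp_le_exp, div_mul_eq_mul_div, div_le_iff₀ hpi]
    nlinarith [norm_phasePoint_sq_le p]
  calc ‖phaseCoeff p‖ * ‖L (gsEmbed H hH ⟨gaussGS (phasePoint p), hmem _⟩)‖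
      ≤ ‖phaseCoeff p‖ * (‖L‖ * (C * (Real.exp (‖rePart (phasePoint p)‖ ^ 2 / 2) *
          Real.exp (ε / (4 * Real.pi ^ 2) * ‖phasePoint p‖ ^ 2)))) := by
        refine mul_le_mul_of_nonneg_left (h1.trans ?_) (norm_nonneg _)
        exact mul_le_mul_of_nonneg_left h2 (norm_nonneg _)
    _ = ‖L‖ * ((‖phaseCoeff p‖ * Real.exp (‖rePart (phasePoint p)‖ ^ 2 / 2)) * C) *
          Real.exp (ε / (4 * Real.pi ^ 2) * ‖phasePoint p‖ ^ 2) := by ring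
    _ ≤ _ := by rw [h3]; gcongr

/-- A Gelfand-Shilov distribution is determined by its short-time Fourier transform. -/
lemma gsDual_apply_eq_integral (u : GelfandShilovDual d (1 / 2)) (φ : GelfandShilov d (1 / 2)) :
    u.1 φ = ∫ p : RSp d × RSp d, fnSTFT (φ : RSp d → ℂ) p.1 p.2 * u.1 (atomGS p) := by
  obtain ⟨hs, h, hh, hφ⟩ := φ.2
  set g : RSp d → ℂ := (φ : RSp d → ℂ) with hg
  set M : ℝ := (gsNorm (1 / 2) h g).toReal
  have hφM : GSBound h M g := GSBound.of_gsNorm hh hφ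
  have hM := hφM.nonneg
  obtain ⟨C, c, hC, hc, hV⟩ := exists_norm_fnSTFT_le d hh
  have hV := hV g M hs hφM
  have hVc := hφM.continuous_fnSTFT hh hs
  have hpi : 0 < 4 * Real.pi ^ 2 := by positivity
  -- The atoms may consume only half of the decay rate `c` of the transform of `φ`; the factor `4π²`
  -- comes from the frequency `2πη`. The rate `c` depends on `h`, and the parameter `H` of the
  -- Gaussians depends in turn on `ε`.
  set ε : ℝ := c / 2 / (4 * Real.pi ^ 2) with hε
  have hεp : 0 < ε := by positivity
  obtain ⟨A, H, hA, hH, hb⟩ := exists_gsBound_gaussDeriv d hεp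
  -- One space `𝒮_{1/2,h'}` now contains both `φ` and all Gaussians.
  set h' : ℝ := max h H
  have hh' : 0 < h' := lt_max_of_lt_left hh
  have hb' : ∀ w : CSp d, GSBound h' (A * (Real.exp (‖rePart w‖ ^ 2 / 2) *
      Real.exp (ε * ‖w‖ ^ 2))) (gaussDeriv (fun j => w j) 0) :=
    fun w => (hb w).mono hH (le_max_right _ _) le_rfl
  have hmem : ∀ w : CSp d, gaussGS w ∈ gsSub d h' := fun w => ⟨_, hb' w⟩
  have hφmem : φ ∈ gsSub d h' := ⟨M, hφM.mono hh (le_max_left _ _) le_rfl⟩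
  obtain ⟨L, hL⟩ := exists_extension_gsDual u hh'
  have hcE := continuous_gsEmbed_gaussGS hh' hmem hA.le hεp.le hb'
  set cf : RSp d × RSp d → ℂ := fun p => fnSTFT g p.1 p.2 * phaseCoeff p with hcf
  have hcfc : Continuous cf := hVc.mul continuous_phaseCoeff
  set B : RSp d × RSp d → ℝ := fun p => A * (Real.exp (‖rePart (phasePoint p)‖ ^ 2 / 2) *
      Real.exp (ε * ‖phasePoint p‖ ^ 2)) with hB
  have hB0 : ∀ p, 0 ≤ B p := fun p => by positivity
  set K : ℝ := C * M * Real.pi ^ (-(d : ℝ) / 4) * A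
  have hcfB : ∀ p, ‖cf p‖ * B p ≤ K * Real.exp (-(c / 2) * (‖p.1‖ ^ 2 + ‖p.2‖ ^ 2)) := by
    intro p
    have h3 := norm_phaseCoeff_mul p
    have h4 : Real.exp (ε * ‖phasePoint p‖ ^ 2) ≤
        Real.exp (c / 2 * (‖p.1‖ ^ 2 + ‖p.2‖ ^ 2)) := by
      rw [Real.exp_le_exp, hε, div_mul_eq_mul_div, div_le_iff₀ hpi]
      nlinarith [norm_phasePoint_sq_le p]
    calc ‖cf p‖ * B p = ‖fnSTFT g p.1 p.2‖ * (‖phaseCoeff p‖ *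
          Real.exp (‖rePart (phasePoint p)‖ ^ 2 / 2)) * A *
            Real.exp (ε * ‖phasePoint p‖ ^ 2) := by
          simp only [hcf, hB, norm_mul]; ring
      _ ≤ (C * M * Real.exp (-c * (‖p.1‖ ^ 2 + ‖p.2‖ ^ 2))) * Real.pi ^ (-(d : ℝ) / 4) * A *
            Real.exp (c / 2 * (‖p.1‖ ^ 2 + ‖p.2‖ ^ 2)) := by
          rw [h3]
          have := hV p.1 p.2
          gcongr
      _ = K * (Real.exp (-c * (‖p.1‖ ^ 2 + ‖p.2‖ ^ 2)) *
            Real.exp (c / 2 * (‖p.1‖ ^ 2 + ‖p.2‖ ^ 2))) := by ring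
      _ = _ := by rw [← Real.exp_add]; ring_nf
  have hdomint : Integrable fun p : RSp d × RSp d =>
      K * Real.exp (-(c / 2) * (‖p.1‖ ^ 2 + ‖p.2‖ ^ 2)) :=
    (integrable_exp_prod d (by positivity)).const_mul _
  set E : RSp d × RSp d → lp (fun _ : GSIndex d => ℂ) ∞ := fun p =>
    gsEmbed h' hh' ⟨gaussGS (phasePoint p), hmem _⟩ with hE
  have hEc : Continuous E := hcE.comp continuous_phasePoint
  have hint : Integrable fun p => cf p • E p := by
    refine hdomint.mono' (hcfc.smul hEc).aestronglyMeasurable (ae_of_all _ fun p => ?_)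
    rw [norm_smul]
    exact (mul_le_mul_of_nonneg_left (norm_gsEmbed_le hh' _ (hb' _)) (norm_nonneg _)).trans (hcfB p)
  have hder : ∀ α, mderiv α g = fun y => ∫ p, cf p * gaussDeriv (fun j => phasePoint p j) α y := by
    intro α
    have h1 : g = fun y => ∫ p, cf p * gaussDeriv (fun j => phasePoint p j) 0 y := by
      funext y
      rw [← integral_fnSTFT_mul_stftAtom hh hs hφM y]
      congr 1; funext p
      rw [stftAtom_phase, Pi.smul_apply, smul_eq_mul, hcf, mul_assoc]
    rw [h1]
    refine mderiv_integral_gaussDeriv (fun a y => ?_) (fun a => ?_) α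
    · exact (hcfc.mul ((differentiable_gaussDeriv_param a y).continuous.comp
        continuous_phasePoint)).aestronglyMeasurable
    · refine ⟨fun p => gsWeight h' a 0 *
        (K * Real.exp (-(c / 2) * (‖p.1‖ ^ 2 + ‖p.2‖ ^ 2))), hdomint.const_mul _, fun p y => ?_⟩
      have h2 := hb' (phasePoint p) a 0 y
      rw [mderiv_gaussDeriv] at h2
      simp only [Pi.zero_apply, pow_zero, Finset.prod_const_one, Complex.ofReal_one, one_mul] at h2
      have h3 : ‖gaussDeriv (fun j => phasePoint p j) a y‖ ≤ B p * gsWeight h' a 0 := by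
        simpa [gsWeight] using h2
      rw [norm_mul]
      calc ‖cf p‖ * ‖gaussDeriv (fun j => phasePoint p j) a y‖
          ≤ ‖cf p‖ * (B p * gsWeight h' a 0) := mul_le_mul_of_nonneg_left h3 (norm_nonneg _)
        _ = gsWeight h' a 0 * (‖cf p‖ * B p) := by ring
        _ ≤ _ := mul_le_mul_of_nonneg_left (hcfB p) (gsWeight_pos hh' _ _).le
  -- The inversion formula lifted to an identity of Bochner integrals in the space of bounded
  -- functions, checked coordinate by coordinate by differentiating under the integral sign.
  -- Applying `L` to it gives the claim.
  have hkey : ∫ p, cf p • E p = gsEmbed h' hh' ⟨φ, hφmem⟩ := by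
    ext i
    have h1 := (lp.evalCLM ℂ (fun _ : GSIndex d => ℂ) ∞ i).integral_comp_comm hint
    have h2 : ∀ x : lp (fun _ : GSIndex d => ℂ) ∞,
        lp.evalCLM ℂ (fun _ : GSIndex d => ℂ) ∞ i x = x i := fun x => rfl
    rw [h2] at h1
    rw [← h1, gsEmbed_apply, gsCoord]
    change _ = ((∏ j, i.2.2 j ^ i.2.1 j : ℝ) : ℂ) * mderiv i.1 g i.2.2 / _
    rw [hder, mul_div_right_comm, ← integral_const_mul]
    congr 1; funext p
    rw [h2]
    change cf p * E p i = _
    rw [hE]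
    simp only
    rw [gsEmbed_apply, gsCoord]
    simp only [gaussGS]
    rw [mderiv_gaussDeriv]
    ring
  calc u.1 φ = L (gsEmbed h' hh' ⟨φ, hφmem⟩) := (hL ⟨φ, hφmem⟩).symm
    _ = ∫ p, L (cf p • E p) := by rw [← hkey, L.integral_comp_comm hint]
    _ = _ := by
      congr 1; funext p
      rw [map_smul, hE, hL, atomGS_eq, map_smul, smul_eq_mul, smul_eq_mul, hcf]
      ring

end

section

variable {d : ℕ}

/-! ### The Bargmann kernel in phase space -/

variable (d) in
/-- The linear identification `(x, η) ↦ (x + 2πiη)/√2` of phase space with `ℂ^d`. -/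
noncomputable def holEquiv : (RSp d × RSp d) ≃L[ℝ] CSp d :=
  LinearEquiv.toContinuousLinearEquiv
    { toFun := fun p => ofReIm ((Real.sqrt 2)⁻¹ • p.1) (((Real.sqrt 2)⁻¹ * (2 * Real.pi)) • p.2)
      invFun := fun z => (Real.sqrt 2 • rePart z, (Real.sqrt 2 / (2 * Real.pi)) • imPart z)
      map_add' := fun p q => by
        ext j
        apply Complex.ext <;> simp [ofReIm]
      map_smul' := fun c p => by
        ext j
        apply Complex.ext
        · simp [ofReIm]; ring
        · simp [ofReIm]; ring
      left_inv := fun p => by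
        have hp := Real.pi_ne_zero
        ext j <;> simp [ofReIm, rePart, imPart] <;> field_simp
      right_inv := fun z => by
        have hp := Real.pi_ne_zero
        ext j
        apply Complex.ext <;> simp [ofReIm, rePart, imPart]
        field_simp }

lemma holEquiv_apply (p : RSp d × RSp d) : holEquiv d p =
    ofReIm ((Real.sqrt 2)⁻¹ • p.1) (((Real.sqrt 2)⁻¹ * (2 * Real.pi)) • p.2) := rfl

lemma holEquiv_coord (p : RSp d × RSp d) (j : Fin d) : holEquiv d p j =
    ((Real.sqrt 2)⁻¹ : ℝ) * ((p.1 j : ℂ) + 2 * Real.pi * (p.2 j : ℂ) * Complex.I) := by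
  rw [holEquiv_apply]
  change (⟨((Real.sqrt 2)⁻¹ • p.1) j, (((Real.sqrt 2)⁻¹ * (2 * Real.pi)) • p.2) j⟩ : ℂ) = _
  rw [Complex.mk_eq_add_mul_I]
  simp only [PiLp.smul_apply, smul_eq_mul]
  push_cast; ring

lemma norm_sq_holEquiv (p : RSp d × RSp d) : ‖holEquiv d p‖ ^ 2 =
    ‖p.1‖ ^ 2 / 2 + 2 * Real.pi ^ 2 * ‖p.2‖ ^ 2 := by
  rw [holEquiv_apply, norm_sq_ofReIm, norm_smul, norm_smul, mul_pow, mul_pow, Real.norm_eq_abs,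
    Real.norm_eq_abs, sq_abs, sq_abs, mul_pow, inv_pow, Real.sq_sqrt zero_le_two]
  ring

lemma integral_cexp_neg_norm_sq_add (c : Fin d → ℂ) :
    ∫ y : RSp d, Complex.exp (-((‖y‖ ^ 2 : ℝ) : ℂ) + ∑ i, c i * (y i : ℂ)) =
      ((Real.pi ^ ((d : ℝ) / 2) : ℝ) : ℂ) * Complex.exp (∑ i, c i ^ 2 / 4) := by
  have h := GaussianFourier.integral_cexp_neg_mul_sum_add (ι := Fin d) (b := 1) (by simp) c
  rw [← (PiLp.volume_preserving_ofLp (Fin d)).integral_comp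
    (MeasurableEquiv.toLp 2 (Fin d → ℝ)).symm.measurableEmbedding] at h
  rw [← Finset.sum_div, show (4 : ℂ) = 4 * 1 by simp]
  rw [Complex.ofReal_cpow Real.pi_pos.le]
  simp only [div_one, Fintype.card_fin] at h
  rw [Complex.ofReal_div, Complex.ofReal_natCast, Complex.ofReal_ofNat, ← h]
  congr 1; funext y
  rw [EuclideanSpace.norm_sq_eq]
  simp

/-- The factor that relates the Bargmann kernel to the reproducing kernel `e^{⟨z, w⟩}`. -/
noncomputable def phaseFactor (p : RSp d × RSp d) : ℂ :=
  Complex.exp (-((‖holEquiv d p‖ ^ 2 : ℝ) : ℂ) / 2 -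
    Real.pi * ((inner ℝ p.1 p.2 : ℝ) : ℂ) * Complex.I)

lemma continuous_phaseFactor : Continuous (phaseFactor : RSp d × RSp d → ℂ) := by
  unfold phaseFactor; fun_prop

lemma norm_phaseFactor (p : RSp d × RSp d) :
    ‖phaseFactor p‖ = Real.exp (-‖holEquiv d p‖ ^ 2 / 2) := by
  rw [phaseFactor, Complex.norm_exp]
  congr 1
  have h : (-((‖holEquiv d p‖ ^ 2 : ℝ) : ℂ) / 2 -
    Real.pi * ((inner ℝ p.1 p.2 : ℝ) : ℂ) * Complex.I) =
    ((-‖holEquiv d p‖ ^ 2 / 2 : ℝ) : ℂ) + ((-Real.pi * inner ℝ p.1 p.2 : ℝ) : ℂ) * Complex.I := by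
    push_cast; ring
  rw [h, Complex.add_re, Complex.re_ofReal_mul, Complex.ofReal_re, Complex.I_re]
  ring

/-- A Gaussian integral, after completing squares. The outcome is the reproducing kernel of the Fock
space, holomorphic in `w`, times a factor free of `w`. The inner product is conjugate-linear in its
first argument, so the exponent is `∑ conj(q_j) w_j`. -/
lemma fnSTFT_bargmannKernel (w : CSp d) (p : RSp d × RSp d) :
    fnSTFT (bargmannKernel w) p.1 p.2 =
      Complex.exp (inner ℂ (holEquiv d p) w) * phaseFactor p := by
  set c : Fin d → ℂ := fun j => ((Real.sqrt 2 : ℝ) : ℂ) * w j + (p.1 j : ℂ) -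
    2 * Real.pi * (p.2 j : ℂ) * Complex.I with hc
  set A : ℂ := ((Real.pi ^ (-(d : ℝ) / 2) : ℝ) : ℂ) *
    Complex.exp (-(1 / 2) * ∑ j, w j * w j - ((‖p.1‖ ^ 2 : ℝ) : ℂ) / 2) with hA
  have h1 : ∀ y : RSp d, Complex.exp ((-2 * Real.pi * inner ℝ y p.2 : ℝ) * Complex.I) •
      (bargmannKernel w y * gaussWindow (y - p.1)) =
      A * Complex.exp (-((‖y‖ ^ 2 : ℝ) : ℂ) + ∑ i, c i * (y i : ℂ)) := by
    intro y
    have hpi : Real.pi ^ (-(d : ℝ) / 2) = Real.pi ^ (-(d : ℝ) / 4) * Real.pi ^ (-(d : ℝ) / 4) := by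
      rw [← Real.rpow_add Real.pi_pos]; ring_nf
    have hs : ∑ i, c i * (y i : ℂ) = ((Real.sqrt 2 : ℝ) : ℂ) * ∑ j, w j * (y j : ℂ) +
        ((inner ℝ y p.1 : ℝ) : ℂ) - 2 * Real.pi * ((inner ℝ y p.2 : ℝ) : ℂ) * Complex.I := by
      simp only [PiLp.inner_apply, RCLike.inner_apply, conj_trivial, Complex.ofReal_sum,
        Complex.ofReal_mul, Finset.mul_sum, Finset.sum_mul, ← Finset.sum_sub_distrib,
        ← Finset.sum_add_distrib, hc]
      exact Finset.sum_congr rfl fun j _ => by ring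
    rw [hs, hA, bargmannKernel, gaussWindow, norm_sub_sq_real, hpi, smul_eq_mul]
    have e : ∀ a b x y z u v : ℂ, x + y + z = u + v → Complex.exp x * (a * Complex.exp y *
        (b * Complex.exp z)) = a * b * Complex.exp u * Complex.exp v := by
      intro a b x y z u v h
      calc _ = a * b * (Complex.exp x * Complex.exp y * Complex.exp z) := by ring
        _ = _ := by rw [← Complex.exp_add, ← Complex.exp_add, h, Complex.exp_add]; ring
    push_cast
    refine e _ _ _ _ _ _ _ ?_
    ring
  rw [fnSTFT, Real.fourier_eq']
  simp_rw [h1]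
  rw [integral_const_mul, integral_cexp_neg_norm_sq_add, hA, phaseFactor, ← Complex.exp_add]
  have hpi : ((Real.pi ^ (-(d : ℝ) / 2) : ℝ) : ℂ) * ((Real.pi ^ ((d : ℝ) / 2) : ℝ) : ℂ) = 1 := by
    rw [← Complex.ofReal_mul, ← Real.rpow_add Real.pi_pos]; ring_nf; simp
  rw [mul_mul_mul_comm, hpi, one_mul, ← Complex.exp_add]
  congr 1
  have hss : ((Real.sqrt 2 : ℝ) : ℂ) ^ 2 = 2 := by
    rw [← Complex.ofReal_pow, Real.sq_sqrt zero_le_two]; simp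
  have hs0 : ((Real.sqrt 2 : ℝ) : ℂ) ≠ 0 := by
    intro h; rw [h] at hss; norm_num at hss
  rw [norm_sq_holEquiv, EuclideanSpace.norm_sq_eq, EuclideanSpace.norm_sq_eq]
  simp only [PiLp.inner_apply, RCLike.inner_apply, conj_trivial, Complex.ofReal_sum,
    Complex.ofReal_mul, Finset.mul_sum, Finset.sum_mul, ← Finset.sum_sub_distrib, Finset.sum_div,
    ← Finset.sum_add_distrib, hc, Real.norm_eq_abs, sq_abs, holEquiv_coord, Complex.ofReal_add,
    ← Finset.sum_neg_distrib]
  refine Finset.sum_congr rfl fun j _ => ?_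
  have hcj : (starRingEnd ℂ) ((((Real.sqrt 2)⁻¹ : ℝ) : ℂ) *
      ((p.1 j : ℂ) + 2 * Real.pi * (p.2 j : ℂ) * Complex.I)) = (((Real.sqrt 2)⁻¹ : ℝ) : ℂ) *
      ((p.1 j : ℂ) - 2 * Real.pi * (p.2 j : ℂ) * Complex.I) := by
    rw [map_mul, map_add, map_mul, map_mul, map_mul, Complex.conj_ofReal, Complex.conj_ofReal,
      Complex.conj_ofReal, Complex.conj_ofReal, Complex.conj_I, map_ofNat]
    ring
  have hI := Complex.I_sq
  have hinv : (((Real.sqrt 2)⁻¹ : ℝ) : ℂ) = ((Real.sqrt 2 : ℝ) : ℂ) / 2 := by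
    rw [← hss]; push_cast; field_simp
  rw [hcj, hinv]
  push_cast
  linear_combination (w j ^ 2 / 4) * hss + (Real.pi ^ 2 * (p.2 j : ℂ) ^ 2) * hI

end

section

variable {d : ℕ}

/-! ### The reproducing formula -/

/-- The mean value property with respect to a rotation invariant Gaussian. -/
lemma integral_exp_neg_norm_sq_mul {H : CSp d → ℂ} (hH : Differentiable ℂ H) {C c : ℝ} (hc : 0 < c)
    (hb : ∀ z, Real.exp (-‖z‖ ^ 2) * ‖H z‖ ≤ C * Real.exp (-c * ‖z‖ ^ 2)) :
    ∫ z : CSp d, (Real.exp (-‖z‖ ^ 2) : ℂ) * H z =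
      H 0 * ∫ z : CSp d, (Real.exp (-‖z‖ ^ 2) : ℂ) := by
  set f : CSp d → ℂ := fun z => (Real.exp (-‖z‖ ^ 2) : ℂ) * H z with hf
  have hHc := hH.continuous
  have hfc : Continuous f := by fun_prop
  have hfb : ∀ z, ‖f z‖ ≤ C * Real.exp (-c * ‖z‖ ^ 2) := fun z => by
    rw [hf, norm_mul, Complex.norm_real, Real.norm_of_nonneg (Real.exp_nonneg _)]
    exact hb z
  have hrot : ∀ θ : ℝ, ∫ z, f (circleMap 0 1 θ • z) = ∫ z, f z := by
    intro θ
    have hn : ‖circleMap 0 1 θ‖ = 1 := by simp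
    have hmp := measurePreserving_circle_smul d _ hn
    have h0 : circleMap 0 1 θ ≠ 0 := by
      intro h; rw [h] at hn; simp at hn
    exact hmp.integral_comp (Homeomorph.smulOfNeZero _ h0).measurableEmbedding f
  have hmean : ∀ z : CSp d, Real.circleAverage (fun ζ : ℂ => H (ζ • z)) 0 1 = H 0 := by
    intro z
    have hd : Differentiable ℂ fun ζ : ℂ => H (ζ • z) := by fun_prop
    rw [DiffContOnCl.circleAverage hd.diffContOnCl, zero_smul]
  have hnc : ∀ (θ : ℝ) (z : CSp d), ‖circleMap 0 1 θ • z‖ = ‖z‖ := fun θ z => by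
    rw [norm_smul]; simp
  have hpos : (0 : ℝ) < 2 * Real.pi := by positivity
  have hint : Integrable (Function.uncurry fun (θ : ℝ) (z : CSp d) => f (circleMap 0 1 θ • z))
      ((volume.restrict (Set.Ioc 0 (2 * Real.pi))).prod volume) := by
    have hg := (integrable_exp_neg_mul_norm_sq (E := CSp d) hc).const_mul C
    have h1 : Integrable (fun _ : ℝ => (1 : ℝ)) (volume.restrict (Set.Ioc 0 (2 * Real.pi))) :=
      integrable_const _
    refine (h1.mul_prod hg).mono' ?_ (ae_of_all _ fun p => ?_)
    · refine Continuous.aestronglyMeasurable ?_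
      have h2 : Continuous fun p : ℝ × CSp d => circleMap 0 1 p.1 • p.2 :=
        ((continuous_circleMap 0 1).comp continuous_fst).smul continuous_snd
      exact hfc.comp h2
    · rw [one_mul]
      refine (hfb _).trans (le_of_eq ?_)
      rw [hnc]
  -- Integrating `f(e^{iθ}z)` over `θ` and `z` in both orders: rotation invariance makes the
  -- `z`-integral independent of `θ`, while the mean value property on circles replaces `H` by `H
  -- 0`.
  have hswap := integral_integral_swap hint
  simp_rw [hrot] at hswap
  have hR : ∀ z : CSp d, ∫ θ in Set.Ioc 0 (2 * Real.pi), f (circleMap 0 1 θ • z) =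
      (2 * Real.pi : ℝ) * ((Real.exp (-‖z‖ ^ 2) : ℂ) * H 0) := by
    intro z
    have h1 := hmean z
    rw [Real.circleAverage_def, intervalIntegral.integral_of_le hpos.le] at h1
    simp only [hf, hnc]
    rw [integral_const_mul, ← h1]
    simp only [Complex.real_smul]
    push_cast
    field_simp
  simp_rw [hR] at hswap
  rw [integral_const_mul, integral_mul_const, integral_const] at hswap
  simp only [measureReal_restrict_apply_univ, Real.volume_real_Ioc_of_le hpos.le, sub_zero,
    Complex.real_smul] at hswap
  rw [mul_comm (H 0)]
  exact mul_left_cancel₀ (by exact_mod_cast hpos.ne') hswap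

lemma integral_exp_neg_norm_sq_holEquiv :
    ∫ p : RSp d × RSp d, (Real.exp (-‖holEquiv d p‖ ^ 2) : ℂ) = 1 := by
  have h1 : ∀ p : RSp d × RSp d, Real.exp (-‖holEquiv d p‖ ^ 2) =
      Real.exp (-(1 / 2) * ‖p.1‖ ^ 2) * Real.exp (-(2 * Real.pi ^ 2) * ‖p.2‖ ^ 2) := by
    intro p
    rw [norm_sq_holEquiv, ← Real.exp_add]; ring_nf
  have hpi := Real.pi_pos
  simp_rw [h1]
  rw [integral_complex_ofReal, Measure.volume_eq_prod,
    integral_prod_mul (fun x : RSp d => Real.exp (-(1 / 2) * ‖x‖ ^ 2))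
      (fun x : RSp d => Real.exp (-(2 * Real.pi ^ 2) * ‖x‖ ^ 2)),
    GaussianFourier.integral_rexp_neg_mul_sq_norm (by norm_num),
    GaussianFourier.integral_rexp_neg_mul_sq_norm (by positivity), finrank_euclideanSpace_fin,
    ← Real.mul_rpow (by positivity) (by positivity)]
  have : Real.pi / (1 / 2) * (Real.pi / (2 * Real.pi ^ 2)) = 1 := by field_simp
  rw [this]; simp

variable (d) in
-- The Jacobian `k` need not be computed: the Gaussian normalization
-- `integral_exp_neg_norm_sq_holEquiv` accounts for it.
lemma exists_map_holEquiv : ∃ k : ℝ≥0∞,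
    (volume : Measure (RSp d × RSp d)).map (holEquiv d) = k • (volume : Measure (CSp d)) := by
  have : (volume : Measure (RSp d × RSp d)).IsAddHaarMeasure :=
    Measure.prod.instIsAddHaarMeasure volume volume
  have : (volume.map (holEquiv d) : Measure (CSp d)).IsAddHaarMeasure :=
    (holEquiv d).isAddHaarMeasure_map volume
  exact ⟨_, Measure.isAddLeftInvariant_eq_smul _ _⟩

/-- The reproducing formula for entire functions. -/
lemma integral_reproducing {F : CSp d → ℂ} (hF : Differentiable ℂ F) {C : ℝ} (hC : 0 ≤ C)
    (hb : ∀ z, ‖F z‖ ≤ C * Real.exp (3 / 4 * ‖z‖ ^ 2)) (w : CSp d) :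
    ∫ p : RSp d × RSp d, Complex.exp (inner ℂ (holEquiv d p) w) *
      ((Real.exp (-‖holEquiv d p‖ ^ 2) : ℂ) * F (holEquiv d p)) = F w := by
  obtain ⟨k, hk⟩ := exists_map_holEquiv d
  have htrans : ∀ f : CSp d → ℂ, ∫ p : RSp d × RSp d, f (holEquiv d p) =
      k.toReal • ∫ z, f z := by
    intro f
    rw [← integral_smul_measure, ← hk]
    exact ((holEquiv d).toHomeomorph.measurableEmbedding.integral_map f).symm
  have hnorm := integral_exp_neg_norm_sq_holEquiv (d := d)
  rw [htrans fun z => (Real.exp (-‖z‖ ^ 2) : ℂ)] at hnorm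
  rw [htrans fun z => Complex.exp (inner ℂ z w) * ((Real.exp (-‖z‖ ^ 2) : ℂ) * F z),
    ← integral_add_right_eq_self _ w]
  -- After translation by `w`, the kernel and the Gaussian combine to `exp(-‖z‖²) exp(-⟨w, z⟩)`. The
  -- second factor is holomorphic in `z`, and `H 0 = F w`.
  set H : CSp d → ℂ := fun z => Complex.exp (-innerSL ℂ w z) * F (z + w) with hHdef
  have hH : Differentiable ℂ H := by
    have h1 : Differentiable ℂ fun z => Complex.exp (-innerSL ℂ w z) :=
      ((innerSL ℂ w).differentiable.neg).cexp
    have h2 : Differentiable ℂ fun z => F (z + w) := hF.comp (differentiable_id.add_const w)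
    exact h1.mul h2
  have hshift : ∀ z : CSp d, Complex.exp (inner ℂ (z + w) w) *
      ((Real.exp (-‖z + w‖ ^ 2) : ℂ) * F (z + w)) = (Real.exp (-‖z‖ ^ 2) : ℂ) * H z := by
    intro z
    have h2 : ((‖z + w‖ ^ 2 : ℝ) : ℂ) = ((‖z‖ ^ 2 : ℝ) : ℂ) + inner ℂ z w + inner ℂ w z +
        ((‖w‖ ^ 2 : ℝ) : ℂ) := by
      have := inner_self_eq_norm_sq_to_K (𝕜 := ℂ) (z + w)
      rw [inner_add_left, inner_add_right, inner_add_right, inner_self_eq_norm_sq_to_K,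
        inner_self_eq_norm_sq_to_K] at this
      push_cast
      simp only [Complex.coe_algebraMap] at this
      rw [← this]; ring
    rw [hHdef, inner_add_left, inner_self_eq_norm_sq_to_K]
    simp only [innerSL_apply_apply]
    rw [← mul_assoc, ← mul_assoc, Complex.ofReal_exp, Complex.ofReal_exp, ← Complex.exp_add,
      ← Complex.exp_add]
    congr 2
    rw [Complex.ofReal_neg, Complex.ofReal_neg, h2]
    simp only [Complex.coe_algebraMap]
    push_cast
    ring
  simp_rw [hshift]
  -- Growth at rate `3/4 < 1` leaves decay at rate `1/16` once the cross terms with `w` have been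
  -- absorbed into `exp(10‖w‖²)`.
  rw [integral_exp_neg_norm_sq_mul hH (C := C * Real.exp (10 * ‖w‖ ^ 2)) (c := 1 / 16)
    (by norm_num), ← mul_smul_comm, hnorm]
  · simp [hHdef]
  · intro z
    have h1 : ‖H z‖ ≤ Real.exp (‖w‖ * ‖z‖) * (C * Real.exp (3 / 4 * ‖z + w‖ ^ 2)) := by
      rw [hHdef, norm_mul]
      refine mul_le_mul ?_ (hb _) (norm_nonneg _) (Real.exp_nonneg _)
      rw [Complex.norm_exp, Real.exp_le_exp]
      refine (Complex.re_le_norm _).trans ?_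
      rw [norm_neg, innerSL_apply_apply]
      exact norm_inner_le_norm w z
    have h2 : ‖z + w‖ ^ 2 ≤ (‖z‖ + ‖w‖) ^ 2 :=
      pow_le_pow_left₀ (norm_nonneg _) (norm_add_le _ _) 2
    calc Real.exp (-‖z‖ ^ 2) * ‖H z‖
        ≤ Real.exp (-‖z‖ ^ 2) * (Real.exp (‖w‖ * ‖z‖) *
          (C * Real.exp (3 / 4 * (‖z‖ + ‖w‖) ^ 2))) := by
          refine mul_le_mul_of_nonneg_left (h1.trans ?_) (Real.exp_nonneg _)
          gcongr
      _ = C * Real.exp (-‖z‖ ^ 2 + ‖w‖ * ‖z‖ + 3 / 4 * (‖z‖ + ‖w‖) ^ 2) := by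
          rw [Real.exp_add, Real.exp_add]; ring
      _ ≤ C * Real.exp (10 * ‖w‖ ^ 2 + -(1 / 16) * ‖z‖ ^ 2) := by
          refine mul_le_mul_of_nonneg_left (Real.exp_le_exp.2 ?_) hC
          nlinarith [sq_nonneg (‖z‖ - 8 * ‖w‖), sq_nonneg (‖z‖ - 7 * ‖w‖), sq_nonneg ‖w‖]
      _ = _ := by rw [Real.exp_add]; ring

end

section

variable {d : ℕ}

/-! ### Distributions with a given short-time Fourier transform -/

lemma integrable_fnSTFT_integrand {g : RSp d → ℂ} (hg : Continuous g) (hi : Integrable g)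
    (x η : RSp d) : Integrable fun y => Complex.exp ((-2 * Real.pi * inner ℝ y η : ℝ) * Complex.I) •
      (g y * gaussWindow (y - x)) := by
  have hcw := continuous_gaussWindow (d := d)
  refine (hi.norm.mul_const (Real.pi ^ (-(d : ℝ) / 4))).mono'
    (Continuous.aestronglyMeasurable (by fun_prop)) (ae_of_all _ fun y => ?_)
  rw [norm_smul, Complex.norm_exp_ofReal_mul_I, one_mul, norm_mul, norm_gaussWindow]
  refine mul_le_mul_of_nonneg_left (mul_le_of_le_one_right (by positivity) ?_) (norm_nonneg _)
  rw [Real.exp_le_one_iff]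
  nlinarith [sq_nonneg ‖y - x‖]

lemma fnSTFT_add {f g : RSp d → ℂ} (hf : Continuous f) (hfi : Integrable f) (hg : Continuous g)
    (hgi : Integrable g) (x η : RSp d) : fnSTFT (f + g) x η = fnSTFT f x η + fnSTFT g x η := by
  simp only [fnSTFT, Real.fourier_eq']
  rw [← integral_add (integrable_fnSTFT_integrand hf hfi x η)
    (integrable_fnSTFT_integrand hg hgi x η)]
  congr 1; funext y
  rw [Pi.add_apply, add_mul, smul_add]

lemma fnSTFT_smul (a : ℂ) (g : RSp d → ℂ) (x η : RSp d) :
    fnSTFT (a • g) x η = a * fnSTFT g x η := by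
  simp only [fnSTFT, Real.fourier_eq']
  rw [← integral_const_mul]
  congr 1; funext y
  rw [Pi.smul_apply, smul_eq_mul, smul_eq_mul, smul_eq_mul]
  ring

lemma GelfandShilov.exists_gsBound (φ : GelfandShilov d (1 / 2)) :
    ContDiff ℝ (⊤ : ℕ∞) (φ : RSp d → ℂ) ∧ ∃ h M : ℝ, 0 < h ∧ GSBound h M (φ : RSp d → ℂ) := by
  obtain ⟨hs, h, hh, hφ⟩ := φ.2
  exact ⟨hs, h, _, hh, GSBound.of_gsNorm hh hφ⟩

lemma integrable_fnSTFT_mul {G : RSp d × RSp d → ℂ} (hG : Continuous G)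
    (hGb : ∀ ε : ℝ, 0 < ε → ∃ C : ℝ, ∀ p, ‖G p‖ ≤ C * Real.exp (ε * (‖p.1‖ ^ 2 + ‖p.2‖ ^ 2)))
    (φ : GelfandShilov d (1 / 2)) :
    Integrable fun p : RSp d × RSp d => fnSTFT (φ : RSp d → ℂ) p.1 p.2 * G p := by
  obtain ⟨hs, h, M, hh, hM⟩ := GelfandShilov.exists_gsBound φ
  obtain ⟨C, c, hC, hc, hV⟩ := exists_norm_fnSTFT_le d hh
  obtain ⟨D, hD⟩ := hGb (c / 2) (by positivity)
  exact integrable_phaseSpace_mul (mul_nonneg hC hM.nonneg) (by linarith : c / 2 < c)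
    (hM.continuous_fnSTFT hh hs) hG (fun p => hV _ M hs hM p.1 p.2) hD

/-- Transforms of functions in `𝒮_{1/2,h}` decay at a rate `c` that tends to depend on `h`, so
growth of `G` below every Gaussian rate is what makes the integral converge on each of these spaces.
The bound is linear in the norm, which gives continuity. -/
lemma exists_gsDual_of_growth {G : RSp d × RSp d → ℂ} (hG : Continuous G)
    (hGb : ∀ ε : ℝ, 0 < ε → ∃ C : ℝ, ∀ p, ‖G p‖ ≤ C * Real.exp (ε * (‖p.1‖ ^ 2 + ‖p.2‖ ^ 2))) :
    ∃ u : GelfandShilovDual d (1 / 2), ∀ φ : GelfandShilov d (1 / 2),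
      u.1 φ = ∫ p : RSp d × RSp d, fnSTFT (φ : RSp d → ℂ) p.1 p.2 * G p := by
  refine ⟨⟨{ toFun := fun φ => ∫ p : RSp d × RSp d, fnSTFT (φ : RSp d → ℂ) p.1 p.2 * G p
             map_add' := fun φ ψ => ?_
             map_smul' := fun a φ => ?_ }, fun h hh => ?_⟩, fun φ => rfl⟩
  · rw [← integral_add (integrable_fnSTFT_mul hG hGb φ) (integrable_fnSTFT_mul hG hGb ψ)]
    congr 1; funext p
    obtain ⟨hs, h, M, hh, hM⟩ := GelfandShilov.exists_gsBound φ
    obtain ⟨hs', h', M', hh', hM'⟩ := GelfandShilov.exists_gsBound ψ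
    rw [Submodule.coe_add, fnSTFT_add hs.continuous (hM.integrable hh hs) hs'.continuous
      (hM'.integrable hh' hs'), add_mul]
  · rw [RingHom.id_apply, smul_eq_mul, ← integral_const_mul]
    congr 1; funext p
    rw [Submodule.coe_smul, fnSTFT_smul, mul_assoc]
  · obtain ⟨C, c, hC, hc, hV⟩ := exists_norm_fnSTFT_le d hh
    obtain ⟨D, hD⟩ := hGb (c / 2) (by positivity)
    set K : ℝ := ∫ p : RSp d × RSp d, C * D * Real.exp (-(c / 2) * (‖p.1‖ ^ 2 + ‖p.2‖ ^ 2))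
    refine ⟨K.toNNReal, fun φ hφ => ?_⟩
    have hM := GSBound.of_gsNorm hh hφ
    set M := (gsNorm (1 / 2) h (φ : RSp d → ℂ)).toReal with hMdef
    have hint := (integrable_exp_prod d (c := c / 2) (by positivity)).const_mul (C * D)
    have h1 : ‖∫ p : RSp d × RSp d, fnSTFT (φ : RSp d → ℂ) p.1 p.2 * G p‖ ≤ K * M := by
      rw [← integral_mul_const]
      refine norm_integral_le_of_norm_le (hint.mul_const M) (ae_of_all _ fun p => ?_)
      rw [norm_mul]
      refine (mul_le_mul (hV _ M φ.2.1 hM p.1 p.2) (hD p) (norm_nonneg _)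
        (mul_nonneg (mul_nonneg hC hM.nonneg) (Real.exp_nonneg _))).trans (le_of_eq ?_)
      have : Real.exp (-(c / 2) * (‖p.1‖ ^ 2 + ‖p.2‖ ^ 2)) =
          Real.exp (-c * (‖p.1‖ ^ 2 + ‖p.2‖ ^ 2)) *
            Real.exp (c / 2 * (‖p.1‖ ^ 2 + ‖p.2‖ ^ 2)) := by
        rw [← Real.exp_add]; ring_nf
      rw [this]; ring
    change ‖∫ p : RSp d × RSp d, fnSTFT (φ : RSp d → ℂ) p.1 p.2 * G p‖ₑ ≤ _
    rw [← ofReal_norm, ← ENNReal.ofReal_toReal hφ.ne, ← hMdef]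
    refine (ENNReal.ofReal_le_ofReal h1).trans ?_
    rw [ENNReal.ofReal_mul' hM.nonneg]
    rfl

/-! ### The Bargmann transform of a distribution -/

/-- In this form `w` occurs only in the exponential, so holomorphy reduces to differentiation under
the integral sign. -/
lemma bargmann_eq_integral (u : GelfandShilovDual d (1 / 2)) (w : CSp d) :
    bargmann u w = ∫ p : RSp d × RSp d, Complex.exp (inner ℂ (holEquiv d p) w) *
      (phaseFactor p * u.1 (atomGS p)) := by
  change u.1 ⟨bargmannKernel w, bargmannKernel_mem w⟩ = _
  rw [gsDual_apply_eq_integral]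
  congr 1; funext p
  rw [fnSTFT_bargmannKernel, mul_assoc]

lemma norm_sq_le_norm_sq_holEquiv (p : RSp d × RSp d) :
    ‖p.1‖ ^ 2 + ‖p.2‖ ^ 2 ≤ 2 * ‖holEquiv d p‖ ^ 2 := by
  rw [norm_sq_holEquiv]
  nlinarith [sq_nonneg ‖p.2‖, Real.pi_gt_three, mul_nonneg (sq_nonneg ‖p.2‖)
    (show 0 ≤ 4 * Real.pi ^ 2 - 1 by nlinarith [Real.pi_gt_three])]

/-- Laplace transforms of Gaussian-decaying functions are entire. -/
lemma differentiable_integral_exp_inner {G : RSp d × RSp d → ℂ} (hG : Continuous G) {C : ℝ}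
    (hb : ∀ p, ‖G p‖ ≤ C * Real.exp (-(1 / 4) * ‖holEquiv d p‖ ^ 2)) :
    Differentiable ℂ fun w : CSp d =>
      ∫ p : RSp d × RSp d, Complex.exp (inner ℂ (holEquiv d p) w) * G p := by
  intro w₀
  have hC : 0 ≤ C := by
    have := (norm_nonneg _).trans (hb 0)
    exact nonneg_of_mul_nonneg_left this (Real.exp_pos _)
  have hLc : Continuous fun p : RSp d × RSp d => innerSL ℂ (holEquiv d p) :=
    (innerSL ℂ).continuous.comp (holEquiv d).continuous
  have hcont : ∀ w : CSp d, Continuous fun p : RSp d × RSp d =>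
      Complex.exp (inner ℂ (holEquiv d p) w) * G p := fun w => by fun_prop
  set R : ℝ := ‖w₀‖ + 1
  have hgauss : Integrable fun p : RSp d × RSp d => C * Real.exp (4 * (R + 1) ^ 2) *
      Real.exp (-(1 / 16) * (‖p.1‖ ^ 2 + ‖p.2‖ ^ 2)) :=
    (integrable_exp_prod d (by norm_num)).const_mul _
  -- The additional factor `exp ‖holEquiv d p‖` dominates both `1` and `‖holEquiv d p‖`, so one
  -- bound serves the integrand and its derivative in `w`.
  have hmain : ∀ w ∈ Metric.ball w₀ 1, ∀ p : RSp d × RSp d,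
      ‖Complex.exp (inner ℂ (holEquiv d p) w) * G p‖ * Real.exp ‖holEquiv d p‖ ≤
        C * Real.exp (4 * (R + 1) ^ 2) * Real.exp (-(1 / 16) * (‖p.1‖ ^ 2 + ‖p.2‖ ^ 2)) := by
    intro w hw p
    have hwR : ‖w‖ ≤ R := by
      have := norm_add_le w₀ (w - w₀)
      rw [Metric.mem_ball, dist_eq_norm] at hw
      rw [add_sub_cancel] at this
      linarith
    have h1 : ‖Complex.exp (inner ℂ (holEquiv d p) w)‖ ≤ Real.exp (R * ‖holEquiv d p‖) := by
      rw [Complex.norm_exp, Real.exp_le_exp]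
      refine (Complex.re_le_norm _).trans ((norm_inner_le_norm _ _).trans ?_)
      rw [mul_comm]
      exact mul_le_mul_of_nonneg_right hwR (norm_nonneg _)
    have h2 := norm_sq_le_norm_sq_holEquiv p
    set t := ‖holEquiv d p‖
    calc ‖Complex.exp (inner ℂ (holEquiv d p) w) * G p‖ * Real.exp t
        ≤ (Real.exp (R * t) * (C * Real.exp (-(1 / 4) * t ^ 2))) * Real.exp t := by
          rw [norm_mul]
          exact mul_le_mul_of_nonneg_right (mul_le_mul h1 (hb p) (norm_nonneg _)
            (Real.exp_nonneg _)) (Real.exp_nonneg _)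
      _ = C * Real.exp (R * t + -(1 / 4) * t ^ 2 + t) := by
          rw [Real.exp_add, Real.exp_add]; ring
      _ ≤ C * Real.exp (4 * (R + 1) ^ 2 + -(1 / 16) * (‖p.1‖ ^ 2 + ‖p.2‖ ^ 2)) := by
          refine mul_le_mul_of_nonneg_left (Real.exp_le_exp.2 ?_) hC
          nlinarith [sq_nonneg (t - 4 * (R + 1))]
      _ = _ := by rw [Real.exp_add]; ring
  have key := hasFDerivAt_integral_of_dominated_of_fderiv_le (𝕜 := ℂ) (μ := volume)
    (F := fun (w : CSp d) (p : RSp d × RSp d) => Complex.exp (inner ℂ (holEquiv d p) w) * G p)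
    (F' := fun (w : CSp d) (p : RSp d × RSp d) =>
      (Complex.exp (inner ℂ (holEquiv d p) w) * G p) • innerSL ℂ (holEquiv d p))
    (x₀ := w₀) (bound := fun p => C * Real.exp (4 * (R + 1) ^ 2) *
      Real.exp (-(1 / 16) * (‖p.1‖ ^ 2 + ‖p.2‖ ^ 2)))
    (Metric.ball_mem_nhds w₀ one_pos)
    (Filter.Eventually.of_forall fun w => (hcont w).aestronglyMeasurable)
    (hgauss.mono' (hcont w₀).aestronglyMeasurable (ae_of_all _ fun p => ?_))
    ((hcont w₀).smul hLc).aestronglyMeasurable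
    (ae_of_all _ fun p w hw => ?_) hgauss (ae_of_all _ fun p w _ => ?_)
  · exact key.differentiableAt
  · refine le_trans ?_ (hmain w₀ (Metric.mem_ball_self one_pos) p)
    exact le_mul_of_one_le_right (norm_nonneg _) (Real.one_le_exp (norm_nonneg _))
  · rw [norm_smul, innerSL_apply_norm]
    refine le_trans ?_ (hmain w hw p)
    exact mul_le_mul_of_nonneg_left ((le_add_of_nonneg_right zero_le_one).trans
      (Real.add_one_le_exp _)) (norm_nonneg _)
  · have h1 := (innerSL ℂ (holEquiv d p)).hasFDerivAt (x := w)
    have h2 := (h1.cexp.mul_const (G p))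
    refine h2.congr_fderiv ?_
    rw [smul_smul, mul_comm (G p)]
    rfl

/-- The Bargmann transform of a distribution is entire. -/
lemma differentiable_bargmann (u : GelfandShilovDual d (1 / 2)) : Differentiable ℂ (bargmann u) := by
  have e : bargmann u = fun w => ∫ p : RSp d × RSp d, Complex.exp (inner ℂ (holEquiv d p) w) *
      (phaseFactor p * u.1 (atomGS p)) := funext fun w => bargmann_eq_integral u w
  rw [e]
  -- With `|p|² ≤ 2‖q‖²` for `q = holEquiv d p`, growth at rate `1/8` in `p` costs at most `1/4` of
  -- the rate `1/2` in `q`, leaving the required `1/4`.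
  obtain ⟨C, hC, hb⟩ := exists_norm_apply_atomGS_le u (ε := 1 / 8) (by norm_num)
  refine differentiable_integral_exp_inner (C := C)
    (continuous_phaseFactor.mul (continuous_apply_atomGS u)) fun p => ?_
  rw [norm_mul, norm_phaseFactor]
  have h2 := norm_sq_le_norm_sq_holEquiv p
  calc Real.exp (-‖holEquiv d p‖ ^ 2 / 2) * ‖u.1 (atomGS p)‖
      ≤ Real.exp (-‖holEquiv d p‖ ^ 2 / 2) *
        (C * Real.exp (1 / 8 * (‖p.1‖ ^ 2 + ‖p.2‖ ^ 2))) :=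
        mul_le_mul_of_nonneg_left (hb p) (Real.exp_nonneg _)
    _ = C * Real.exp (-‖holEquiv d p‖ ^ 2 / 2 + 1 / 8 * (‖p.1‖ ^ 2 + ‖p.2‖ ^ 2)) := by
        rw [Real.exp_add]; ring
    _ ≤ _ := by
        refine mul_le_mul_of_nonneg_left (Real.exp_le_exp.2 ?_) hC
        linarith

end

section

variable {d : ℕ}

/-! ### The Bargmann transform and the short-time Fourier transform -/

lemma bargmannKernel_eq_smul (z : CSp d) : bargmannKernel z = (((Real.pi ^ (-(d : ℝ) / 4) : ℝ) : ℂ) *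
    Complex.exp (-(1 / 2) * ∑ j, z j * z j)) •
      gaussDeriv (fun j => ((Real.sqrt 2 : ℝ) : ℂ) * z j) 0 := by
  funext y
  rw [Pi.smul_apply, gaussDeriv_zero_apply, bargmannKernel, smul_eq_mul, mul_assoc,
    ← Complex.exp_add, Finset.mul_sum]
  congr 2
  simp only [mul_assoc]
  ring

lemma conjScale_coord (z : CSp d) (j : Fin d) : conjScale z j =
    ((Real.sqrt 2)⁻¹ : ℝ) * ((rePart z j : ℂ) - Complex.I * (imPart z j : ℂ)) := by
  change (⟨((Real.sqrt 2)⁻¹ • rePart z) j, (-((Real.sqrt 2)⁻¹ • imPart z)) j⟩ : ℂ) = _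
  rw [Complex.mk_eq_add_mul_I]
  simp only [PiLp.smul_apply, PiLp.neg_apply, smul_eq_mul]
  push_cast; ring

/-- Both functions are Gaussians with linear phase, and `√2 · conjScale z = x - iξ` matches the
phases. The remaining scalar is the factor of `bargUInv` without its power of `2π`, which belongs to
`stft`. -/
lemma stftAtom_eq_smul_bargmannKernel (z : CSp d) : stftAtom (rePart z) (imPart z) =
    (((Real.exp (-(‖rePart z‖ ^ 2 + ‖imPart z‖ ^ 2) / 4) : ℝ) : ℂ) *
      Complex.exp (-Complex.I * ((inner ℝ (rePart z) (imPart z) : ℝ) : ℂ) / 2)) •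
        bargmannKernel (conjScale z) := by
  have hss : ((Real.sqrt 2 : ℝ) : ℂ) ^ 2 = 2 := by
    rw [← Complex.ofReal_pow, Real.sq_sqrt zero_le_two]; simp
  have hs0 : ((Real.sqrt 2 : ℝ) : ℂ) ≠ 0 := by
    intro h; rw [h] at hss; norm_num at hss
  have hinv : (((Real.sqrt 2)⁻¹ : ℝ) : ℂ) = ((Real.sqrt 2 : ℝ) : ℂ) / 2 := by
    rw [← hss]; push_cast; field_simp
  rw [stftAtom_eq_smul, bargmannKernel_eq_smul, smul_smul]
  have hw : (fun j => ((Real.sqrt 2 : ℝ) : ℂ) * conjScale z j) =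
      fun j => ofReIm (rePart z) (-imPart z) j := by
    funext j
    have h1 : ofReIm (rePart z) (-imPart z) j = (rePart z j : ℂ) - Complex.I * (imPart z j : ℂ) := by
      change (⟨rePart z j, (-imPart z) j⟩ : ℂ) = _
      rw [Complex.mk_eq_add_mul_I, PiLp.neg_apply]
      push_cast; ring
    rw [h1, conjScale_coord, hinv]
    linear_combination (1 / 2) * ((rePart z j : ℂ) - Complex.I * (imPart z j : ℂ)) * hss
  rw [hw]
  congr 1
  rw [Complex.ofReal_mul, Complex.ofReal_exp, Complex.ofReal_exp]
  rw [mul_left_comm, ← Complex.exp_add, ← Complex.exp_add]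
  congr 2
  have hsum : ∑ j, conjScale z j * conjScale z j = ((‖rePart z‖ ^ 2 : ℝ) : ℂ) / 2 -
      ((‖imPart z‖ ^ 2 : ℝ) : ℂ) / 2 -
      Complex.I * ((inner ℝ (rePart z) (imPart z) : ℝ) : ℂ) := by
    rw [EuclideanSpace.norm_sq_eq, EuclideanSpace.norm_sq_eq]
    simp only [PiLp.inner_apply, RCLike.inner_apply, conj_trivial, Complex.ofReal_sum,
      Complex.ofReal_mul, Finset.mul_sum, ← Finset.sum_sub_distrib,
      Finset.sum_div, Real.norm_eq_abs, sq_abs]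
    refine Finset.sum_congr rfl fun j _ => ?_
    rw [conjScale_coord, hinv]
    push_cast
    linear_combination ((rePart z j : ℂ) - Complex.I * (imPart z j : ℂ)) ^ 2 / 4 * hss +
      (imPart z j : ℂ) ^ 2 / 2 * Complex.I_sq
  rw [hsum]
  push_cast
  ring

/-- The Bargmann transform is the short-time Fourier transform, up to `U_𝔙`. -/
lemma bargUInv_bargmann (f : GelfandShilovDual d (1 / 2)) : bargUInv (bargmann f) = stft f := by
  funext z
  have e : (⟨stftAtom (rePart z) (imPart z), stftAtom_mem _ _⟩ : GelfandShilov d (1 / 2)) =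
      (((Real.exp (-(‖rePart z‖ ^ 2 + ‖imPart z‖ ^ 2) / 4) : ℝ) : ℂ) *
      Complex.exp (-Complex.I * ((inner ℝ (rePart z) (imPart z) : ℝ) : ℂ) / 2)) •
        ⟨bargmannKernel (conjScale z), bargmannKernel_mem _⟩ :=
    Subtype.ext (stftAtom_eq_smul_bargmannKernel z)
  rw [stft, e, map_smul, smul_eq_mul, bargUInv, Complex.ofReal_mul]
  change _ * _ * f.1 ⟨bargmannKernel (conjScale z), bargmannKernel_mem _⟩ = _
  ring

lemma bNorm_bargmann (ω : CSp d → ℝ) (B : MixedSpace (CSp d)) (f : GelfandShilovDual d (1 / 2)) :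
    bNorm ω B (bargmann f) = modNorm ω B f := by
  rw [bNorm, modNorm, bargUInv_bargmann]

variable (d) in
/-- The Bargmann transform is injective. -/
lemma bargmann_injective : Function.Injective (bargmann : GelfandShilovDual d (1 / 2) → CSp d → ℂ) := by
  intro u v h
  have hst : stft u = stft v := by rw [← bargUInv_bargmann, h, bargUInv_bargmann]
  have hatom : ∀ p : RSp d × RSp d, u.1 (atomGS p) = v.1 (atomGS p) := by
    intro p
    have h1 := congrFun hst (ofReIm p.1 (-(2 * Real.pi) • p.2))
    have h0 : (((2 * Real.pi) ^ (-(d : ℝ) / 2) : ℝ) : ℂ) ≠ 0 := by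
      exact_mod_cast (by positivity : (0 : ℝ) < (2 * Real.pi) ^ (-(d : ℝ) / 2)).ne'
    exact mul_left_cancel₀ h0 h1
  refine Subtype.ext (LinearMap.ext fun φ => ?_)
  rw [gsDual_apply_eq_integral, gsDual_apply_eq_integral]
  simp_rw [hatom]

lemma norm_sq_ofReIm_eq_holEquiv (p : RSp d × RSp d) :
    ‖ofReIm p.1 (-(2 * Real.pi) • p.2)‖ ^ 2 = 2 * ‖holEquiv d p‖ ^ 2 := by
  rw [norm_sq_ofReIm, norm_sq_holEquiv, norm_smul, mul_pow, Real.norm_eq_abs, sq_abs]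
  ring

lemma conjScale_ofReIm (p : RSp d × RSp d) :
    conjScale (ofReIm p.1 (-(2 * Real.pi) • p.2)) = holEquiv d p := by
  rw [holEquiv_apply, conjScale]
  change ofReIm ((Real.sqrt 2)⁻¹ • p.1) (-((Real.sqrt 2)⁻¹ • (-(2 * Real.pi) • p.2))) = _
  rw [smul_smul, ← neg_smul]
  congr 2
  ring

/-- At frequency `-2πη` the oscillating factors cancel, and the two half Gaussians `exp(-|q|²/2)`
multiply to the Fock weight. This dictates the constant in front of `bargUInv F` when a distribution
is built from `F`. -/
lemma phaseFactor_mul_bargUInv (F : CSp d → ℂ) (p : RSp d × RSp d) :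
    phaseFactor p * ((((2 * Real.pi) ^ ((d : ℝ) / 2) : ℝ) : ℂ) *
      bargUInv F (ofReIm p.1 (-(2 * Real.pi) • p.2))) =
    (Real.exp (-‖holEquiv d p‖ ^ 2) : ℂ) * F (holEquiv d p) := by
  have h1 : bargUInv F (ofReIm p.1 (-(2 * Real.pi) • p.2)) =
      (((2 * Real.pi) ^ (-(d : ℝ) / 2) *
      Real.exp (-(2 * ‖holEquiv d p‖ ^ 2) / 4) : ℝ) : ℂ) *
    Complex.exp (-Complex.I * ((inner ℝ p.1 (-(2 * Real.pi) • p.2) : ℝ) : ℂ) / 2) *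
    F (holEquiv d p) := by
    rw [← norm_sq_ofReIm_eq_holEquiv, norm_sq_ofReIm, ← conjScale_ofReIm]
    rfl
  have hpi : ((((2 * Real.pi) ^ ((d : ℝ) / 2) : ℝ) : ℂ)) *
      (((2 * Real.pi) ^ (-(d : ℝ) / 2) : ℝ) : ℂ) = 1 := by
    rw [← Complex.ofReal_mul, ← Real.rpow_add (by positivity)]; ring_nf; simp
  have he : phaseFactor p * (Complex.exp (((-(2 * ‖holEquiv d p‖ ^ 2) / 4 : ℝ) : ℂ)) *
      Complex.exp (-Complex.I * ((inner ℝ p.1 (-(2 * Real.pi) • p.2) : ℝ) : ℂ) / 2)) =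
      Complex.exp (((-‖holEquiv d p‖ ^ 2 : ℝ) : ℂ)) := by
    rw [phaseFactor, ← Complex.exp_add, ← Complex.exp_add, inner_smul_right]
    congr 1
    push_cast
    ring
  rw [h1, Complex.ofReal_exp, ← he, Complex.ofReal_mul, Complex.ofReal_exp]
  linear_combination phaseFactor p * (Complex.exp (((-(2 * ‖holEquiv d p‖ ^ 2) / 4 : ℝ) : ℂ)) *
      Complex.exp (-Complex.I * ((inner ℝ p.1 (-(2 * Real.pi) • p.2) : ℝ) : ℂ) / 2)) *
      F (holEquiv d p) * hpi

/-- Every entire function that is subgaussian after `U_𝔙⁻¹` is a Bargmann transform. -/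
lemma exists_bargmann_eq {F : CSp d → ℂ} (hF : Differentiable ℂ F)
    (hb : ∀ ε : ℝ, 0 < ε → ∃ C : ℝ, 0 ≤ C ∧ ∀ z, ‖bargUInv F z‖ ≤ C * Real.exp (ε * ‖z‖ ^ 2)) :
    ∃ u : GelfandShilovDual d (1 / 2), bargmann u = F := by
  have hpi : 0 < 4 * Real.pi ^ 2 := by positivity
  set κ : ℝ := (2 * Real.pi) ^ ((d : ℝ) / 2) with hκ
  have hκ0 : 0 ≤ κ := by positivity
  have hpt : Continuous fun p : RSp d × RSp d => ofReIm p.1 (-(2 * Real.pi) • p.2) :=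
    continuous_ofReIm.comp (f := fun p : RSp d × RSp d => (p.1, -(2 * Real.pi) • p.2)) (by fun_prop)
  have hGc : Continuous fun p : RSp d × RSp d =>
      (κ : ℂ) * bargUInv F (ofReIm p.1 (-(2 * Real.pi) • p.2)) :=
    continuous_const.mul ((continuous_bargUInv hF.continuous).comp hpt)
  obtain ⟨u, hu⟩ := exists_gsDual_of_growth hGc (fun ε hε => by
    obtain ⟨C, hC, hCb⟩ := hb (ε / (4 * Real.pi ^ 2)) (by positivity)
    refine ⟨κ * C, fun p => ?_⟩
    rw [norm_mul, Complex.norm_real, Real.norm_of_nonneg hκ0, mul_assoc]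
    refine mul_le_mul_of_nonneg_left ((hCb _).trans ?_) hκ0
    refine mul_le_mul_of_nonneg_left (Real.exp_le_exp.2 ?_) hC
    rw [div_mul_eq_mul_div, div_le_iff₀ hpi, norm_sq_ofReIm_eq_holEquiv, norm_sq_holEquiv]
    have : 1 ≤ 4 * Real.pi ^ 2 := by nlinarith [Real.pi_gt_three]
    nlinarith [mul_le_mul_of_nonneg_left (mul_le_mul_of_nonneg_right this (sq_nonneg ‖p.1‖)) hε.le])
  refine ⟨u, funext fun w => ?_⟩
  -- Undoing `bargUInv` costs `exp(‖z‖²/2)`. The rate `1/8`, doubled by the scaling by `√2`, adds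
  -- `1/4`, for a total of `3/4`, as the reproducing formula requires.
  obtain ⟨C, hC, hCb⟩ := hb (1 / 8) (by norm_num)
  have hFb : ∀ z, ‖F z‖ ≤ (κ * C) * Real.exp (3 / 4 * ‖z‖ ^ 2) := by
    intro z
    obtain ⟨p, rfl⟩ := (holEquiv d).surjective z
    have h1 := congrArg norm (phaseFactor_mul_bargUInv F p)
    rw [norm_mul, norm_mul, norm_mul, norm_phaseFactor, Complex.norm_real, Complex.norm_real,
      ← hκ, Real.norm_of_nonneg hκ0, Real.norm_of_nonneg (Real.exp_nonneg _)] at h1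
    have h2 := hCb (ofReIm p.1 (-(2 * Real.pi) • p.2))
    rw [norm_sq_ofReIm_eq_holEquiv] at h2
    set t := ‖holEquiv d p‖ ^ 2
    calc ‖F (holEquiv d p)‖ = Real.exp t * (Real.exp (-t) * ‖F (holEquiv d p)‖) := by
          rw [← mul_assoc, ← Real.exp_add]; simp
      _ ≤ Real.exp t * (Real.exp (-t / 2) * (κ * (C * Real.exp (1 / 8 * (2 * t))))) := by
          rw [← h1]; gcongr
      _ = κ * C * (Real.exp t * Real.exp (-t / 2) * Real.exp (1 / 8 * (2 * t))) := by ring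
      _ = _ := by
          rw [← Real.exp_add, ← Real.exp_add]; ring_nf
  rw [← integral_reproducing hF (mul_nonneg hκ0 hC) hFb w]
  change u.1 ⟨bargmannKernel w, bargmannKernel_mem w⟩ = _
  rw [hu]
  congr 1; funext p
  rw [fnSTFT_bargmannKernel, mul_assoc, phaseFactor_mul_bargUInv]

/-! ### Identification of the spaces of entire functions -/

lemma mem_aSpace_of_differentiable (r : ℝ≥0∞) {ω : CSp d → ℝ} {B : MixedSpace (CSp d)}
    {F : CSp d → ℂ} (hF : Differentiable ℂ F) (hFB : bNorm ω B F < ∞) : F ∈ aSpace r ω B := by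
  refine ⟨hF, fun K hK => ?_, hFB⟩
  -- Entire functions are bounded on compact sets, which have finite measure; membership in
  -- `L^r_loc` is therefore automatic for every exponent.
  obtain ⟨C, hC⟩ := hK.exists_bound_of_continuousOn hF.continuous.continuousOn
  have : IsFiniteMeasure ((volume : Measure (CSp d)).restrict K) :=
    isFiniteMeasure_restrict.2 hK.measure_lt_top.ne
  exact MemLp.of_bound hF.continuous.aestronglyMeasurable C
    (ae_restrict_of_forall_mem hK.measurableSet hC)

lemma bijOn_bargmann {B : MixedSpace (CSp d)} {ω : CSp d → ℝ} (hω : IsWeaklySubgaussian ω)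
    {r : ℝ≥0∞} (hr : 0 < r) (hrB : r ≤ B.minExponent) :
    Set.BijOn bargmann (modSpace ω B) (aSpace r ω B) := by
  refine ⟨fun f hf => ?_, (bargmann_injective d).injOn, fun F hF => ?_⟩
  · exact mem_aSpace_of_differentiable r (differentiable_bargmann f)
      ((bNorm_bargmann ω B f).trans_lt hf)
  -- Growth below every Gaussian rate makes `F` the transform of some distribution `u`; equality of
  -- the quasi-norms then puts `u` into the modulation space.
  · obtain ⟨u, rfl⟩ := exists_bargmann_eq hF.1 fun ε hε =>
      exists_norm_bargUInv_le hω hr hrB hF.1 hF.2.2 hε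
    exact ⟨u, (bNorm_bargmann ω B u).symm.trans_lt hF.2.2, rfl⟩

lemma aZeroNorm_bargmann {ω : CSp d → ℝ} {B : MixedSpace (CSp d)} {f : GelfandShilovDual d (1 / 2)}
    (hf : f ∈ modSpace ω B) : aZeroNorm ω B (bargmann f) = modNorm ω B f := by
  refine le_antisymm (iInf₂_le f ⟨hf, rfl⟩) (le_iInf₂ fun g hg => ?_)
  rw [bargmann_injective d hg.2]

end

end BargmannMod

open BargmannMod in
theorem theorem3 (d : ℕ) (B : MixedSpace (CSp d)) (ω : CSp d → ℝ) (hω : IsWeaklySubgaussian ω)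
    (r : ℝ≥0∞) (hr : 0 < r) (hrB : r ≤ B.minExponent) :
    aZeroSpace ω B = aSpace r ω B ∧
    (∀ F ∈ aSpace r ω B, aZeroNorm ω B F = bNorm ω B F) ∧
    Set.BijOn bargmann (modSpace ω B) (aSpace r ω B) ∧
    (∀ f ∈ modSpace ω B, bNorm ω B (bargmann f) = modNorm ω B f) := by
  have hbij := bijOn_bargmann hω hr hrB
  refine ⟨hbij.image_eq, fun F hF => ?_, hbij, fun f _ => bNorm_bargmann ω B f⟩
  obtain ⟨f, hf, rfl⟩ := hbij.surjOn hF
  rw [aZeroNorm_bargmann hf, bNorm_bargmann]
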